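/- Let $K$ be an algebraically closed field of characteristic zero, let $M\ge 4$, and let $\mathcal P_d$ be the affine space of forms of degree $d$ in $x_0,\dots,x_M$ over $K$. For $f\in\mathcal P_{2(M-1)}$ let $W=\{f=0\}\subset\mathbb P^M$, and let $V\subset\mathbb P(1^{M+1},M-1)$ be the double space $x_{M+1}^2=f(x_0,\dots,x_M)$ branched over $W$. Let $H$ be the pull back to $V$ of a hyperplane of $\mathbb P^M$. A line on $V$ is an irreducible curve $C\subset V$ with $(C\cdot H)=1$. For a line $L\subset\mathbb P^M$ say that $W|_L$ is divisible by $2$ if $L\subset W$ or the divisor $W|_L$ on $L$ has even multiplicity at every point. (1) There is a non-empty Zariski open subset of $\mathcal P_{2(M-1)}$ such that for every $f$ in it the hypersurface $W$ is smooth, through every point of $V$ there passes at least one and only finitely many lines on $V$, and for every point $x\in\mathbb P^M$ there are only finitely many lines $L\ni x$ in $\mathbb P^M$ such that $W|_L$ is divisible by $2$. (2) For every $f\in\mathcal P_{2(M-1)}$ with $W$ smooth, the following are equivalent: through every point of $V$ there pass only finitely many lines on $V$; for every point $x\in\mathbb P^M$ there are only finitely many lines $L\ni x$ such that $W|_L$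 is divisible by $2$. (3) For every point $x\in\mathbb P^M$, the set of all $F\in\mathcal P_{2(M-1)}$ for which there are infinitely many lines $L\ni x$ such that $F|_L$ is the square of a form of degree $M-1$ on $L$ has codimension at least $M+1$ in $\mathcal P_{2(M-1)}$ (the codimension of a set being that of its Zariski closure). -/

import Mathlib

open scoped LinearAlgebra.Projectivization

/-- Exponents of the monomials of degree `d` in the homogeneous coordinates `x₀, …, x_M`
of `ℙ^M`. -/
abbrev FormIndex (M d : ℕ) : Type :=
  ↥((Finset.univ : Finset (Fin (M + 1))).finsuppAntidiag d)

/-- The form of degree `d` on `ℙ^M` with coefficient vector `c`. In this way the space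
`𝒫_d(ℙ^M)` of all forms of degree `d` is the affine space `FormIndex M d → K`. -/
noncomputable def formOf {K : Type*} [Field K] {M d : ℕ} (c : FormIndex M d → K) :
    MvPolynomial (Fin (M + 1)) K :=
  ∑ m : FormIndex M d, MvPolynomial.monomial m.1 (c m)

/-- The codimension of a subset `S` of the affine space `ι → K` (that is, of its Zariski closure):
the height of the ideal of all polynomials vanishing on `S`. It is `⊤` for `S = ∅`. -/
noncomputable def zariskiCodim {K ι : Type*} [Field K] (S : Set (ι → K)) : ℕ∞ :=
  (MvPolynomial.vanishingIdeal K S).height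

/-- The hypersurface `f = 0` in `ℙ^M` is smooth (Jacobian criterion). -/
def IsSmoothForm {K : Type*} [Field K] {M : ℕ} (f : MvPolynomial (Fin (M + 1)) K) : Prop :=
  ∀ x : Fin (M + 1) → K, x ≠ 0 → MvPolynomial.eval x f = 0 →
    ∃ i, MvPolynomial.eval x (MvPolynomial.pderiv i f) ≠ 0

/-- The lines in `ℙ^M` through the point `x`: planes `L` in `K^{M+1}` containing the line
`x` in `K^{M+1}`. -/
def linesThrough {K : Type*} [Field K] {M : ℕ} (x : ℙ K (Fin (M + 1) → K)) :
    Set (Submodule K (Fin (M + 1) → K)) :=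
  {L | Module.finrank K L = 2 ∧ x.submodule ≤ L}

/-- The restriction `f(u + t v)` of `f` to the line spanned by `u` and `v`, in the affine
coordinate `t` with origin at `u`. -/
noncomputable def restrictToLine {K : Type*} [Field K] {M : ℕ}
    (f : MvPolynomial (Fin (M + 1)) K) (u v : Fin (M + 1) → K) : Polynomial K :=
  MvPolynomial.aeval (fun i => Polynomial.C (u i) + Polynomial.C (v i) * Polynomial.X) f

/-- For `W = {f = 0}`: either the line `L` is contained in `W`, or the divisor `W|_L` on `L` is
divisible by `2`, that is, for every point `u` of `L` the multiplicity at `u` of the restriction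
of `f` to `L` is even. -/
def DivisibleByTwoOn {K : Type*} [Field K] {M : ℕ}
    (f : MvPolynomial (Fin (M + 1)) K) (L : Submodule K (Fin (M + 1) → K)) : Prop :=
  (∀ u ∈ L, MvPolynomial.eval u f = 0) ∨
    ∀ u ∈ L, ∀ v ∈ L, LinearIndependent K ![u, v] →
      Even ((restrictToLine f u v).rootMultiplicity 0)

/-- The restriction of `f` to the line `L` is the square of a form of degree `k` on `L`, that is,
`f|_L ∈ [𝒫_k(L)]²`. (Forms on `L` are the restrictions of forms on `ℙ^M`.) -/
def IsSquareOn {K : Type*} [Field K] {M : ℕ} (k : ℕ)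
    (f : MvPolynomial (Fin (M + 1)) K) (L : Submodule K (Fin (M + 1) → K)) : Prop :=
  ∃ g : MvPolynomial (Fin (M + 1)) K, g.IsHomogeneous k ∧
    ∀ u ∈ L, MvPolynomial.eval u f = MvPolynomial.eval u g ^ 2

/-- Forms `F` of degree `2(M-1)` such that infinitely many lines `L ∋ x` satisfy
`F|_L ∈ [𝒫_{M-1}(L)]²`. -/
def badForms {K : Type*} [Field K] {M : ℕ} (x : ℙ K (Fin (M + 1) → K)) :
    Set (FormIndex M (2 * (M - 1)) → K) :=
  {c | {L | L ∈ linesThrough x ∧ IsSquareOn (M - 1) (formOf c) L}.Infinite}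

/-- The weights of the coordinates of `ℙ(1, …, 1, M-1)`: the coordinates `some i` are
`x₀, …, x_M`, of weight `1`, and `none` is the last coordinate `x_{M+1}`, of weight `M - 1`. -/
def coordWeight (M : ℕ) : Option (Fin (M + 1)) → ℕ
  | some _ => 1
  | none => M - 1

/-- Nonzero vectors of `K^{M+2}` up to the weighted action of `Kˣ`. -/
def weightedSetoid (K : Type*) [Field K] (M : ℕ) :
    Setoid {v : Option (Fin (M + 1)) → K // v ≠ 0} where
  r v v' := ∃ t : Kˣ, ∀ i, v'.1 i = (t : K) ^ coordWeight M i * v.1 i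
  iseqv :=
    { refl := fun _ => ⟨1, fun _ => by simp⟩
      symm := fun {v v'} ⟨t, h⟩ => ⟨t⁻¹, fun i => by
        rw [h i, ← mul_assoc, ← mul_pow]; simp⟩
      trans := fun {v v' v''} ⟨t, h⟩ ⟨s, h'⟩ => ⟨s * t, fun i => by
        rw [h' i, h i]; push_cast; ring⟩ }

/-- The (closed points of the) weighted projective space `ℙ(1, …, 1, M-1)`, with `M + 1` weights
equal to `1`. -/
def WeightedProj (K : Type*) [Field K] (M : ℕ) : Type _ := Quotient (weightedSetoid K M)

/-- The point with weighted homogeneous coordinates `v`. -/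
def WeightedProj.mk {K : Type*} [Field K] {M : ℕ} (v : Option (Fin (M + 1)) → K) (hv : v ≠ 0) :
    WeightedProj K M := Quotient.mk (weightedSetoid K M) ⟨v, hv⟩

/-- The coordinate vectors of the points of `C`. -/
def coneOf {K : Type*} [Field K] {M : ℕ} (C : Set (WeightedProj K M)) :
    Set (Option (Fin (M + 1)) → K) :=
  {v | ∃ hv : v ≠ 0, WeightedProj.mk v hv ∈ C}

/-- The double space branched over `f = 0`: the hypersurface
`x_{M+1}² = f(x₀, …, x_M)` in `ℙ(1, …, 1, M-1)`. -/
def doubleSpace {K : Type*} [Field K] {M : ℕ} (f : MvPolynomial (Fin (M + 1)) K) :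
    Set (WeightedProj K M) :=
  {p | ∃ (v : Option (Fin (M + 1)) → K) (hv : v ≠ 0), WeightedProj.mk v hv = p ∧
    v none ^ 2 = MvPolynomial.eval (fun i => v (some i)) f}

/-- The ideal of `C` in the graded ring `K[x₀, …, x_M, x_{M+1}]`. -/
noncomputable def idealOf {K : Type*} [Field K] {M : ℕ} (C : Set (WeightedProj K M)) :
    Ideal (MvPolynomial (Option (Fin (M + 1))) K) :=
  MvPolynomial.vanishingIdeal K (coneOf C)

/-- `C` is an irreducible Zariski closed subset of the weighted projective space. -/
def IsIrreducibleClosed {K : Type*} [Field K] {M : ℕ} (C : Set (WeightedProj K M)) : Prop :=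
  (idealOf C).IsPrime ∧
    ∀ (v : Option (Fin (M + 1)) → K) (hv : v ≠ 0),
      (∀ g ∈ idealOf C, MvPolynomial.eval v g = 0) → WeightedProj.mk v hv ∈ C

/-- The Hilbert function of `C`: the dimension of the component of weighted degree `n` of the
homogeneous coordinate ring of `C`. -/
noncomputable def hilbertFn {K : Type*} [Field K] {M : ℕ} (C : Set (WeightedProj K M))
    (n : ℕ) : ℕ :=
  Module.finrank K
    (Submodule.map (Ideal.Quotient.mkₐ K (idealOf C)).toLinearMap
      (MvPolynomial.weightedHomogeneousSubmodule K (coordWeight M) n))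

/-- `C` is an irreducible curve on the double space `V` with `(C · H) = e`, where `e > 0` and
`H` is the pull back of a hyperplane of `ℙ^M`, that is, the class of `𝒪(1)`. The number
`(C · H)` is the degree of the line bundle `𝒪(1)` on `C`, that is, the leading coefficient of the
Hilbert polynomial `n ↦ χ(C, 𝒪(n)) = (C · H) n + b`, which is the value of the Hilbert function
for `n ≫ 0`; that it has degree one in `n` says that `C` is a curve. -/
def IsCurveOfDegree {K : Type*} [Field K] {M : ℕ} (f : MvPolynomial (Fin (M + 1)) K) (e : ℕ)
    (C : Set (WeightedProj K M)) : Prop :=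
  0 < e ∧ C ⊆ doubleSpace f ∧ IsIrreducibleClosed C ∧
    ∃ b : ℤ, ∀ᶠ n : ℕ in Filter.atTop, (hilbertFn C n : ℤ) = e * n + b

/-- The lines on the double space through its point `p`: the irreducible curves `C ∋ p` with
`(C · H) = 1`. -/
def doubleSpaceLinesThrough {K : Type*} [Field K] {M : ℕ} (f : MvPolynomial (Fin (M + 1)) K)
    (p : WeightedProj K M) : Set (Set (WeightedProj K M)) :=
  {C | IsCurveOfDegree f 1 C ∧ p ∈ C}

/-!
The theorem combines a dimension count for forms that are squares on lines with a description of
the lines on the double space `V`.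

**The dimension count.** Write `M = m + 1`. Over an algebraically closed field a form of degree
`2m` divisible by two on a line is a square there (`DivisibleByTwoOn.exists_sq`). The codimension
of a set of forms is the height of its ideal, and the height of the ideal of a point with
coordinates in an extension field is at least the number of variables minus the transcendence
degree of the coordinates (`card_le_height_ker_add_eRk`). So if the forms that are squares on
infinitely many lines through some point of a family had small codimension, there would be
(`exists_generic_point`) a form `c`, a point `x`, a direction `v` and a square root `H` over an
extension field, with `c|_{x + tv} = H(t)²`, the coefficients `c` of large transcendence degree,
and `v` not algebraic over `c` and `x`. This is impossible by `natRk_add_le_of_square`, which shows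
that `c` then satisfies `m + 2` conditions over `x`.

For this, put `x` at a coordinate point (`shiftForm`) and split `c` into its homogeneous parts
`c_d`, with `c_d(v)` the coefficient of `t ^ d` in `H²`. Let `ρ_d` (`dirRank`) be the transcendence
degree of `v` over `x` and the parts of degree less than `d`. The sequence `ρ_d` decreases from at
most `m` to at least `1`. At a degree `d` where it is stationary, the part `c_d` does not bind `v`:
transcendence bases of `v` over the lower parts can be moved to independent conjugates without
moving `c_d` (`exists_algHom_of_indep`). If moreover `c_d(v)` is algebraic over `v` and the lower
parts, each conjugate gives a linear equation for `c_d`, and these equations are independent, as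
many as there are monomials of degree `d` in `ρ_d + 1` variables
(`eRk_add_card_le_of_relation`, `natRk_coeffsBelow_succ_add_choose_le`). Let `j` be the order of
`H`. There are two ranges of degrees where `c_d(v)` is known: for `j ≤ d < 2j` it is zero, and for
`m + j < d ≤ 2m` it is determined by the coefficients of `H`, hence by the lower parts. These are
`m` degrees, so one of them is stationary, and the binomial coefficient is large enough.

A point moving in an affine space of dimension `r` costs `r` of the `m + 2` conditions
(`le_zariskiCodim_infinite_squareDirections`). With `r = 0` this is the bound for the bad forms at
a fixed point (`le_zariskiCodim_badForms`); with `r = m + 1` one condition remains, so that a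
generic form has only finitely many such lines through every point. The same count, with `M + 1`
conditions for a singularity at a point and `M` parameters for the point, shows that a generic form
is smooth (`one_le_zariskiCodim_singularData`).

**Lines on the double space.** Over a line `L` with `f|_L = g²` the section `x_{M+1} = g` is a line
on `V` (`isCurveOfDegree_lineCurve`). Conversely, let `C` be an irreducible curve with
`(C · H) = 1`. By its Hilbert function the projection of `C` lies on a line (`hilbertFn_add_two_le`)
and `x_{M+1}` is a rational function of the parameters of this line; its square is the form `f|_L`,
so it is itself a form (`IsCurveOfDegree.exists_eq_lineCurve`). Hence over each line on which `f`
is a square lie at most two lines on `V` (`finite_lineCurve`), and every point of `V` over it is on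
one of them (`IsSquareOn.exists_lineCurve`). This gives the equivalence of the two finiteness
properties (`forall_finite_doubleSpaceLinesThrough_iff`).

**Existence.** A direction at a point of `ℙ^M` and a square root with given constant term are
`2m + 1` unknowns, and `2m` equations, with a trivial solution, say that the form is the square of
the root along the direction. By Krull's height theorem there is a nontrivial solution
(`exists_ne_zero_forall_eval_eq_zero`, `exists_isSquareOn`).
-/

universe u

/-! ### Codimension and generic points -/

section GenericPoint

open AlgebraicIndependent

variable {K : Type u} [Field K]

theorem mem_matroid_closure_iff {κ : Type*} [Field κ] [Algebra K κ] {s : Set κ} {z : κ} :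
    z ∈ (matroid K κ).closure s ↔ IsAlgebraic (Algebra.adjoin K s) z := by
  rw [matroid_closure_eq, SetLike.mem_coe, Subalgebra.mem_algebraicClosure]

/-- An algebraic relation over the subalgebra generated by a family lifts to a polynomial relation
whose coefficients are polynomials in the family. -/
theorem exists_polynomial_of_mem_closure_range {κ ι : Type*} [Field κ] [Algebra K κ]
    {p : ι → κ} {z : κ} (hz : z ∈ (matroid K κ).closure (Set.range p)) :
    ∃ q : Polynomial (MvPolynomial ι K),
      q.map (MvPolynomial.aeval p).toRingHom ≠ 0 ∧
      q.eval₂ (MvPolynomial.aeval p).toRingHom z = 0 := by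
  rw [mem_matroid_closure_iff, Algebra.adjoin_range_eq_range_aeval] at hz
  obtain ⟨q, hq0, hq⟩ := hz
  have hs : Function.Surjective (MvPolynomial.aeval (R := K) p).rangeRestrict :=
    AlgHom.rangeRestrict_surjective _
  obtain ⟨q', rfl⟩ := Polynomial.map_surjective
    (MvPolynomial.aeval (R := K) p).rangeRestrict.toRingHom hs q
  have hcomp : (MvPolynomial.aeval (R := K) p).toRingHom =
      (algebraMap (MvPolynomial.aeval (R := K) p).range κ).comp
        (MvPolynomial.aeval (R := K) p).rangeRestrict.toRingHom := by
    ext <;> rfl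
  refine ⟨q', ?_, ?_⟩
  · rw [hcomp, ← Polynomial.map_map]
    rwa [Ne, Polynomial.map_eq_zero_iff]
    exact Subtype.val_injective
  · rw [hcomp, ← Polynomial.eval₂_map]
    exact hq

/-- Substitute `p i` for the variables `X i` with `i ∈ u` and keep the other variables. -/
noncomputable def partialSubst {κ ι : Type*} [Field κ] [Algebra K κ] [DecidableEq ι]
    (p : ι → κ) (u : Finset ι) : MvPolynomial ι K →ₐ[K] MvPolynomial ι κ :=
  MvPolynomial.aeval fun i => if i ∈ u then MvPolynomial.C (p i) else MvPolynomial.X i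

/-- Substituting one more value enlarges the kernel, as the substitution factors. -/
theorem partialSubst_ker_le {κ ι : Type*} [Field κ] [Algebra K κ] [DecidableEq ι]
    (p : ι → κ) (u : Finset ι) (j : ι) :
    RingHom.ker (partialSubst (K := K) p u) ≤
      RingHom.ker (partialSubst (K := K) p (insert j u)) := by
  have : partialSubst (K := K) p (insert j u) = ((MvPolynomial.aeval fun i =>
      if i ∈ insert j u then MvPolynomial.C (p i) else MvPolynomial.X i).restrictScalars K).comp
      (partialSubst (K := K) p u) := by
    ext i : 1
    by_cases hi : i ∈ u
    · simp [partialSubst, hi]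
    · simp [partialSubst, hi]
  intro f hf
  rw [RingHom.mem_ker] at hf ⊢
  rw [this, AlgHom.comp_apply, hf, map_zero]

/-- The height of the ideal of a point with coordinates in an extension field, plus the
transcendence degree of its coordinates, is at least the number of variables. -/
theorem card_le_height_ker_add_eRk {κ ι : Type*} [Field κ] [Algebra K κ] [Fintype ι]
    (p : ι → κ) :
    (Fintype.card ι : ℕ∞) ≤ (RingHom.ker (MvPolynomial.aeval (R := K) p)).height +
      (matroid K κ).eRk (Set.range p) := by
  classical
  -- The kernels of the partial substitutions form a chain of primes; the inclusion that belongs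
  -- to `j` is strict as soon as `p j` is algebraic over the values substituted before.
  have key : ∀ u : Finset ι, (u.card : ℕ∞) ≤
      (RingHom.ker (partialSubst (K := K) p u)).height + (matroid K κ).eRk (p '' u) := by
    intro u
    induction u using Finset.induction_on with
    | empty => simp
    | insert j u hj ih =>
      have hprime : ∀ u, (RingHom.ker (partialSubst (K := K) p u)).IsPrime := fun u =>
        RingHom.ker_isPrime _
      have hle := partialSubst_ker_le (K := K) p u j
      rw [Finset.card_insert_of_notMem hj, Finset.coe_insert, Set.image_insert_eq]
      push_cast
      by_cases hcl : p j ∈ (matroid K κ).closure (p '' u)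
      · have hr : (matroid K κ).eRk (insert (p j) (p '' u)) = (matroid K κ).eRk (p '' u) := by
          rw [← (matroid K κ).eRk_closure_eq, (matroid K κ).closure_insert_eq_of_mem_closure hcl,
            (matroid K κ).eRk_closure_eq]
        rw [hr]
        have hlt : RingHom.ker (partialSubst (K := K) p u) <
            RingHom.ker (partialSubst (K := K) p (insert j u)) := by
          refine lt_of_le_of_ne hle fun heq => ?_
          rw [Set.image_eq_range] at hcl
          obtain ⟨q, hq0, hq⟩ := exists_polynomial_of_mem_closure_range hcl
          let f : MvPolynomial ι K := q.eval₂ (MvPolynomial.rename Subtype.val).toRingHom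
            (MvPolynomial.X j)
          have hf : ∀ v : Finset ι, u ⊆ v → partialSubst (K := K) p v f =
              (q.map (MvPolynomial.aeval fun i : (u : Set ι) => p i).toRingHom).eval₂
                MvPolynomial.C (if j ∈ v then MvPolynomial.C (p j) else MvPolynomial.X j) := by
            intro v huv
            change (partialSubst (K := K) p v).toRingHom (Polynomial.eval₂ _ _ q) = _
            rw [Polynomial.hom_eval₂, Polynomial.eval₂_map]
            congr 1
            · apply MvPolynomial.ringHom_ext
              · intro r
                simp [partialSubst, MvPolynomial.algebraMap_eq]
              · intro i
                have : (i : ι) ∈ v := huv i.2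
                simp [partialSubst, this]
            · simp [partialSubst]
          have h1 : f ∈ RingHom.ker (partialSubst (K := K) p (insert j u)) := by
            rw [RingHom.mem_ker, hf _ (Finset.subset_insert _ _),
              if_pos (Finset.mem_insert_self _ _), Polynomial.eval₂_at_apply, Polynomial.eval_map,
              hq, map_zero]
          rw [← heq, RingHom.mem_ker, hf u subset_rfl, if_neg hj] at h1
          apply hq0
          have h2 := congrArg (MvPolynomial.aeval (R := κ) fun _ : ι => Polynomial.X (R := κ)) h1
          rw [map_zero] at h2
          rw [← h2, ← AlgHom.coe_toRingHom, Polynomial.hom_eval₂]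
          conv_lhs => rw [← Polynomial.eval₂_C_X (p := Polynomial.map _ q)]
          congr 1
          · ext r : 1
            simp [Polynomial.algebraMap_eq]
          · simp
        have := Ideal.height_add_one_le_of_lt_of_isPrime hlt
        calc (u.card : ℕ∞) + 1
            ≤ ((RingHom.ker (partialSubst (K := K) p u)).height +
              (matroid K κ).eRk (p '' u)) + 1 := by gcongr
          _ = ((RingHom.ker (partialSubst (K := K) p u)).height + 1) +
              (matroid K κ).eRk (p '' u) := by ring
          _ ≤ _ := by gcongr
      · rw [(matroid K κ).eRk_insert_eq_add_one ⟨Set.mem_univ _, hcl⟩, ← add_assoc]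
        gcongr
        refine ih.trans ?_
        gcongr
  have h := key Finset.univ
  have hker : RingHom.ker (partialSubst (K := K) p Finset.univ) =
      RingHom.ker (MvPolynomial.aeval (R := K) p) := by
    have : partialSubst (K := K) p Finset.univ =
        (IsScalarTower.toAlgHom K κ (MvPolynomial ι κ)).comp (MvPolynomial.aeval p) := by
      ext i : 1
      simp [partialSubst, MvPolynomial.algebraMap_eq]
    ext f
    rw [RingHom.mem_ker, RingHom.mem_ker, this, AlgHom.comp_apply]
    rw [IsScalarTower.toAlgHom_apply, MvPolynomial.algebraMap_eq,
      map_eq_zero_iff _ (MvPolynomial.C_injective ι κ)]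
  simpa [hker] using h

/-- **Generic points.** Let the projection of `S₁` to the coordinates `e₁` have codimension at most
`k`, and let over each point of `S₁` the coordinate `w` take infinitely many values on `T`. Then
there is a point with coordinates in an extension field that satisfies all algebraic relations
valid on `T`, whose coordinates `e₁` have transcendence degree at least `card ι - k`, and over
whose coordinates `e` the coordinate `w` is transcendental. -/
theorem exists_generic_point {ι ι₁ τ : Type} [Fintype ι] (e₁ : ι → ι₁) {S₁ : Set (ι₁ → K)} {k : ℕ}
    (hS : ¬ ((k + 1 : ℕ) : ℕ∞) ≤ zariskiCodim ((fun s => s ∘ e₁) '' S₁)) (T : Set (τ → K))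
    (e : ι₁ → τ) (w : τ) (hT : ∀ s ∈ S₁, {z | ∃ u ∈ T, u ∘ e = s ∧ u w = z}.Infinite) :
    ∃ (κ : Type u) (_ : Field κ) (_ : Algebra K κ) (p : τ → κ),
      (∀ G : MvPolynomial τ K, (∀ u ∈ T, MvPolynomial.aeval u G = 0) →
        MvPolynomial.aeval p G = 0) ∧
      (Fintype.card ι : ℕ∞) ≤ k + (matroid K κ).eRk (Set.range (p ∘ e ∘ e₁)) ∧
      p w ∉ (matroid K κ).closure (Set.range (p ∘ e)) := by
  let T' : Set (τ → K) := {u | u ∈ T ∧ u ∘ e ∈ S₁}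
  obtain ⟨P₀, hP₀min, hP₀k⟩ :
      ∃ P ∈ (MvPolynomial.vanishingIdeal K ((fun s => s ∘ e₁) '' S₁)).minimalPrimes,
      P.height < ((k + 1 : ℕ) : ℕ∞) := by
    rw [zariskiCodim, Ideal.height_eq_inf_minimalPrimes] at hS
    push Not at hS
    simpa [iInf_lt_iff] using hS
  have hcomap : MvPolynomial.vanishingIdeal K ((fun s => s ∘ e₁) '' S₁) =
      (MvPolynomial.vanishingIdeal K S₁).comap
        (MvPolynomial.rename (R := K) e₁).toRingHom := by
    ext G
    simp [MvPolynomial.aeval_rename]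
  rw [hcomap] at hP₀min
  obtain ⟨P, hPmin, hPP₀⟩ := Ideal.exists_minimalPrimes_comap_eq _ _ hP₀min
  have hP : P.IsPrime := hPmin.1.1
  let ψ : Polynomial (MvPolynomial ι₁ K) →+* MvPolynomial τ K :=
    Polynomial.eval₂RingHom (MvPolynomial.rename e).toRingHom (MvPolynomial.X w)
  have hP' : (P.map (Polynomial.C : MvPolynomial ι₁ K →+* _)).IsPrime :=
    Ideal.isPrime_map_C_of_isPrime
  have hle : (MvPolynomial.vanishingIdeal K T').comap ψ ≤ P.map Polynomial.C := by
    intro q hq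
    rw [Ideal.mem_map_C_iff]
    intro i
    refine hPmin.1.2 fun s hs => ?_
    -- over each point of `S₁` the polynomial vanishes at the infinitely many values of `w`
    have hzero : q.map (MvPolynomial.aeval (R := K) s).toRingHom = 0 := by
      refine Polynomial.eq_zero_of_infinite_isRoot _ ((hT s hs).mono ?_)
      rintro z ⟨u, hu, rfl, rfl⟩
      have := hq u ⟨hu, hs⟩
      rw [← AlgHom.coe_toRingHom, Polynomial.coe_eval₂RingHom, Polynomial.hom_eval₂] at this
      rw [Set.mem_ofPred_eq, Polynomial.IsRoot, Polynomial.eval_map, ← this]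
      congr 1
      · ext <;> simp
      · simp
    have := congrArg (fun r => Polynomial.coeff r i) hzero
    simpa using this
  -- a prime ideal of relations on `T'` which imposes no relation on `w` over the points of `P`
  obtain ⟨Q, hIQ, hQ, hQP⟩ := Ideal.exists_ideal_comap_le_prime _ _ hle
  let κ := FractionRing (MvPolynomial τ K ⧸ Q)
  let π : MvPolynomial τ K →ₐ[K] κ :=
    (IsScalarTower.toAlgHom K (MvPolynomial τ K ⧸ Q) κ).comp (Ideal.Quotient.mkₐ K Q)
  have hπ : ∀ G, π G = 0 ↔ G ∈ Q := by
    intro G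
    rw [AlgHom.comp_apply, IsScalarTower.toAlgHom_apply,
      map_eq_zero_iff _ (IsFractionRing.injective (MvPolynomial τ K ⧸ Q) κ),
      Ideal.Quotient.mkₐ_eq_mk, Ideal.Quotient.eq_zero_iff_mem]
  let p : τ → κ := fun i => π (MvPolynomial.X i)
  have hp : ∀ G, MvPolynomial.aeval p G = π G := by
    intro G
    rw [MvPolynomial.aeval_unique π]
    rfl
  have hpe : ∀ G, MvPolynomial.aeval (p ∘ e) G = π (MvPolynomial.rename e G) := by
    intro G
    rw [← hp, MvPolynomial.aeval_rename]
  -- relations between the generic coordinates `e` and `w` only hold modulo `P`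
  have hrel : ∀ q : Polynomial (MvPolynomial ι₁ K),
      q.eval₂ (MvPolynomial.aeval (R := K) (p ∘ e)).toRingHom (p w) = 0 → ∀ i, q.coeff i ∈ P := by
    intro q hq
    rw [← Ideal.mem_map_C_iff]
    apply hQP
    rw [Ideal.mem_comap, ← hπ, ← hq, Polynomial.coe_eval₂RingHom, ← AlgHom.coe_toRingHom,
      Polynomial.hom_eval₂]
    congr 1
    ext x <;> simp [hpe, p]
  have hker : RingHom.ker (MvPolynomial.aeval (R := K) (p ∘ e)) = P := by
    have h1 : RingHom.ker (MvPolynomial.aeval (R := K) (p ∘ e)) ≤ P := by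
      intro G hG
      have := hrel (Polynomial.C G) (by simpa using hG) 0
      simpa using this
    refine le_antisymm h1 (hPmin.2 ⟨RingHom.ker_isPrime _, fun G hG => ?_⟩ h1)
    rw [RingHom.mem_ker, hpe, hπ]
    apply hIQ
    intro u hu
    rw [MvPolynomial.aeval_rename]
    exact hG _ hu.2
  refine ⟨κ, inferInstance, inferInstance, p, fun G hG => ?_, ?_, fun hw => ?_⟩
  · rw [hp, hπ]
    exact hIQ fun u hu => hG u hu.1
  · refine (card_le_height_ker_add_eRk (K := K) (p ∘ e ∘ e₁)).trans ?_
    have hker₀ : RingHom.ker (MvPolynomial.aeval (R := K) (p ∘ e ∘ e₁)) = P₀ := by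
      rw [← hPP₀, ← hker]
      ext G
      simp [MvPolynomial.aeval_rename, Function.comp_assoc]
    rw [hker₀]
    gcongr
    exact Order.le_of_lt_add_one (by exact_mod_cast hP₀k)
  · obtain ⟨q, hq0, hq⟩ := exists_polynomial_of_mem_closure_range hw
    apply hq0
    ext i
    have := hrel q hq i
    rw [← hker, RingHom.mem_ker] at this
    simpa using this

theorem zariskiCodim_anti {ι : Type*} {S S' : Set (ι → K)} (h : S ⊆ S') :
    zariskiCodim S' ≤ zariskiCodim S :=
  Ideal.height_mono (MvPolynomial.vanishingIdeal_anti_mono h)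

/-- A prime containing the ideal of a finite union contains the ideal of one of its members. -/
theorem le_zariskiCodim_iUnion {ι α : Type*} [Finite α] {S : α → Set (ι → K)} {k : ℕ∞}
    (h : ∀ i, k ≤ zariskiCodim (S i)) : k ≤ zariskiCodim (⋃ i, S i) := by
  have := Fintype.ofFinite α
  rw [zariskiCodim, Ideal.height_eq_inf_minimalPrimes]
  refine le_iInf₂ fun P hP => ?_
  have hPp : P.IsPrime := hP.1.1
  have hle : Finset.univ.inf (fun i => MvPolynomial.vanishingIdeal K (S i)) ≤ P := by
    refine le_trans (fun G hG => ?_) hP.1.2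
    rintro x hx
    obtain ⟨i, hi⟩ := Set.mem_iUnion.1 hx
    exact (Finset.inf_le (f := fun i => MvPolynomial.vanishingIdeal K (S i))
      (Finset.mem_univ i)) hG x hi
  obtain ⟨i, -, hi⟩ := (Ideal.IsPrime.inf_le' hPp).1 hle
  exact (h i).trans (Ideal.height_mono hi)

/-- A set of positive codimension lies in the zero set of a nonzero polynomial. -/
theorem exists_ne_zero_of_one_le_zariskiCodim {ι : Type*} {S : Set (ι → K)}
    (h : 1 ≤ zariskiCodim S) :
    ∃ G : MvPolynomial ι K, G ≠ 0 ∧ ∀ s ∈ S, MvPolynomial.eval s G = 0 := by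
  have hne : MvPolynomial.vanishingIdeal K S ≠ ⊥ := by
    intro h0
    rw [zariskiCodim, h0, Ideal.height_bot] at h
    simp at h
  obtain ⟨G, hG, hG0⟩ := Submodule.exists_mem_ne_zero_of_ne_bot hne
  exact ⟨G, hG0, fun s hs => by simpa [MvPolynomial.coe_aeval_eq_eval] using hG s hs⟩

end GenericPoint

/-! ### Conjugates and linear conditions -/

section Conjugates

open AlgebraicIndependent

variable {K : Type u} [Field K]

/-- The converse of `exists_polynomial_of_mem_closure_range`. -/
theorem mem_closure_range_of_polynomial {κ ι : Type*} [Field κ] [Algebra K κ]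
    {p : ι → κ} {z : κ} (q : Polynomial (MvPolynomial ι K))
    (hq0 : q.map (MvPolynomial.aeval p).toRingHom ≠ 0)
    (hq : q.eval₂ (MvPolynomial.aeval p).toRingHom z = 0) :
    z ∈ (matroid K κ).closure (Set.range p) := by
  rw [mem_matroid_closure_iff, Algebra.adjoin_range_eq_range_aeval]
  have hcomp : (MvPolynomial.aeval (R := K) p).toRingHom =
      (algebraMap (MvPolynomial.aeval (R := K) p).range κ).comp
        (MvPolynomial.aeval (R := K) p).rangeRestrict.toRingHom := by
    ext <;> rfl
  refine ⟨q.map (MvPolynomial.aeval (R := K) p).rangeRestrict.toRingHom, fun h => hq0 ?_, ?_⟩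
  · rw [hcomp, ← Polynomial.map_map, h, Polynomial.map_zero]
  · rw [hcomp, ← Polynomial.eval₂_map] at hq
    exact hq

/-- Homomorphisms of fields preserve algebraic dependence. -/
theorem map_mem_closure_image {κ Ω : Type*} [Field κ] [Field Ω] [Algebra K κ] [Algebra K Ω]
    (φ : κ →ₐ[K] Ω) {s : Set κ} {z : κ} (hz : z ∈ (matroid K κ).closure s) :
    φ z ∈ (matroid K Ω).closure (φ '' s) := by
  rw [← Subtype.range_coe (s := s)] at hz
  obtain ⟨q, hq0, hq⟩ := exists_polynomial_of_mem_closure_range hz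
  rw [← Subtype.range_coe (s := s), ← Set.range_comp]
  have hcomp : (MvPolynomial.aeval (R := K) (φ ∘ ((↑) : s → κ))).toRingHom =
      φ.toRingHom.comp (MvPolynomial.aeval (R := K) ((↑) : s → κ)).toRingHom := by
    apply MvPolynomial.ringHom_ext
    · intro r; simp
    · intro i; simp
  refine mem_closure_range_of_polynomial q ?_ ?_
  · rw [hcomp, ← Polynomial.map_map]
    rwa [Ne, Polynomial.map_eq_zero_iff φ.toRingHom.injective]
  · rw [hcomp]
    have := congrArg φ.toRingHom hq
    rwa [map_zero, Polynomial.hom_eval₂] at this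

/-- The relative algebraic closure of the field generated by `s`. -/
noncomputable def relClosure (K : Type u) [Field K] {κ : Type*} [Field κ] [Algebra K κ]
    (s : Set κ) : IntermediateField K κ :=
  (algebraicClosure (IntermediateField.adjoin K s) κ).restrictScalars K

theorem mem_relClosure {κ : Type*} [Field κ] [Algebra K κ] {s : Set κ} {z : κ} :
    z ∈ relClosure K s ↔ z ∈ (matroid K κ).closure s := by
  rw [mem_matroid_closure_iff, ← IntermediateField.isAlgebraic_adjoin_iff, relClosure,
    IntermediateField.mem_restrictScalars, mem_algebraicClosure_iff]

theorem subset_relClosure {κ : Type*} [Field κ] [Algebra K κ] (s : Set κ) :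
    s ⊆ relClosure K s := fun _ hz =>
  mem_relClosure.2 ((matroid K κ).subset_closure s (Set.subset_univ _) hz)

theorem relClosure_mono {κ : Type*} [Field κ] [Algebra K κ] {s t : Set κ} (h : s ⊆ t) :
    relClosure K s ≤ relClosure K t := fun _ hz =>
  mem_relClosure.2 ((matroid K κ).closure_subset_closure h (mem_relClosure.1 hz))

theorem exists_ringHom_extension {S κ Ω : Type*} [CommRing S] [Field κ] [Field Ω]
    [IsAlgClosed Ω] [Algebra S κ] [Algebra.IsAlgebraic S κ] [FaithfulSMul S κ] (f : S →+* Ω)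
    (hf : Function.Injective f) : ∃ σ : κ →+* Ω, ∀ s, σ (algebraMap S κ s) = f s := by
  have : IsDomain S := hf.isDomain f
  let _ : Algebra S Ω := f.toAlgebra
  have : FaithfulSMul S Ω := (faithfulSMul_iff_algebraMap_injective S Ω).2 hf
  let σ : κ →ₐ[S] Ω := IsAlgClosed.lift
  exact ⟨σ, σ.commutes⟩

/-- An independent set `Λ` over `B` can be moved, by a homomorphism fixing the elements algebraic
over `B`, to any given elements that are independent over the whole field. -/
theorem exists_algHom_of_indep {κ Ω : Type u} [Field κ] [Field Ω] [IsAlgClosed Ω]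
    [Algebra K κ] [Algebra K Ω] [Algebra κ Ω] [IsScalarTower K κ Ω] {B Λ : Set κ}
    (hB : (matroid K κ).Indep (B ∪ Λ)) (hd : Disjoint B Λ) (t : κ → Ω)
    (ht : AlgebraicIndependent κ t) :
    ∃ σ : κ →ₐ[K] Ω, (∀ z ∈ relClosure K B, σ z = algebraMap κ Ω z) ∧ ∀ l ∈ Λ, σ l = t l := by
  let R := Subalgebra.algebraicClosure (Algebra.adjoin K B) κ
  have hΛ : AlgebraicIndependent R ((↑) : Λ → κ) := by
    have h1 : AlgebraicIndependent K ((↑) : (B ∪ Λ : Set κ) → κ) := hB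
    let ι : Λ ⊕ B → (B ∪ Λ : Set κ) :=
      Sum.elim (fun l => ⟨l, Or.inr l.2⟩) (fun b => ⟨b, Or.inl b.2⟩)
    have hι : Function.Injective ι := by
      have hne : ∀ (l : Λ) (b : B), (l : κ) ≠ b := fun l b h =>
        Set.disjoint_left.1 hd b.2 (h ▸ l.2)
      rintro (a | a) (b | b) h
      · exact congrArg Sum.inl (Subtype.ext (Subtype.ext_iff.1 h :))
      · exact absurd (Subtype.ext_iff.1 h) (hne a b)
      · exact absurd (Subtype.ext_iff.1 h).symm (hne b a)
      · exact congrArg Sum.inr (Subtype.ext (Subtype.ext_iff.1 h :))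
    have h2 : AlgebraicIndependent K (Sum.elim ((↑) : Λ → κ) ((↑) : B → κ)) := by
      convert h1.comp ι hι using 1
      ext (a | a) <;> rfl
    have h3 := (AlgebraicIndependent.sumElim_iff.1 h2).2
    rw [Subtype.range_coe] at h3
    exact h3.subalgebraAlgebraicClosure
  -- a transcendence basis containing `Λ` can be moved to `t`, and the rest of `κ` is algebraic
  obtain ⟨C, hC, hCb⟩ := exists_isTranscendenceBasis_superset (R := R) (s := Λ) hΛ
  have htC : AlgebraicIndependent R (fun c : C => t c) :=
    (ht.restrictScalars (R := R) Subtype.val_injective).comp _ Subtype.val_injective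
  let S := Algebra.adjoin R (Set.range ((↑) : C → κ))
  let f : S →ₐ[R] Ω := (MvPolynomial.aeval fun c : C => t c).comp hCb.1.aevalEquiv.symm.toAlgHom
  have halg : Algebra.IsAlgebraic S κ := hCb.isAlgebraic
  have hinj : Function.Injective f :=
    Function.Injective.comp (g := MvPolynomial.aeval fun c : C => t c) htC
      hCb.1.aevalEquiv.symm.injective
  obtain ⟨σ, hσ⟩ := exists_ringHom_extension (S := S) (κ := κ) (Ω := Ω)
    (f : S →+* Ω) (by exact hinj)
  have hR : ∀ r : R, σ r = algebraMap κ Ω r := by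
    intro r
    have := hσ (algebraMap R S r)
    refine this.trans ?_
    exact f.commutes r
  let σ' : κ →ₐ[K] Ω :=
    { σ with
      commutes' := fun r => by
        refine (hR (algebraMap K R r)).trans ?_
        exact (IsScalarTower.algebraMap_apply K κ Ω r).symm }
  refine ⟨σ', fun z hz => ?_, fun l hl => ?_⟩
  · have hz' : z ∈ R := by
      rw [mem_relClosure, mem_matroid_closure_iff] at hz
      exact hz
    exact hR ⟨z, hz'⟩
  · have he : (algebraMap S κ (hCb.1.aevalEquiv (MvPolynomial.X ⟨l, hC hl⟩))) = l := by
      rw [AlgebraicIndependent.algebraMap_aevalEquiv]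
      simp
    have := hσ (hCb.1.aevalEquiv (MvPolynomial.X ⟨l, hC hl⟩))
    rw [he] at this
    refine this.trans ?_
    simp [f]

/-- The matrix of monomials at algebraically independent points is invertible: its determinant
contains the product of the diagonal entries with coefficient one. -/
theorem det_monomials_ne_zero {ι Λ κ Ω : Type*} [Fintype ι] [DecidableEq ι] [Fintype Λ]
    [Field κ] [Field Ω] [Algebra κ Ω] {β : ι → Λ → ℕ} (hβ : Function.Injective β)
    {t : ι × Λ → Ω} (ht : AlgebraicIndependent κ t) :
    (Matrix.of fun i k => ∏ l, t (i, l) ^ β k l).det ≠ 0 := by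
  classical
  let e : ι → ι → (ι × Λ →₀ ℕ) := fun i k =>
    Finsupp.equivFunOnFinite.symm fun q => if q.1 = i then β k q.2 else 0
  let P : Matrix ι ι (MvPolynomial (ι × Λ) κ) :=
    Matrix.of fun i k => MvPolynomial.monomial (e i k) 1
  have hP : (Matrix.of fun i k => ∏ l, t (i, l) ^ β k l) = P.map (MvPolynomial.aeval t) := by
    ext i k
    rw [Matrix.map_apply, Matrix.of_apply, show P i k = MvPolynomial.monomial (e i k) 1 from rfl,
      MvPolynomial.aeval_monomial, map_one, one_mul, Finsupp.prod_fintype _ _ (by simp),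
      Fintype.prod_prod_type,
      Finset.prod_eq_single i (fun j _ hj => by simp [e, hj]) (by simp)]
    simp [e]
  have hdet : P.det ≠ 0 := by
    intro h0
    have h1 := congrArg (MvPolynomial.coeff (∑ i, e i i)) h0
    rw [Matrix.det_apply, MvPolynomial.coeff_sum, MvPolynomial.coeff_zero,
      Finset.sum_eq_single 1] at h1
    · simp only [P, Equiv.Perm.sign_one, one_smul, Equiv.Perm.coe_one, id_eq, Matrix.of_apply] at h1
      rw [← MvPolynomial.monomial_sum_one] at h1
      simp at h1
    · intro σ _ hσ
      simp only [P, Matrix.of_apply]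
      rw [← MvPolynomial.monomial_sum_one, MvPolynomial.coeff_smul, MvPolynomial.coeff_monomial,
        if_neg, smul_zero]
      intro hE
      apply hσ
      ext i
      rw [Equiv.Perm.coe_one, id_eq]
      apply hβ
      ext l
      have := DFunLike.congr_fun hE (σ i, l)
      simp only [Finsupp.coe_finsetSum, Finset.sum_apply, e,
        Finsupp.equivFunOnFinite_symm_apply_apply] at this
      simpa [σ.injective.eq_iff] using this.symm
    · simp
  rw [hP]
  have := (AlgHom.map_det (MvPolynomial.aeval (R := κ) t) P)
  rw [AlgHom.mapMatrix_apply] at this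
  rw [← this]
  exact fun h => hdet (ht (by rw [h, map_zero]))

theorem eRk_map_le {κ Ω : Type*} [Field κ] [Field Ω] [Algebra K κ] [Algebra K Ω]
    (φ : κ →ₐ[K] Ω) (s : Set κ) : (matroid K Ω).eRk (φ '' s) ≤ (matroid K κ).eRk s := by
  obtain ⟨B, hB⟩ := (matroid K κ).exists_isBasis s
  rw [hB.eRk_eq_encard, ← φ.injective.encard_image]
  refine le_trans (le_trans ((matroid K Ω).eRk_mono ?_) ((matroid K Ω).eRk_closure_eq _).le)
    ((matroid K Ω).eRk_le_encard _)
  rintro _ ⟨z, hz, rfl⟩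
  exact map_mem_closure_image φ (hB.subset_closure hz)

/-- Elements of an extension field that are independent over `κ` add their number to the
transcendence degree of every subset of `κ`. -/
theorem eRk_add_card_le {κ Ω : Type*} [Field κ] [Field Ω] [Algebra K κ] [Algebra K Ω]
    [Algebra κ Ω] [IsScalarTower K κ Ω] {ι : Type*} (s : Set κ) {t : ι → Ω}
    (ht : AlgebraicIndependent κ t) :
    (matroid K κ).eRk s + ENat.card ι ≤
      (matroid K Ω).eRk (algebraMap κ Ω '' s ∪ Set.range t) := by
  obtain ⟨B, hB⟩ := (matroid K κ).exists_isBasis s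
  have hB' : AlgebraicIndependent K ((↑) : B → κ) := hB.indep
  have h := hB'.sumElim_comp ht
  have hind : (matroid K Ω).Indep (Set.range (Sum.elim t (algebraMap κ Ω ∘ ((↑) : B → κ)))) :=
    h.to_subtype_range
  rw [hB.eRk_eq_encard]
  refine le_trans ?_ (hind.encard_le_eRk_of_subset ?_)
  · refine le_trans (le_of_eq ?_) h.injective.encard_range
    rw [ENat.card_sum, add_comm]
    rfl
  · rw [Set.Sum.elim_range, Set.range_comp, Subtype.range_coe, Set.union_comm]
    exact Set.union_subset_union_left _ (Set.image_mono hB.subset)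

/-- **Linear conditions at a generic point.** If `∑ j, y j * u j = g`, where the coefficients `u j`
and `g` are algebraic over `A` and a set `Λ` that is independent over `A` and `y`, then each of the
distinct monomials in `Λ` among the `u j` lowers the transcendence degree of `y` over `A` by one:
moving `Λ` to independent conjugates over `A` and `y` gives as many linear equations for `y`. -/
theorem eRk_add_card_le_of_relation {κ : Type u} [Field κ] [Algebra K κ] (A : Set κ)
    {J : Type} [Fintype J] (y : J → κ) (I : Finset J) (Λ : Finset κ) {B : Set κ}
    (hB : (matroid K κ).IsBasis B (A ∪ Set.range y)) (hind : (matroid K κ).Indep (B ∪ Λ))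
    (hd : Disjoint B (Λ : Set κ)) (u : J → κ) (β : J → Λ → ℕ)
    (hu : ∀ i ∈ I, u i = ∏ l : Λ, (l : κ) ^ β i l) (hβ : Set.InjOn β I)
    (hu' : ∀ j, u j ∈ relClosure K (A ∪ Λ)) {g : κ} (hg : g ∈ relClosure K (A ∪ Λ))
    (hrel : ∑ j, y j * u j = g) :
    (matroid K κ).eRk (A ∪ Set.range y) + I.card ≤ (matroid K κ).eRk A + Fintype.card J := by
  classical
  let Ω := AlgebraicClosure (FractionRing (MvPolynomial (I × κ) κ))
  have : IsScalarTower K κ Ω := inferInstance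
  let t : I × κ → Ω := fun q => algebraMap (MvPolynomial (I × κ) κ) Ω (MvPolynomial.X q)
  have hinj : Function.Injective (algebraMap (MvPolynomial (I × κ) κ) Ω) := by
    rw [IsScalarTower.algebraMap_eq _ (FractionRing (MvPolynomial (I × κ) κ)) Ω]
    exact (RingHom.injective (algebraMap (FractionRing (MvPolynomial (I × κ) κ)) Ω)).comp
      (IsFractionRing.injective _ _)
  have ht : AlgebraicIndependent κ t := by
    have := (MvPolynomial.algebraicIndependent_X (I × κ) κ).map'
      (f := IsScalarTower.toAlgHom κ (MvPolynomial (I × κ) κ) Ω) hinj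
    exact this
  have hσ : ∀ i : I, ∃ σ : κ →ₐ[K] Ω, (∀ z ∈ relClosure K B, σ z = algebraMap κ Ω z) ∧
      ∀ l ∈ Λ, σ l = t (i, l) := fun i =>
    exists_algHom_of_indep hind hd (fun z => t (i, z)) (ht.comp _ (Prod.mk_right_injective i))
  choose σ hσB hσΛ using hσ
  let t' : I × Λ → Ω := fun q => t (q.1, q.2)
  have ht' : AlgebraicIndependent κ t' :=
    ht.comp (fun q : I × Λ => ((q.1, (q.2 : κ)) : I × κ)) fun q q' h => by
      simp only [Prod.mk.injEq] at h
      exact Prod.ext h.1 (Subtype.ext h.2)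
  have hsub : ∀ z ∈ A ∪ Set.range y, ∀ i, σ i z = algebraMap κ Ω z := fun z hz i =>
    hσB i z (mem_relClosure.2 (hB.subset_closure hz))
  let ε : κ →ₐ[K] Ω := IsScalarTower.toAlgHom K κ Ω
  let N : Set J := (I : Set J)ᶜ
  let Z := relClosure K (ε '' A ∪ Set.range t' ∪ (fun j => ε (y j)) '' N)
  have hZ : ∀ i, ∀ z ∈ relClosure K (A ∪ Λ), σ i z ∈ Z := by
    intro i z hz
    have := map_mem_closure_image (σ i) (mem_relClosure.1 hz)
    refine mem_relClosure.2 ((matroid K Ω).closure_subset_closure ?_ this)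
    rintro _ ⟨w, hw | hw, rfl⟩
    · exact Or.inl (Or.inl ⟨w, hw, (hsub w (Or.inl hw) i).symm⟩)
    · exact Or.inl (Or.inr ⟨(i, ⟨w, hw⟩), (hσΛ i w hw).symm⟩)
  -- the equations, one for each conjugate, determine the `y j` with `j ∈ I`
  have hsolve : ∀ k : I, ε (y k) ∈ Z := by
    let P : Matrix I I Z := Matrix.of fun i k => ⟨σ i (u k), hZ i _ (hu' k)⟩
    have hb : ∀ i : I, σ i g - ∑ j ∈ Iᶜ, ε (y j) * σ i (u j) ∈ Z := by
      intro i
      refine sub_mem (hZ i g hg) (sum_mem fun j hj => mul_mem ?_ (hZ i _ (hu' j)))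
      exact subset_relClosure _ (Or.inr ⟨j, by simpa [N] using hj, rfl⟩)
    let b : I → Z := fun i => ⟨_, hb i⟩
    have hPmap : P.map (algebraMap Z Ω) =
        Matrix.of fun i k : I => ∏ l : Λ, t' (i, l) ^ β k l := by
      ext i k
      change σ i (u k) = _
      rw [hu k k.2, map_prod]
      refine Finset.prod_congr rfl fun l _ => ?_
      rw [map_pow, hσΛ i l l.2]
    have hdet : P.det ≠ 0 := by
      intro h0
      have h1 := det_monomials_ne_zero (ι := I) (β := fun k l => β k l)
        (fun a b hab => Subtype.ext (hβ a.2 b.2 hab)) ht'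
      rw [← hPmap] at h1
      apply h1
      have := RingHom.map_det (algebraMap Z Ω) P
      rw [RingHom.mapMatrix_apply] at this
      rw [← this, h0, map_zero]
    have hunit : IsUnit P.det := hdet.isUnit
    have hsys : (P.map (algebraMap Z Ω)).mulVec (fun k => ε (y k)) =
        fun i => algebraMap Z Ω (b i) := by
      ext i
      have h1 := congrArg (σ i) hrel
      rw [map_sum, ← Finset.sum_add_sum_compl I] at h1
      have h2 : ∀ j, σ i (y j * u j) = ε (y j) * σ i (u j) := fun j => by
        rw [map_mul, hsub (y j) (Or.inr ⟨j, rfl⟩) i]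
        rfl
      simp only [h2] at h1
      change ∑ k : I, σ i (u k) * ε (y k) = σ i g - ∑ j ∈ Iᶜ, ε (y j) * σ i (u j)
      rw [← h1, add_sub_cancel_right, ← Finset.sum_coe_sort I]
      exact Finset.sum_congr rfl fun k _ => mul_comm _ _
    have hsol : (fun k : I => ε (y k)) = fun k => algebraMap Z Ω ((P⁻¹.mulVec b) k) := by
      have hdet' : IsUnit (P.map (algebraMap Z Ω)) := by
        rw [Matrix.isUnit_iff_isUnit_det]
        have := RingHom.map_det (algebraMap Z Ω) P
        rw [RingHom.mapMatrix_apply] at this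
        rw [← this]
        exact hunit.map _
      apply Matrix.mulVec_injective_of_isUnit hdet'
      change (P.map (algebraMap Z Ω)).mulVec _ = (P.map (algebraMap Z Ω)).mulVec _
      rw [hsys]
      ext i
      have := RingHom.map_mulVec (algebraMap Z Ω) P (P⁻¹.mulVec b) i
      rw [Matrix.mulVec_mulVec, Matrix.mul_nonsing_inv _ hunit, Matrix.one_mulVec] at this
      exact this
    intro k
    rw [show ε (y k) = _ from congrFun hsol k]
    exact (P⁻¹.mulVec b k).2
  -- `y` is algebraic over `A`, the conjugates of `Λ` and the `y j` with `j ∉ I`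
  have h1 := eRk_add_card_le (K := K) (A ∪ Set.range y) ht'
  have h2 : (matroid K Ω).eRk (algebraMap κ Ω '' (A ∪ Set.range y) ∪ Set.range t') ≤
      (matroid K κ).eRk A + ENat.card (I × Λ) + (Fintype.card J - I.card : ℕ) := by
    calc _ ≤ (matroid K Ω).eRk (Z : Set Ω) := by
          refine (matroid K Ω).eRk_mono ?_
          rintro _ (⟨z, hz | ⟨j, rfl⟩, rfl⟩ | hz)
          · exact subset_relClosure _ (Or.inl (Or.inl ⟨z, hz, rfl⟩))
          · by_cases hj : j ∈ I
            · exact hsolve ⟨j, hj⟩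
            · exact subset_relClosure _ (Or.inr ⟨j, hj, rfl⟩)
          · exact subset_relClosure _ (Or.inl (Or.inr hz))
      _ ≤ (matroid K Ω).eRk (ε '' A ∪ Set.range t' ∪ (fun j => ε (y j)) '' N) := by
          have : (Z : Set Ω) =
              (matroid K Ω).closure (ε '' A ∪ Set.range t' ∪ (fun j => ε (y j)) '' N) := by
            ext z
            exact mem_relClosure
          rw [this, (matroid K Ω).eRk_closure_eq]
      _ ≤ (matroid K Ω).eRk (ε '' A) + (Set.range t').encard +
          ((fun j => ε (y j)) '' N).encard := by
          refine ((matroid K Ω).eRk_union_le_eRk_add_encard _ _).trans ?_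
          gcongr
          exact (matroid K Ω).eRk_union_le_eRk_add_encard _ _
      _ ≤ _ := by
          gcongr
          · exact eRk_map_le ε A
          · rw [← Set.image_univ, ← Set.encard_univ]
            exact Set.encard_image_le _ _
          · refine (Set.encard_image_le _ _).trans ?_
            simp only [N, ← Finset.coe_compl, Set.encard_coe_eq_coe_finsetCard, Finset.card_compl]
            rfl
  have h3 := h1.trans h2
  have hfin : ENat.card (I × Λ) ≠ ⊤ := by
    rw [ENat.card_eq_coe_fintype_card]
    exact ENat.natCast_ne_top _
  rw [add_right_comm, ENat.add_le_add_iff_right hfin] at h3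
  calc _ ≤ (matroid K κ).eRk A + (Fintype.card J - I.card : ℕ) + (I.card : ℕ∞) := by gcongr
    _ = _ := by
      rw [add_assoc, ← Nat.cast_add, Nat.sub_add_cancel (Finset.card_le_univ I)]

end Conjugates

/-! ### Relative ranks in a matroid -/

section RelativeRank

variable {α : Type*} {N : Matroid α}

/-- The rank of a set in a matroid as a natural number; it is meaningful for finite sets. -/
noncomputable def natRk (N : Matroid α) (s : Set α) : ℕ := (N.eRk s).toNat

theorem coe_natRk {s : Set α} (hs : s.Finite) : (natRk N s : ℕ∞) = N.eRk s := by
  refine ENat.natCast_toNat fun h => ?_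
  have := N.eRk_le_encard s
  rw [h, top_le_iff, Set.encard_eq_top_iff] at this
  exact this hs

theorem natRk_mono {s t : Set α} (h : s ⊆ t) (ht : t.Finite) : natRk N s ≤ natRk N t := by
  have := N.eRk_mono h
  rw [← coe_natRk ht, ← coe_natRk (ht.subset h)] at this
  exact_mod_cast this

theorem natRk_union_le {s t : Set α} (hs : s.Finite) (ht : t.Finite) :
    natRk N (s ∪ t) ≤ natRk N s + t.ncard := by
  have := N.eRk_union_le_eRk_add_encard s t
  rw [← coe_natRk (hs.union ht), ← coe_natRk hs, ← ht.cast_ncard_eq] at this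
  exact_mod_cast this

/-- The rank of `v` relative to `t` is at most the rank relative to a subset of `t`. -/
theorem natRk_submodular {s t v : Set α} (h : s ⊆ t) (ht : t.Finite) (hv : v.Finite) :
    natRk N (t ∪ v) + natRk N s ≤ natRk N t + natRk N (s ∪ v) := by
  have h1 := N.eRk_inter_add_eRk_union_le t (s ∪ v)
  have h2 := N.eRk_mono (show s ⊆ t ∩ (s ∪ v) from Set.subset_inter h Set.subset_union_left)
  have h3 : t ∪ (s ∪ v) = t ∪ v := by
    rw [← Set.union_assoc, Set.union_eq_self_of_subset_right h]
  rw [h3] at h1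
  have h4 : N.eRk (t ∪ v) + N.eRk s ≤ N.eRk t + N.eRk (s ∪ v) := by
    rw [add_comm]
    exact le_trans (by gcongr) h1
  have hs := ht.subset h
  rw [← coe_natRk (ht.union hv), ← coe_natRk hs, ← coe_natRk ht, ← coe_natRk (hs.union hv)] at h4
  exact_mod_cast h4

theorem natRk_closure_eq_of_subset {s t : Set α} (h : t ⊆ N.closure s) (hst : s ⊆ t) :
    natRk N t = natRk N s := by
  rw [natRk, natRk]
  congr 1
  refine le_antisymm ?_ (N.eRk_mono hst)
  exact (N.eRk_mono h).trans (N.eRk_closure_eq s).le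

theorem closure_eq_of_natRk_le {s t : Set α} (hst : s ⊆ t) (ht : t.Finite)
    (h : natRk N t ≤ natRk N s) : N.closure s = N.closure t := by
  have hs := ht.subset hst
  refine Matroid.IsRkFinite.closure_eq_closure_of_subset_of_eRk_ge_eRk ?_ hst ?_
  · rw [← Matroid.eRk_ne_top_iff, ← coe_natRk hs]
    exact ENat.natCast_ne_top _
  · rw [← coe_natRk hs, ← coe_natRk ht]
    exact_mod_cast h

/-- A maximal subset of `v` that is independent over `t`. -/
theorem exists_relative_basis (hE : N.E = Set.univ) {t v : Set α} (ht : t.Finite) (hv : v.Finite) :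
    ∃ B Λ : Set α, N.IsBasis B t ∧ N.Indep (B ∪ Λ) ∧ Disjoint B Λ ∧ Λ ⊆ v ∧
      natRk N (t ∪ Λ) = natRk N t + Λ.ncard ∧ natRk N (t ∪ v) = natRk N t + Λ.ncard := by
  have hgr : ∀ s : Set α, s ⊆ N.E := fun s => hE ▸ Set.subset_univ s
  obtain ⟨B, hB⟩ := N.exists_isBasis t (hgr _)
  obtain ⟨C, hC, hBC⟩ := hB.indep.subset_isBasis_of_subset (Set.subset_union_left (t := v)) (hgr _)
  have hBfin := ht.subset hB.subset
  have hCfin := (hBfin.union hv).subset hC.subset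
  have hU : B ∪ C \ B = C := Set.union_sdiff_cancel hBC
  have hΛv : C \ B ⊆ v := fun z hz => (hC.subset hz.1).resolve_left hz.2
  have hcard : natRk N t + (C \ B).ncard = C.ncard := by
    have : natRk N t = B.ncard := by
      rw [natRk, hB.eRk_eq_encard]
      rfl
    rw [this, add_comm, Set.ncard_sdiff_add_ncard_of_subset hBC hCfin]
  have hrk : ∀ w, C \ B ⊆ w → w ⊆ v → natRk N (t ∪ w) = C.ncard := by
    intro w hw hwv
    rw [natRk, ← hB.eRk_eq_eRk_union]
    have h1 : N.eRk (B ∪ w) = C.encard := by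
      refine le_antisymm ?_ ?_
      · rw [← hC.eRk_eq_encard]
        exact N.eRk_mono (Set.union_subset_union_right _ hwv)
      · refine hC.indep.encard_le_eRk_of_subset ?_
        rw [← hU]
        exact Set.union_subset_union_right _ hw
    rw [h1]
    rfl
  exact ⟨B, C \ B, hB, by rw [hU]; exact hC.indep, Set.disjoint_sdiff_right, hΛv,
    by rw [hcard, hrk _ subset_rfl hΛv], by rw [hcard, hrk _ hΛv subset_rfl]⟩

end RelativeRank

/-! ### Homogeneous parts of a form at a coordinate point -/

section FormsAtPivot

open AlgebraicIndependent

variable {M D : ℕ}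

/-- The degree of a monomial in the coordinates other than `a`. -/
def offDegree (a : Fin (M + 1)) (m : FormIndex M D) : ℕ := D - m.1 a

/-- The value at `v` of the part of a monomial that does not involve the coordinate `a`. -/
def offMonomial {R : Type*} [CommRing R] (a : Fin (M + 1)) (v : Fin (M + 1) → R)
    (m : FormIndex M D) : R := ∏ i ∈ Finset.univ.erase a, v i ^ m.1 i

theorem FormIndex.sum_eq (m : FormIndex M D) : ∑ i, m.1 i = D :=
  (Finset.mem_finsuppAntidiag.1 m.2).1

theorem FormIndex.le (m : FormIndex M D) (i : Fin (M + 1)) : m.1 i ≤ D :=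
  (Finset.single_le_sum (f := fun i => m.1 i) (fun _ _ => Nat.zero_le _)
    (Finset.mem_univ i)).trans m.sum_eq.le

theorem FormIndex.sum_erase (a : Fin (M + 1)) (m : FormIndex M D) :
    ∑ i ∈ Finset.univ.erase a, m.1 i = offDegree a m := by
  have h := m.sum_eq
  rw [← Finset.add_sum_erase _ _ (Finset.mem_univ a)] at h
  rw [offDegree]
  omega

theorem offDegree_le (a : Fin (M + 1)) (m : FormIndex M D) : offDegree a m ≤ D := Nat.sub_le _ _

/-- There are at least as many monomials of off-degree `d` that involve only `x_a` and the
coordinates in `s` as there are monomials of degree `d` in `card s` variables. -/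
theorem card_monomials_supported {a : Fin (M + 1)} {s : Finset (Fin (M + 1))} (ha : a ∉ s)
    {d : ℕ} (hd : d ≤ D) :
    (s.card + d - 1).choose d ≤ (Finset.univ.filter fun m : FormIndex M D =>
      offDegree a m = d ∧ m.1.support ⊆ insert a s).card := by
  classical
  rw [← Finset.card_finsuppAntidiag_nat_eq_choose]
  have hsum : ∀ n ∈ s.finsuppAntidiag d, ∑ i, n i = d := fun n hn => by
    rw [Finset.mem_finsuppAntidiag] at hn
    rw [← hn.1]
    exact (Finset.sum_subset (Finset.subset_univ s) fun i _ hi =>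
      Finsupp.notMem_support_iff.1 fun h => hi (hn.2 h)).symm
  have hna : ∀ n ∈ s.finsuppAntidiag d, n a = 0 := fun n hn =>
    Finsupp.notMem_support_iff.1 fun h => ha ((Finset.mem_finsuppAntidiag.1 hn).2 h)
  have hmem : ∀ n ∈ s.finsuppAntidiag d,
      n + Finsupp.single a (D - d) ∈ Finset.univ.finsuppAntidiag D := by
    intro n hn
    rw [Finset.mem_finsuppAntidiag]
    refine ⟨?_, Finset.subset_univ _⟩
    change ∑ i, (n i + Finsupp.single a (D - d) i) = D
    rw [Finset.sum_add_distrib, hsum n hn, Finset.sum_eq_single a (fun i _ hi => by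
      rw [Finsupp.single_apply, if_neg hi.symm]) (by simp), Finsupp.single_eq_same]
    omega
  refine Finset.card_le_card_of_injOn
    (fun n => if h : n + Finsupp.single a (D - d) ∈ Finset.univ.finsuppAntidiag D then
      (⟨_, h⟩ : FormIndex M D) else
      ⟨Finsupp.single a D, by simp [Finset.mem_finsuppAntidiag]⟩) ?_ ?_
  · intro n hn
    have hmem := hmem n hn
    simp only [hmem, dif_pos]
    simp only [Finset.coe_filter, Finset.mem_univ, true_and, Set.mem_ofPred_eq]
    refine ⟨?_, ?_⟩
    · simp [offDegree, hna n hn]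
      omega
    · refine Finsupp.support_add.trans (Finset.union_subset ?_ ?_)
      · exact (Finset.mem_finsuppAntidiag.1 hn).2.trans (Finset.subset_insert _ _)
      · exact Finsupp.support_single_subset.trans (by simp)
  · intro n hn n' hn' h
    simp only [hmem n hn, hmem n' hn', dif_pos] at h
    exact add_right_cancel (Subtype.ext_iff.1 h)

variable {κ : Type u}

/-- The coefficients of off-degree less than `d`, together with a base set `X`. -/
def coeffsBelow (X : Set κ) (a : Fin (M + 1)) (c : FormIndex M D → κ) (d : ℕ) : Set κ :=
  X ∪ c '' {m | offDegree a m < d}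

theorem coeffsBelow_finite {X : Set κ} (hX : X.Finite) (a : Fin (M + 1)) (c : FormIndex M D → κ)
    (d : ℕ) : (coeffsBelow X a c d).Finite := hX.union (Set.toFinite _)

theorem coeffsBelow_mono (X : Set κ) (a : Fin (M + 1)) (c : FormIndex M D → κ) :
    Monotone (coeffsBelow X a c) := fun _ _ h =>
  Set.union_subset_union_right _ (Set.image_mono fun _ hm => lt_of_lt_of_le hm h)

theorem coeffsBelow_succ (X : Set κ) (a : Fin (M + 1)) (c : FormIndex M D → κ) (d : ℕ) :
    coeffsBelow X a c (d + 1) = coeffsBelow X a c d ∪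
      Set.range (fun m : {m : FormIndex M D // offDegree a m = d} => c m) := by
  ext z
  constructor
  · rintro (h | ⟨m, hm, rfl⟩)
    · exact Or.inl (Or.inl h)
    · rcases Nat.lt_succ_iff_lt_or_eq.1 hm with h | h
      · exact Or.inl (Or.inr ⟨m, h, rfl⟩)
      · exact Or.inr ⟨⟨m, h⟩, rfl⟩
  · rintro ((h | ⟨m, hm, rfl⟩) | ⟨⟨m, hm⟩, rfl⟩)
    · exact Or.inl h
    · exact Or.inr ⟨m, Nat.lt_succ_of_lt hm, rfl⟩
    · exact Or.inr ⟨m, hm ▸ Nat.lt_succ_self _, rfl⟩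

variable {K : Type u} [Field K] [Field κ] [Algebra K κ]

/-- The transcendence degree of the direction `v` over the coefficients of off-degree less
than `d`. -/
noncomputable def dirRank (K : Type u) [Field K] [Algebra K κ] (X : Set κ) (a : Fin (M + 1))
    (c : FormIndex M D → κ) (v : Fin (M + 1) → κ) (d : ℕ) : ℕ :=
  natRk (matroid K κ) (coeffsBelow X a c d ∪ Set.range v) -
    natRk (matroid K κ) (coeffsBelow X a c d)

theorem natRk_coeffsBelow_add_dirRank {X : Set κ} (hX : X.Finite) (a : Fin (M + 1))
    (c : FormIndex M D → κ) (v : Fin (M + 1) → κ) (d : ℕ) :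
    natRk (matroid K κ) (coeffsBelow X a c d) + dirRank K X a c v d =
      natRk (matroid K κ) (coeffsBelow X a c d ∪ Set.range v) :=
  Nat.add_sub_cancel' (natRk_mono Set.subset_union_left
    ((coeffsBelow_finite hX a c d).union (Set.finite_range v)))

theorem dirRank_antitone {X : Set κ} (hX : X.Finite) (a : Fin (M + 1))
    (c : FormIndex M D → κ) (v : Fin (M + 1) → κ) : Antitone (dirRank K X a c v) := by
  intro d d' h
  have h1 := natRk_submodular (N := matroid K κ) (coeffsBelow_mono X a c h)
    (coeffsBelow_finite hX a c d') (Set.finite_range v)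
  have h2 := natRk_coeffsBelow_add_dirRank (K := K) hX a c v d
  have h3 := natRk_coeffsBelow_add_dirRank (K := K) hX a c v d'
  omega

/-- If the homogeneous part of degree `d` takes at `v` a value algebraic over the coefficients of
lower degree and `v`, and yet does not lower the transcendence degree `ρ` of `v`, then its
coefficients satisfy at least as many conditions as there are monomials of degree `d` in `ρ + 1`
variables. -/
theorem natRk_coeffsBelow_succ_add_choose_le {X : Set κ} (hX : X.Finite) {a b : Fin (M + 1)}
    (hab : b ≠ a) (c : FormIndex M D → κ) {v : Fin (M + 1) → κ} (hva : v a = 0) (hvb : v b = 1)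
    {d : ℕ} (hd : d ≤ D)
    (hstat : dirRank K X a c v d = dirRank K X a c v (d + 1))
    (hval : ∑ m : {m : FormIndex M D // offDegree a m = d}, c m * offMonomial a v m.1 ∈
      relClosure K (coeffsBelow X a c d ∪ Set.range v)) :
    natRk (matroid K κ) (coeffsBelow X a c (d + 1)) + (dirRank K X a c v (d + 1) + d).choose d ≤
      natRk (matroid K κ) (coeffsBelow X a c d) +
        Fintype.card {m : FormIndex M D // offDegree a m = d} := by
  classical
  set A := coeffsBelow X a c d with hA
  have hAfin : A.Finite := coeffsBelow_finite hX a c d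
  have hsucc := coeffsBelow_succ X a c d
  rw [← hA] at hsucc
  have hA'fin := coeffsBelow_finite hX a c (d + 1)
  obtain ⟨B, Λ, hB, hind, hd', hΛv, hr1, hr2⟩ := exists_relative_basis (N := matroid K κ) rfl
    hA'fin (Set.finite_range v)
  have hΛfin : Λ.Finite := (Set.finite_range v).subset hΛv
  obtain ⟨Λ, rfl⟩ := hΛfin.exists_finset_coe
  rw [Set.ncard_coe_finset] at hr1 hr2
  have hρ' := natRk_coeffsBelow_add_dirRank (K := K) hX a c v (d + 1)
  have hρ := natRk_coeffsBelow_add_dirRank (K := K) hX a c v d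
  rw [← hA] at hρ
  have hcard : dirRank K X a c v (d + 1) = Λ.card := by omega
  -- `Λ` is also a transcendence basis of `v` over the lower coefficients
  have hcl : (matroid K κ).closure (A ∪ Λ) = (matroid K κ).closure (A ∪ Set.range v) := by
    refine closure_eq_of_natRk_le (Set.union_subset_union_right _ hΛv)
      (hAfin.union (Set.finite_range v)) ?_
    have := natRk_submodular (N := matroid K κ) (coeffsBelow_mono X a c (Nat.le_succ d))
      hA'fin Λ.finite_toSet
    rw [← hA] at this
    simp only [Nat.succ_eq_add_one] at this
    omega
  have hcl' : relClosure K (A ∪ (Λ : Set κ)) = relClosure K (A ∪ Set.range v) := by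
    ext z
    rw [mem_relClosure, mem_relClosure, hcl]
  choose idx hidx using fun l : Λ => hΛv l.2
  have hconst : ∀ z ∈ relClosure K (∅ : Set κ), z ∉ Λ := by
    intro z hz hzΛ
    have h1 : z ∈ (matroid K κ).closure B :=
      (matroid K κ).closure_subset_closure (Set.empty_subset B) (mem_relClosure.1 hz)
    have h2 : B ⊆ (B ∪ Λ) \ {z} := fun w hw =>
      ⟨Or.inl hw, fun h => Set.disjoint_left.1 hd' hw (by
        rw [Set.mem_singleton_iff.1 h]; exact hzΛ)⟩
    exact hind.notMem_closure_sdiff_of_mem (Or.inr hzΛ)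
      ((matroid K κ).closure_subset_closure h2 h1)
  have hidxa : ∀ l, idx l ≠ a := fun l h => hconst 0 (zero_mem _) (by
    rw [← hva, ← h, hidx]; exact l.2)
  have hidxb : ∀ l, idx l ≠ b := fun l h => hconst 1 (one_mem _) (by
    rw [← hvb, ← h, hidx]; exact l.2)
  have hidxinj : Function.Injective idx := fun l l' h => Subtype.ext (by
    rw [← hidx l, ← hidx l', h])
  let s : Finset (Fin (M + 1)) := insert b (Finset.univ.image idx)
  have has : a ∉ s := by
    simp only [s, Finset.mem_insert, Finset.mem_image, Finset.mem_univ, true_and, not_or,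
      not_exists]
    exact ⟨hab.symm, hidxa⟩
  have hscard : s.card = Λ.card + 1 := by
    rw [Finset.card_insert_of_notMem (by simpa using hidxb),
      Finset.card_image_of_injective _ hidxinj, Finset.card_univ, Fintype.card_coe]
  let I : Finset {m : FormIndex M D // offDegree a m = d} :=
    Finset.univ.filter fun m => m.1.1.support ⊆ insert a s
  have hIcard : (dirRank K X a c v (d + 1) + d).choose d ≤ I.card := by
    have h1 := card_monomials_supported has hd
    rw [hscard, show Λ.card + 1 + d - 1 = Λ.card + d by omega, ← hcard] at h1
    refine h1.trans (le_of_eq ?_)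
    refine (Finset.card_bij (fun m _ => m.1) ?_ ?_ ?_).symm
    · intro m hm
      simp only [I, Finset.mem_filter, Finset.mem_univ, true_and] at hm ⊢
      exact ⟨m.2, hm⟩
    · intro m _ m' _ h
      exact Subtype.ext h
    · intro m hm
      simp only [Finset.mem_filter, Finset.mem_univ, true_and] at hm
      exact ⟨⟨m, hm.1⟩, by simpa [I] using hm.2, rfl⟩
  have hzero : ∀ m : FormIndex M D, m.1.support ⊆ insert a s → ∀ i, i ≠ a → i ≠ b →
      (∀ l, idx l ≠ i) → m.1 i = 0 := by
    intro m hm i hia hib hil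
    refine Finsupp.notMem_support_iff.1 fun h => ?_
    have := hm h
    simp only [s, Finset.mem_insert, Finset.mem_image, Finset.mem_univ, true_and] at this
    rcases this with h | h | ⟨l, h⟩
    exacts [hia h, hib h, hil l h]
  have key := eRk_add_card_le_of_relation (K := K) A
    (fun m : {m : FormIndex M D // offDegree a m = d} => c m) I Λ (B := B) (by rwa [← hsucc])
    hind hd'
    (fun m => offMonomial a v m.1) (fun m l => m.1.1 (idx l)) ?_ ?_ ?_ (by rwa [hcl']) rfl
  · rw [← hsucc, ← coe_natRk hA'fin, ← coe_natRk hAfin] at key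
    have key' : natRk (matroid K κ) (coeffsBelow X a c (d + 1)) + I.card ≤
      natRk (matroid K κ) A + Fintype.card {m : FormIndex M D // offDegree a m = d} := by
      exact_mod_cast key
    omega
  · intro m hm
    have hm' : m.1.1.support ⊆ insert a s := by simpa [I] using hm
    rw [offMonomial]
    have h1 : ∏ l : Λ, (l : κ) ^ m.1.1 (idx l) = ∏ i ∈ Finset.univ.image idx, v i ^ m.1.1 i := by
      rw [Finset.prod_image (fun _ _ _ _ h => hidxinj h)]
      exact Finset.prod_congr rfl fun l _ => by rw [hidx]
    rw [h1]
    symm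
    refine Finset.prod_subset ?_ ?_
    · intro i hi
      obtain ⟨l, -, rfl⟩ := Finset.mem_image.1 hi
      exact Finset.mem_erase.2 ⟨hidxa l, Finset.mem_univ _⟩
    · intro i hi hi'
      by_cases hib : i = b
      · rw [hib, hvb, one_pow]
      · rw [hzero m.1 hm' i (Finset.ne_of_mem_erase hi) hib
          (fun l h => hi' (Finset.mem_image.2 ⟨l, Finset.mem_univ _, h⟩)), pow_zero]
  · intro m hm m' hm' h
    have hm1 : m.1.1.support ⊆ insert a s := by simpa [I] using hm
    have hm1' : m'.1.1.support ⊆ insert a s := by simpa [I] using hm'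
    have hne : ∀ i, i ≠ b → m.1.1 i = m'.1.1 i := by
      intro i hib
      by_cases hia : i = a
      · have h1 := m.2
        have h2 := m'.2
        have h3 := m.1.le a
        have h4 := m'.1.le a
        rw [offDegree] at h1 h2
        rw [hia]
        omega
      · by_cases hil : ∃ l, idx l = i
        · obtain ⟨l, rfl⟩ := hil
          exact congrFun h l
        · push Not at hil
          rw [hzero m.1 hm1 i hia hib hil, hzero m'.1 hm1' i hia hib hil]
    apply Subtype.ext
    apply Subtype.ext
    ext i
    by_cases hib : i = b
    · have h1 := m.1.sum_eq
      have h2 := m'.1.sum_eq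
      rw [← Finset.add_sum_erase _ _ (Finset.mem_univ b)] at h1 h2
      have h3 : ∑ i ∈ Finset.univ.erase b, m.1.1 i = ∑ i ∈ Finset.univ.erase b, m'.1.1 i :=
        Finset.sum_congr rfl fun i hi => hne i (Finset.ne_of_mem_erase hi)
      rw [hib]
      omega
    · exact hne i hib
  · intro m
    rw [hcl']
    exact prod_mem fun i _ => pow_mem (subset_relClosure (K := K) (A ∪ Set.range v)
      (Or.inr ⟨i, rfl⟩)) _

end FormsAtPivot

/-! ### Conditions on a form that is a square along a generic direction -/

section SquareLines

open AlgebraicIndependent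

theorem le_choose_of_pos_of_lt {n j : ℕ} (h0 : 0 < j) (hn : j < n) : n ≤ n.choose j := by
  induction n generalizing j with
  | zero => omega
  | succ n ih =>
    obtain ⟨j, rfl⟩ : ∃ k, j = k + 1 := ⟨j - 1, by omega⟩
    rw [Nat.choose_succ_succ]
    rcases Nat.lt_or_ge (j + 1) n with h | h
    · have := ih (Nat.succ_pos j) h
      have : 0 < n.choose j := Nat.choose_pos (by omega)
      simp only [Nat.succ_eq_add_one] at *
      omega
    · have hjn : n = j + 1 := by omega
      subst hjn
      simp

/-- A sequence that strictly decreases on an interval drops by at least its length. -/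
theorem add_le_of_forall_ne {f : ℕ → ℕ} (hf : Antitone f) (s k : ℕ)
    (h : ∀ d, s ≤ d → d < s + k → f d ≠ f (d + 1)) : f (s + k) + k ≤ f s := by
  induction k with
  | zero => simp
  | succ k ih =>
    have h1 := ih fun d hd hd' => h d hd (by omega)
    have h2 := h (s + k) (by omega) (by omega)
    have h3 := hf (Nat.le_succ (s + k))
    simp only [Nat.succ_eq_add_one] at h3
    rw [show s + (k + 1) = s + k + 1 by omega]
    omega

/-- The exponent of the `D`-th power of the coordinate `a`. -/
noncomputable def purePower {M D : ℕ} (a : Fin (M + 1)) : FormIndex M D :=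
  ⟨Finsupp.single a D, by simp [Finset.mem_finsuppAntidiag]⟩

theorem offDegree_eq_zero_iff {M D : ℕ} {a : Fin (M + 1)} {n : FormIndex M D} :
    offDegree a n = 0 ↔ n = purePower a := by
  constructor
  · intro hn
    have hna : n.1 a = D := by
      have := n.le a
      rw [offDegree] at hn
      omega
    have hsum := n.sum_erase a
    rw [hn, Finset.sum_eq_zero_iff] at hsum
    apply Subtype.ext
    ext i
    by_cases hi : i = a
    · rw [hi, hna]
      simp [purePower]
    · rw [hsum i (Finset.mem_erase.2 ⟨hi, Finset.mem_univ _⟩)]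
      simp [purePower, Ne.symm hi]
  · rintro rfl
    simp [offDegree, purePower]

theorem offMonomial_purePower {M D : ℕ} {R : Type*} [CommRing R] (a : Fin (M + 1))
    (v : Fin (M + 1) → R) : offMonomial a v (purePower a : FormIndex M D) = 1 := by
  rw [offMonomial]
  refine Finset.prod_eq_one fun i hi => ?_
  simp [purePower, (Finset.ne_of_mem_erase hi).symm]

variable {K κ : Type u} [Field K] [Field κ] [Algebra K κ] {m : ℕ}

theorem mem_relClosure_of_sq {s : Set κ} {z : κ} (h : z ^ 2 ∈ relClosure K s) :
    z ∈ relClosure K s := by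
  rw [relClosure, IntermediateField.mem_restrictScalars, mem_algebraicClosure_iff] at h ⊢
  exact h.of_pow two_pos

/-- The coefficients of a square root of a polynomial are algebraic over the coefficients of the
polynomial in an initial range. -/
theorem sqrt_coeff_mem_relClosure [NeZero (2 : κ)] {s : Set κ} {H : ℕ → κ} {j n : ℕ}
    (hlow : ∀ k < j, H k = 0) (hne : H j ≠ 0)
    (hs : ∀ d ≤ j + n,
      ∑ p ∈ Finset.HasAntidiagonal.antidiagonal d, H p.1 * H p.2 ∈ relClosure K s) :
    ∀ k ≤ n, H k ∈ relClosure K s := by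
  intro k
  induction k using Nat.strong_induction_on with
  | _ k ih =>
    intro hk
    rcases lt_trichotomy k j with h | rfl | h
    · rw [hlow k h]
      exact zero_mem _
    · have h1 := hs (k + k) (by omega)
      rw [Finset.sum_eq_single (k, k)] at h1
      · exact mem_relClosure_of_sq (by rwa [sq])
      · rintro ⟨p, q⟩ hpq hne'
        rw [Finset.HasAntidiagonal.mem_antidiagonal] at hpq
        simp only at hpq
        rcases lt_or_ge p k with hp | hp
        · rw [hlow p hp, zero_mul]
        · rw [hlow q (by
            rcases lt_or_ge q k with hq | hq
            · exact hq
            · exact absurd (Prod.ext (by simp; omega) (by simp; omega)) hne'), mul_zero]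
      · simp
    · have h1 := hs (j + k) (by omega)
      have hmem1 : (j, k) ∈ Finset.HasAntidiagonal.antidiagonal (j + k) := by simp
      have hmem2 : (k, j) ∈ (Finset.HasAntidiagonal.antidiagonal (j + k)).erase (j, k) := by
        simp [Finset.mem_erase]
        omega
      rw [← Finset.add_sum_erase _ _ hmem1, ← Finset.add_sum_erase _ _ hmem2] at h1
      have h2 : ∑ x ∈ ((Finset.HasAntidiagonal.antidiagonal (j + k)).erase (j, k)).erase (k, j),
          H x.1 * H x.2 ∈ relClosure K s := by
        refine sum_mem fun x hx => ?_
        obtain ⟨p, q⟩ := x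
        simp only [Finset.mem_erase, Finset.HasAntidiagonal.mem_antidiagonal, ne_eq,
          Prod.mk.injEq] at hx
        simp only
        rcases lt_or_ge p j with hp | hp
        · rw [hlow p hp, zero_mul]
          exact zero_mem _
        · rcases lt_or_ge q j with hq | hq
          · rw [hlow q hq, mul_zero]
            exact zero_mem _
          · exact mul_mem (ih p (by omega) (by omega)) (ih q (by omega) (by omega))
      have hj : H j ∈ relClosure K s := ih j h (by omega)
      have h3 : 2 * H j * H k ∈ relClosure K s := by
        have := sub_mem h1 h2
        convert this using 1
        ring
      have h4 : (2 * H j)⁻¹ * (2 * H j * H k) ∈ relClosure K s :=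
        mul_mem (inv_mem (mul_mem (ofNat_mem _ 2) hj)) h3
      rwa [inv_mul_cancel_left₀ (mul_ne_zero (NeZero.ne _) hne)] at h4

/-- Of the `M + 1` coordinates of a normalised direction two are constant. -/
theorem dirRank_add_one_le {M D : ℕ} {X : Set κ} (hX : X.Finite) {a b : Fin (M + 1)} (hab : b ≠ a)
    (c : FormIndex M D → κ) {v : Fin (M + 1) → κ} (hva : v a = 0) (hvb : v b = 1) (d : ℕ) :
    dirRank K X a c v d + 1 ≤ M := by
  classical
  have h0 := natRk_coeffsBelow_add_dirRank (K := K) hX a c v d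
  set A := coeffsBelow X a c d
  have hA : A.Finite := coeffsBelow_finite hX a c d
  let s : Finset (Fin (M + 1)) := (Finset.univ.erase a).erase b
  have hs : s.card + 1 = M := by
    have h1 : b ∈ Finset.univ.erase a := Finset.mem_erase.2 ⟨hab, Finset.mem_univ b⟩
    have := Finset.card_erase_add_one h1
    rw [Finset.card_erase_of_mem (Finset.mem_univ a), Finset.card_univ, Fintype.card_fin] at this
    simpa using this
  have h1 : natRk (matroid K κ) (A ∪ Set.range v) ≤
      natRk (matroid K κ) (A ∪ v '' s ∪ {0, 1}) := by
    refine natRk_mono ?_ ((hA.union (Set.toFinite _)).union (Set.toFinite _))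
    rintro z (hz | ⟨i, rfl⟩)
    · exact Or.inl (Or.inl hz)
    · by_cases hia : i = a
      · exact Or.inr (Or.inl (by rw [hia, hva]))
      by_cases hib : i = b
      · exact Or.inr (Or.inr (by rw [hib, hvb]; rfl))
      · exact Or.inl (Or.inr ⟨i, by simp [s, hia, hib], rfl⟩)
  have h2 : natRk (matroid K κ) (A ∪ v '' s ∪ {0, 1}) = natRk (matroid K κ) (A ∪ v '' s) := by
    refine natRk_closure_eq_of_subset ?_ Set.subset_union_left
    rintro z (hz | rfl | rfl)
    · exact mem_relClosure.1 (subset_relClosure _ hz)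
    · exact mem_relClosure.1 (zero_mem _)
    · exact mem_relClosure.1 (one_mem _)
  have h3 := natRk_union_le (N := matroid K κ) hA (Set.toFinite (v '' s))
  have h4 : (v '' s).ncard ≤ s.card := by
    rw [← Set.ncard_coe_finset]
    exact Set.ncard_image_le (Finset.finite_toSet s)
  omega

/-- Conditions on the coefficients of off-degree `d` over those of lower off-degree are conditions
on the whole form, and each vanishing coefficient in a set `z` of lower off-degree is one more. -/
theorem natRk_coeffsBelow_top_le {M D : ℕ} {X : Set κ} (hX : X.Finite) (a : Fin (M + 1))
    (c : FormIndex M D → κ) (d : ℕ) (z : Finset (FormIndex M D))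
    (hz : ∀ m ∈ z, c m = 0 ∧ offDegree a m < d) :
    natRk (matroid K κ) (X ∪ Set.range c) + Fintype.card {m : FormIndex M D // offDegree a m = d} +
      natRk (matroid K κ) (coeffsBelow X a c d) + z.card ≤
    natRk (matroid K κ) (coeffsBelow X a c (d + 1)) + natRk (matroid K κ) X +
      Fintype.card (FormIndex M D) := by
  classical
  let lo : Finset (FormIndex M D) := Finset.univ.filter fun m => offDegree a m < d
  let mid : Finset (FormIndex M D) := Finset.univ.filter fun m => offDegree a m = d
  let hi : Finset (FormIndex M D) := Finset.univ.filter fun m => d < offDegree a m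
  have hcard : lo.card + mid.card + hi.card = Fintype.card (FormIndex M D) := by
    rw [← Finset.card_union_of_disjoint, ← Finset.card_union_of_disjoint, ← Finset.card_univ]
    · congr 1
      ext m
      simp only [lo, mid, hi, Finset.mem_union, Finset.mem_filter, Finset.mem_univ, true_and,
        iff_true]
      omega
    · rw [Finset.disjoint_left]
      intro m hm
      simp only [lo, mid, hi, Finset.mem_union, Finset.mem_filter, Finset.mem_univ,
        true_and] at hm ⊢
      omega
    · rw [Finset.disjoint_left]
      intro m hm
      simp only [lo, mid, Finset.mem_filter, Finset.mem_univ, true_and] at hm ⊢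
      omega
  have hmid : Fintype.card {m : FormIndex M D // offDegree a m = d} = mid.card :=
    Fintype.card_subtype _
  have himage : ∀ s : Finset (FormIndex M D), (c '' s).ncard ≤ s.card := fun s => by
    rw [← Set.ncard_coe_finset]
    exact Set.ncard_image_le (Finset.finite_toSet s)
  have h1 : natRk (matroid K κ) (X ∪ Set.range c) ≤
      natRk (matroid K κ) (coeffsBelow X a c (d + 1)) + hi.card := by
    refine (natRk_mono ?_ ((coeffsBelow_finite hX a c (d + 1)).union
      (Set.toFinite (c '' hi)))).trans ((natRk_union_le (coeffsBelow_finite hX a c _)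
        (Set.toFinite _)).trans (Nat.add_le_add_left (himage hi) _))
    rintro w (hw | ⟨m, rfl⟩)
    · exact Or.inl (Or.inl hw)
    · rcases Nat.lt_or_ge d (offDegree a m) with h | h
      · exact Or.inr ⟨m, by simpa [hi] using h, rfl⟩
      · exact Or.inl (Or.inr ⟨m, Nat.lt_succ_of_le h, rfl⟩)
  have hzlo : z ⊆ lo := fun m hm => by simpa [lo] using (hz m hm).2
  have h2 : natRk (matroid K κ) (coeffsBelow X a c d) ≤
      natRk (matroid K κ) X + (lo \ z).card := by
    refine le_trans (natRk_mono (t := X ∪ c '' (lo \ z : Finset _) ∪ {0}) ?_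
      ((hX.union (Set.toFinite _)).union (Set.toFinite _))) ?_
    · rintro w (hw | ⟨m, hm, rfl⟩)
      · exact Or.inl (Or.inl hw)
      · by_cases hmz : m ∈ z
        · exact Or.inr (hz m hmz).1
        · refine Or.inl (Or.inr ⟨m, ?_, rfl⟩)
          rw [Finset.mem_coe, Finset.mem_sdiff]
          exact ⟨by simpa [lo] using hm, hmz⟩
    · rw [natRk_closure_eq_of_subset (s := X ∪ c '' (lo \ z : Finset _)) ?_ Set.subset_union_left]
      · exact (natRk_union_le hX (Set.toFinite _)).trans (Nat.add_le_add_left (himage _) _)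
      · rintro w (hw | rfl)
        · exact mem_relClosure.1 (subset_relClosure _ hw)
        · exact mem_relClosure.1 (zero_mem _)
  rw [Finset.card_sdiff_of_subset hzlo] at h2
  have := Finset.card_le_card hzlo
  omega

/-- **The main count.** Let a form of degree `2m` in `m + 2` variables, with coefficients `c` with
respect to coordinates centred at a point, restrict to a square on a line through this point whose
direction `v` is not algebraic over the coefficients. Then the coefficients satisfy at least
`m + 2` independent conditions. Here `H` is the sequence of coefficients of the square root and `j`
its order, or `m` if the root vanishes to a higher order, that is, is zero. -/
theorem natRk_add_le_of_square [NeZero (2 : κ)] {X : Set κ} (hX : X.Finite)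
    {a b : Fin (m + 1 + 1)} (hab : b ≠ a) (c : FormIndex (m + 1) (2 * m) → κ)
    {v : Fin (m + 1 + 1) → κ} (hva : v a = 0) (hvb : v b = 1) {H : ℕ → κ} {j : ℕ} (hj : j ≤ m)
    (hlow : ∀ k < j, H k = 0) (hhigh : ∀ k, m < k → H k = 0) (hne : H j ≠ 0 ∨ j = m)
    (hsq : ∀ d ≤ 2 * m,
      ∑ n : {n : FormIndex (m + 1) (2 * m) // offDegree a n = d}, c n * offMonomial a v n.1 =
        ∑ p ∈ Finset.HasAntidiagonal.antidiagonal d, H p.1 * H p.2)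
    (htr : ¬ Set.range v ⊆ relClosure K (X ∪ Set.range c)) :
    natRk (matroid K κ) (X ∪ Set.range c) + (m + 2) ≤
      natRk (matroid K κ) X + Fintype.card (FormIndex (m + 1) (2 * m)) := by
  have hanti := dirRank_antitone (K := K) hX a c v
  have hfull : ∀ d, 2 * m < d → coeffsBelow X a c d = X ∪ Set.range c := by
    intro d hd
    rw [coeffsBelow, Set.eq_univ_of_forall (s := {n | offDegree a n < d})
      (fun n => (offDegree_le a n).trans_lt hd), Set.image_univ]
  have hpos : 1 ≤ dirRank K X a c v (2 * m + 1) := by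
    by_contra h0
    apply htr
    have h1 := natRk_coeffsBelow_add_dirRank (K := K) hX a c v (2 * m + 1)
    rw [hfull _ (Nat.lt_succ_self _)] at h1
    have h2 := closure_eq_of_natRk_le (N := matroid K κ)
      (Set.subset_union_left (s := X ∪ Set.range c) (t := Set.range v))
      ((hX.union (Set.finite_range c)).union (Set.finite_range v)) (by omega)
    intro z hz
    rw [SetLike.mem_coe, mem_relClosure, h2, ← mem_relClosure]
    exact subset_relClosure _ (Or.inr hz)
  have htop : ∀ d, dirRank K X a c v d ≤ m := fun d => by
    have := dirRank_add_one_le (K := K) hX hab c hva hvb d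
    omega
  -- the value of each homogeneous part at `v` lies in the field of the coefficients and `v`
  have hvals : ∀ d e, d < e → d ≤ 2 * m → ∑ p ∈ Finset.HasAntidiagonal.antidiagonal d,
      H p.1 * H p.2 ∈ relClosure K (coeffsBelow X a c e ∪ Set.range v) := by
    intro d e hde hd
    rw [← hsq d hd]
    refine sum_mem fun n _ => mul_mem ?_ (prod_mem fun i _ => pow_mem ?_ _)
    · exact subset_relClosure _ (Or.inl (Or.inr ⟨n, n.2.trans_lt hde, rfl⟩))
    · exact subset_relClosure _ (Or.inr ⟨i, rfl⟩)
  -- A stationary degree above `m + j`: the square root is determined by the parts up to degree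
  -- `m + j`, and the number of conditions is at least `d + 1`, since `v` has rank at least one.
  have hupper : ∀ d, m + j + 1 ≤ d → d ≤ 2 * m →
      dirRank K X a c v d = dirRank K X a c v (d + 1) →
      natRk (matroid K κ) (coeffsBelow X a c (d + 1)) + (m + 2) ≤
        natRk (matroid K κ) (coeffsBelow X a c d) +
          Fintype.card {n : FormIndex (m + 1) (2 * m) // offDegree a n = d} := by
    intro d hd hd2 hstat
    have hH0 : H j ≠ 0 := hne.resolve_right (by omega)
    have hH : ∀ k, H k ∈ relClosure K (coeffsBelow X a c d ∪ Set.range v) := by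
      intro k
      rcases Nat.lt_or_ge m k with h | h
      · rw [hhigh k h]
        exact zero_mem _
      · exact sqrt_coeff_mem_relClosure hlow hH0
          (fun e he => hvals e d (by omega) (by omega)) k h
    have h1 := natRk_coeffsBelow_succ_add_choose_le (K := K) hX hab c hva hvb hd2 hstat (by
      rw [hsq d hd2]
      exact sum_mem fun p _ => mul_mem (hH _) (hH _))
    have h2 : 1 ≤ dirRank K X a c v (d + 1) := hpos.trans (hanti (by omega))
    have h3 : (1 + d).choose d ≤ (dirRank K X a c v (d + 1) + d).choose d :=
      Nat.choose_le_choose d (by omega)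
    rw [add_comm 1 d, Nat.choose_succ_self_right] at h3
    omega
  by_cases hup : ∃ d, m + j + 1 ≤ d ∧ d ≤ 2 * m ∧
      dirRank K X a c v d = dirRank K X a c v (d + 1)
  · obtain ⟨d, hd, hd2, hstat⟩ := hup
    have h1 := hupper d hd hd2 hstat
    have h2 := natRk_coeffsBelow_top_le (K := K) hX a c d ∅ (by simp)
    omega
  -- Otherwise the rank drops at all `m - j` degrees above `m + j`. It cannot drop at all `j`
  -- degrees from `j` to `2j - 1` as well, because in total it drops by at most `m - 1`.
  · push Not at hup
    have h1 := add_le_of_forall_ne hanti (m + j + 1) (m - j) fun d hd hd' =>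
      hup d hd (by omega)
    rw [show m + j + 1 + (m - j) = 2 * m + 1 by omega] at h1
    have hj0 : 0 < j := by
      rcases Nat.eq_zero_or_pos j with rfl | h
      · have := htop (m + 0 + 1)
        omega
      · exact h
    obtain ⟨d, hd, hd2, hstat⟩ : ∃ d, j ≤ d ∧ d < j + j ∧
        dirRank K X a c v d = dirRank K X a c v (d + 1) := by
      by_contra hcon
      push Not at hcon
      have h2 := add_le_of_forall_ne hanti j j hcon
      have h3 : dirRank K X a c v (m + j + 1) ≤ dirRank K X a c v (j + j) := hanti (by omega)
      have h4 := htop j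
      omega
    have hzero : ∀ d < j + j, ∑ p ∈ Finset.HasAntidiagonal.antidiagonal d, H p.1 * H p.2 = 0 := by
      intro d hd
      refine Finset.sum_eq_zero fun p hp => ?_
      rw [Finset.HasAntidiagonal.mem_antidiagonal] at hp
      rcases Nat.lt_or_ge p.1 j with h | h
      · rw [hlow _ h, zero_mul]
      · rw [hlow p.2 (by omega), mul_zero]
    have h2 := natRk_coeffsBelow_succ_add_choose_le (K := K) hX hab c hva hvb (by omega) hstat (by
      rw [hsq d (by omega), hzero d hd2]
      exact zero_mem _)
    -- the drops above `m + j` leave a rank of at least `m + 1 - j` here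
    have h3 : m + 1 ≤ (dirRank K X a c v (d + 1) + d).choose d := by
      have h4 : m + 1 - j ≤ dirRank K X a c v (d + 1) := by
        have : dirRank K X a c v (m + j + 1) ≤ dirRank K X a c v (d + 1) := hanti (by omega)
        omega
      calc m + 1 ≤ (m + 1).choose j := le_choose_of_pos_of_lt hj0 (by omega)
        _ ≤ (dirRank K X a c v (d + 1) + j).choose j := Nat.choose_le_choose j (by omega)
        _ = (dirRank K X a c v (d + 1) + j).choose (dirRank K X a c v (d + 1)) :=
          (Nat.choose_symm_add).symm
        _ ≤ (dirRank K X a c v (d + 1) + d).choose (dirRank K X a c v (d + 1)) :=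
          Nat.choose_le_choose _ (by omega)
        _ = _ := Nat.choose_symm_add
    -- the constant term vanishes as well, which is one more condition
    let n₀ : FormIndex (m + 1) (2 * m) := purePower a
    have hn₀ : offDegree a n₀ = 0 := offDegree_eq_zero_iff.2 rfl
    have hc₀ : c n₀ = 0 := by
      have h5 := hsq 0 (by omega)
      rw [hzero 0 (by omega), Finset.sum_eq_single ⟨n₀, hn₀⟩] at h5
      · rwa [offMonomial_purePower, mul_one] at h5
      · rintro ⟨n, hn⟩ _ hne'
        exact absurd (Subtype.ext (offDegree_eq_zero_iff.1 hn)) hne'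
      · simp
    have h4 := natRk_coeffsBelow_top_le (K := K) hX a c d {n₀} (by
      intro n hn
      rw [Finset.mem_singleton.1 hn, hn₀]
      exact ⟨hc₀, by omega⟩)
    rw [Finset.card_singleton] at h4
    omega

end SquareLines

/-! ### Change of the point -/

section Shift

open AlgebraicIndependent MvPolynomial

variable {M D : ℕ} {R S : Type*} [CommRing R] [CommRing S]

/-- The form with coefficient vector `c` over a commutative ring; compare `formOf`. -/
noncomputable def ringForm (c : FormIndex M D → R) : MvPolynomial (Fin (M + 1)) R :=
  ∑ n : FormIndex M D, monomial n.1 (c n)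

theorem ringForm_isHomogeneous (c : FormIndex M D → R) : (ringForm c).IsHomogeneous D :=
  IsHomogeneous.sum _ _ _ fun n _ => isHomogeneous_monomial _ (by
    rw [Finsupp.degree_eq_sum]; exact n.sum_eq)

theorem coeff_ringForm (c : FormIndex M D → R) (n : FormIndex M D) :
    coeff n.1 (ringForm c) = c n := by
  rw [ringForm, coeff_sum, Finset.sum_eq_single n]
  · simp
  · intro k _ hk
    rw [coeff_monomial, if_neg fun h => hk (Subtype.ext h)]
  · simp

theorem ringForm_coeff {P : MvPolynomial (Fin (M + 1)) R} (hP : P.IsHomogeneous D) :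
    ringForm (fun n : FormIndex M D => coeff n.1 P) = P := by
  ext k
  by_cases hk : k.degree = D
  · exact coeff_ringForm (fun n : FormIndex M D => coeff n.1 P)
      ⟨k, by simp [Finset.mem_finsuppAntidiag, ← Finsupp.degree_eq_sum, hk]⟩
  · rw [(ringForm_isHomogeneous _).coeff_eq_zero hk, hP.coeff_eq_zero hk]

theorem map_ringForm (φ : R →+* S) (c : FormIndex M D → R) :
    map φ (ringForm c) = ringForm (φ ∘ c) := by
  simp [ringForm, map_monomial]

/-- The coefficients of the form obtained from the form `c` by the substitution
`X_i ↦ X_i + y_i X_a`, which for `y_a = 0` moves the point `e_a + y` to `e_a`. -/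
noncomputable def shiftForm (y : Fin (M + 1) → R) (a : Fin (M + 1)) (c : FormIndex M D → R) :
    FormIndex M D → R := fun n =>
  coeff n.1 (aeval (fun i => X i + C (y i) * X a) (ringForm c))

theorem ringForm_shiftForm (y : Fin (M + 1) → R) (a : Fin (M + 1)) (c : FormIndex M D → R) :
    ringForm (shiftForm y a c) = aeval (fun i => X i + C (y i) * X a) (ringForm c) := by
  refine ringForm_coeff ?_
  have := (ringForm_isHomogeneous c).aeval (fun i => X i + C (y i) * X a) (n := 1) fun i =>
    (isHomogeneous_X R i).add (by simpa using (isHomogeneous_C _ (y i)).mul (isHomogeneous_X R a))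
  rwa [one_mul] at this

theorem map_shiftForm (φ : R →+* S) (y : Fin (M + 1) → R) (a : Fin (M + 1))
    (c : FormIndex M D → R) (n : FormIndex M D) :
    φ (shiftForm y a c n) = shiftForm (φ ∘ y) a (φ ∘ c) n := by
  rw [shiftForm, shiftForm, ← coeff_map, ← map_ringForm]
  congr 1
  rw [aeval_def, aeval_def, eval₂_map, ← coe_eval₂Hom, ← RingHom.comp_apply, ← coe_eval₂Hom]
  congr 1
  apply ringHom_ext <;> intro <;> simp [algebraMap_eq]

/-- The substitution of `shiftForm` is inverted by the one with the opposite sign. -/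
theorem shiftForm_neg_shiftForm {y : Fin (M + 1) → R} {a : Fin (M + 1)} (hy : y a = 0)
    (c : FormIndex M D → R) : shiftForm (-y) a (shiftForm y a c) = c := by
  funext n
  rw [shiftForm, ringForm_shiftForm, ← coeff_ringForm c n]
  congr 1
  rw [← AlgHom.comp_apply]
  conv_rhs => rw [← aeval_X_left_apply (ringForm c)]
  congr 1
  ext i : 1
  simp [hy]

/-- The restriction of the form `c` to the line through `x` and `v`, in the affine coordinate with
origin `x`; compare `restrictToLine`. -/
noncomputable def lineForm (c : FormIndex M D → R) (x v : Fin (M + 1) → R) : Polynomial R :=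
  aeval (fun i => Polynomial.C (x i) + Polynomial.C (v i) * Polynomial.X) (ringForm c)

theorem map_lineForm (φ : R →+* S) (c : FormIndex M D → R) (x v : Fin (M + 1) → R) :
    (lineForm c x v).map φ = lineForm (φ ∘ c) (φ ∘ x) (φ ∘ v) := by
  rw [lineForm, lineForm, ← map_ringForm, aeval_def, aeval_def, eval₂_map, ← coe_eval₂Hom,
    ← Polynomial.coe_mapRingHom, ← RingHom.comp_apply, ← coe_eval₂Hom]
  congr 1
  apply ringHom_ext <;> intro <;> simp [Polynomial.algebraMap_eq]

theorem lineForm_shiftForm {y v : Fin (M + 1) → R} {a : Fin (M + 1)} (hv : v a = 0)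
    (c : FormIndex M D → R) :
    lineForm (shiftForm y a c) (Pi.single a 1) v = lineForm c (Pi.single a 1 + y) v := by
  rw [lineForm, lineForm, ringForm_shiftForm, ← AlgHom.restrictScalars_apply R (aeval _),
    ← AlgHom.comp_apply]
  congr 1
  ext i : 1
  simp [hv, Polynomial.algebraMap_eq]
  ring

/-- Along a line through the coordinate point `e_a` the coefficient of `t ^ d` is the value at the
direction of the part of off-degree `d`. -/
theorem coeff_lineForm_single {v : Fin (M + 1) → R} {a : Fin (M + 1)} (hv : v a = 0)
    (c : FormIndex M D → R) (d : ℕ) :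
    (lineForm c (Pi.single a 1) v).coeff d =
      ∑ n : {n : FormIndex M D // offDegree a n = d}, c n * offMonomial a v n.1 := by
  classical
  have h : lineForm c (Pi.single a 1) v = ∑ n : FormIndex M D,
      Polynomial.C (c n * offMonomial a v n) * Polynomial.X ^ offDegree a n := by
    rw [lineForm, ringForm, map_sum]
    refine Finset.sum_congr rfl fun n _ => ?_
    rw [aeval_monomial, Finsupp.prod_fintype _ _ (fun _ => pow_zero _),
      ← Finset.mul_prod_erase _ _ (Finset.mem_univ a), ← n.sum_erase, ← Finset.prod_pow_eq_pow_sum,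
      Polynomial.C_mul, offMonomial, map_prod, mul_assoc, ← Finset.prod_mul_distrib]
    simp only [Pi.single_eq_same, hv, map_one, map_zero, zero_mul, add_zero, one_pow, one_mul,
      Polynomial.algebraMap_eq]
    congr 1
    refine Finset.prod_congr rfl fun i hi => ?_
    rw [Pi.single_eq_of_ne (Finset.ne_of_mem_erase hi)]
    simp [mul_pow]
  rw [h, Polynomial.finsetSum_coeff]
  simp only [Polynomial.coeff_C_mul_X_pow]
  rw [← Finset.sum_filter]
  rw [Finset.sum_subtype (p := fun n => offDegree a n = d)]
  intro n
  simp [eq_comm]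

variable {K κ : Type u} [Field K] [Field κ] [Algebra K κ] {m : ℕ}

theorem shiftForm_mem_relClosure {s : Set κ} {y : Fin (M + 1) → κ} (a : Fin (M + 1))
    {c : FormIndex M D → κ} (hy : ∀ i, y i ∈ relClosure K s) (hc : ∀ n, c n ∈ relClosure K s)
    (n : FormIndex M D) : shiftForm y a c n ∈ relClosure K s := by
  have := map_shiftForm (relClosure K s).toSubring.subtype (fun i => ⟨y i, hy i⟩) a
    (fun n => ⟨c n, hc n⟩) n
  have h2 : shiftForm y a c n = _ := this.symm
  rw [h2]
  exact Subtype.prop (p := fun z => z ∈ (relClosure K s).toSubring) _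

theorem range_subset_relClosure_shiftForm {s : Set κ} {y : Fin (M + 1) → κ} {a : Fin (M + 1)}
    (hya : y a = 0) {c : FormIndex M D → κ} (hy : ∀ i, y i ∈ relClosure K s) :
    Set.range c ⊆ relClosure K (s ∪ Set.range (shiftForm y a c)) := by
  rintro _ ⟨n, rfl⟩
  have h := shiftForm_mem_relClosure (s := s ∪ Set.range (shiftForm y a c)) (y := -y)
    (c := shiftForm y a c) a (fun i => neg_mem (relClosure_mono Set.subset_union_left (hy i)))
    (fun k => subset_relClosure _ (Or.inr ⟨k, rfl⟩)) n
  rwa [shiftForm_neg_shiftForm hya] at h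

theorem relClosure_union_range_shiftForm {s : Set κ} {y : Fin (M + 1) → κ} {a : Fin (M + 1)}
    (hya : y a = 0) {c : FormIndex M D → κ} (hy : ∀ i, y i ∈ relClosure K s) :
    relClosure K (s ∪ Set.range (shiftForm y a c)) = relClosure K (s ∪ Set.range c) := by
  have key : ∀ {t t' : Set κ}, t ⊆ relClosure K t' → relClosure K t ≤ relClosure K t' := by
    intro t t' h z hz
    rw [mem_relClosure] at hz ⊢
    have h' : t ⊆ (matroid K κ).closure t' := fun w hw => mem_relClosure.1 (h hw)
    exact (matroid K κ).closure_subset_closure_of_subset_closure h' hz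
  refine le_antisymm (key ?_) (key ?_)
  · refine Set.union_subset (Set.subset_union_left.trans (subset_relClosure _)) ?_
    rintro _ ⟨n, rfl⟩
    exact shiftForm_mem_relClosure a (fun i => relClosure_mono Set.subset_union_left (hy i))
      (fun k => subset_relClosure _ (Or.inr (Set.mem_range_self k))) n
  · exact Set.union_subset (Set.subset_union_left.trans (subset_relClosure _))
      (range_subset_relClosure_shiftForm hya hy)

/-- Over the coordinates of a point, moving the point does not change the transcendence degree of
the coefficients of a form. -/
theorem natRk_union_range_shiftForm {s : Set κ} {y : Fin (M + 1) → κ} {a : Fin (M + 1)}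
    (hya : y a = 0) {c : FormIndex M D → κ} (hy : ∀ i, y i ∈ relClosure K s) :
    natRk (matroid K κ) (s ∪ Set.range (shiftForm y a c)) =
      natRk (matroid K κ) (s ∪ Set.range c) := by
  have h := relClosure_union_range_shiftForm hya (c := c) hy
  have h' : (matroid K κ).closure (s ∪ Set.range (shiftForm y a c)) =
      (matroid K κ).closure (s ∪ Set.range c) := by
    ext z
    rw [← mem_relClosure, h, mem_relClosure]
  rw [natRk, natRk, ← Matroid.eRk_closure_eq, h', Matroid.eRk_closure_eq]

/-- `natRk_add_le_of_square` for the lines through an arbitrary point `x` with `x_a = 1`. -/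
theorem natRk_add_le_of_lineForm_eq_sq [NeZero (2 : κ)] {a b : Fin (m + 1 + 1)} (hab : b ≠ a)
    (c : FormIndex (m + 1) (2 * m) → κ) {x v : Fin (m + 1 + 1) → κ} (hxa : x a = 1)
    (hva : v a = 0) (hvb : v b = 1) {P : Polynomial κ} (hP : P.natDegree ≤ m) {j : ℕ} (hj : j ≤ m)
    (hlow : ∀ k < j, P.coeff k = 0) (hne : P.coeff j ≠ 0 ∨ j = m)
    (hsq : lineForm c x v = P ^ 2)
    (htr : ¬ Set.range v ⊆ relClosure K (Set.range x ∪ Set.range c)) :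
    natRk (matroid K κ) (Set.range x ∪ Set.range c) + (m + 2) ≤
      natRk (matroid K κ) (Set.range x) + Fintype.card (FormIndex (m + 1) (2 * m)) := by
  have hy : ∀ i, (x - Pi.single a 1 : Fin (m + 1 + 1) → κ) i ∈ relClosure K (Set.range x) := by
    intro i
    refine sub_mem (subset_relClosure _ (Set.mem_range_self i)) ?_
    rw [Pi.single_apply]
    split_ifs
    · exact one_mem _
    · exact zero_mem _
  have hya : (x - Pi.single a 1 : Fin (m + 1 + 1) → κ) a = 0 := by simp [hxa]
  rw [← natRk_union_range_shiftForm hya hy]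
  refine natRk_add_le_of_square (Set.finite_range x) hab _ hva hvb hj hlow
    (fun k hk => Polynomial.coeff_eq_zero_of_natDegree_lt (hP.trans_lt hk)) hne (fun d _ => ?_) ?_
  · rw [← coeff_lineForm_single hva, lineForm_shiftForm hva, add_sub_cancel, hsq, pow_two,
      Polynomial.coeff_mul]
  · rwa [relClosure_union_range_shiftForm hya hy]

end Shift

/-! ### Families of forms that are squares on lines -/

section FamiliesOfForms

open AlgebraicIndependent MvPolynomial

variable {K : Type u} [Field K] {m : ℕ}

/-- The directions `v`, normalised by `v_a = 0` and `v_b = 1`, of lines through `x` on which the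
form `c` is the square of a form of degree `m`. -/
def squareDirections (c : FormIndex (m + 1) (2 * m) → K) (x : Fin (m + 1 + 1) → K)
    (a b : Fin (m + 1 + 1)) : Set (Fin (m + 1 + 1) → K) :=
  {v | v a = 0 ∧ v b = 1 ∧ ∃ P : Polynomial K, P.natDegree ≤ m ∧ lineForm c x v = P ^ 2}

/-- The polynomial of degree at most `m` with coefficients `H`. -/
noncomputable def polyOfFin {R : Type*} [CommRing R] (H : Fin (m + 1) → R) : Polynomial R :=
  ∑ k, Polynomial.C (H k) * Polynomial.X ^ (k : ℕ)

theorem map_polyOfFin {R S : Type*} [CommRing R] [CommRing S] (φ : R →+* S) (H : Fin (m + 1) → R) :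
    (polyOfFin H).map φ = polyOfFin (φ ∘ H) := by
  simp [polyOfFin, Polynomial.map_sum]

theorem coeff_polyOfFin {R : Type*} [CommRing R] (H : Fin (m + 1) → R) (k : Fin (m + 1)) :
    (polyOfFin H).coeff k = H k := by
  rw [polyOfFin, Polynomial.finsetSum_coeff, Finset.sum_eq_single k]
  · simp
  · intro l _ hl
    rw [Polynomial.coeff_C_mul_X_pow, if_neg fun h => hl (Fin.ext h.symm)]
  · simp

theorem natDegree_polyOfFin_le {R : Type*} [CommRing R] (H : Fin (m + 1) → R) :
    (polyOfFin H).natDegree ≤ m :=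
  Polynomial.natDegree_sum_le_of_forall_le _ _ fun k _ =>
    (Polynomial.natDegree_C_mul_X_pow_le _ _).trans (Nat.lt_succ_iff.1 k.2)

theorem polyOfFin_coeff {R : Type*} [CommRing R] {P : Polynomial R} (hP : P.natDegree ≤ m) :
    polyOfFin (fun k : Fin (m + 1) => P.coeff k) = P := by
  rw [polyOfFin, Fin.sum_univ_eq_sum_range (fun k => Polynomial.C (P.coeff k) * Polynomial.X ^ k)]
  exact (P.as_sum_range_C_mul_X_pow' (Nat.lt_succ_of_le hP)).symm

theorem map_lineForm_algHom {A B : Type*} [CommRing A] [CommRing B] [Algebra K A] [Algebra K B]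
    {M D : ℕ} (φ : A →ₐ[K] B) (c : FormIndex M D → A) (x v : Fin (M + 1) → A) :
    (lineForm c x v).map (φ : A →+* B) =
      lineForm (fun n => φ (c n)) (fun i => φ (x i)) (fun i => φ (v i)) :=
  map_lineForm (φ : A →+* B) c x v

/-- Index set for a form, a point, a direction, a square root and one auxiliary variable. -/
abbrev SquareLineIndex (m : ℕ) : Type :=
  (FormIndex (m + 1) (2 * m) ⊕ Fin (m + 1 + 1)) ⊕ (Fin (m + 1 + 1) ⊕ Option (Fin (m + 1)))

/-- The data `(c, x, v, H, u)` of a form `c`, a point `x` with the coordinates `x_i`, `i ∉ free`,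
those of `x₀`, a normalised direction `v`, and a square root `H` of order `j` (or `≥ j = m`) of the
restriction of the form. That `H_j` is not zero is expressed by the auxiliary variable `u`. -/
def squareLineData (x₀ : Fin (m + 1 + 1) → K) (free : Finset (Fin (m + 1 + 1)))
    (a b : Fin (m + 1 + 1)) (j : Fin (m + 1)) : Set (SquareLineIndex m → K) :=
  {s | (∀ i ∉ free, s (.inl (.inr i)) = x₀ i) ∧ s (.inr (.inl a)) = 0 ∧ s (.inr (.inl b)) = 1 ∧
    lineForm (fun n => s (.inl (.inl n))) (fun i => s (.inl (.inr i)))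
        (fun i => s (.inr (.inl i))) =
      polyOfFin (fun k => s (.inr (.inr (some k)))) ^ 2 ∧
    (∀ k < j, s (.inr (.inr (some k))) = 0) ∧
    (s (.inr (.inr (some j))) * s (.inr (.inr none)) = 1 ∨ (j : ℕ) = m)}

/-- A point with coordinates in an extension field at which all polynomials vanishing on
`squareLineData` vanish satisfies the equations of `squareLineData`. -/
theorem squareLineData_generic {x₀ : Fin (m + 1 + 1) → K} {free : Finset (Fin (m + 1 + 1))}
    {a b : Fin (m + 1 + 1)} {j : Fin (m + 1)} {κ : Type u} [Field κ] [Algebra K κ]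
    {p : SquareLineIndex m → κ}
    (hp : ∀ G : MvPolynomial (SquareLineIndex m) K,
      (∀ s ∈ squareLineData x₀ free a b j, aeval s G = 0) → aeval p G = 0) :
    (∀ i ∉ free, p (.inl (.inr i)) = algebraMap K κ (x₀ i)) ∧
    p (.inr (.inl a)) = 0 ∧ p (.inr (.inl b)) = 1 ∧
    lineForm (fun n => p (.inl (.inl n))) (fun i => p (.inl (.inr i)))
        (fun i => p (.inr (.inl i))) =
      polyOfFin (fun k => p (.inr (.inr (some k)))) ^ 2 ∧
    (∀ k < j, p (.inr (.inr (some k))) = 0) ∧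
    (p (.inr (.inr (some j))) ≠ 0 ∨ (j : ℕ) = m) := by
  refine ⟨fun i hi => ?_, ?_, ?_, ?_, fun k hk => ?_, ?_⟩
  · have := hp (X (.inl (.inr i)) - C (x₀ i)) fun s hs => by simp [hs.1 i hi]
    simpa [sub_eq_zero] using this
  · simpa using hp (X (.inr (.inl a))) fun s hs => by simp [hs.2.1]
  · have := hp (X (.inr (.inl b)) - 1) fun s hs => by simp [hs.2.2.1]
    simpa only [map_sub, aeval_X, map_one, sub_eq_zero] using this
  · let Q : Polynomial (MvPolynomial (SquareLineIndex m) K) :=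
      lineForm (fun n => X (.inl (.inl n))) (fun i => X (.inl (.inr i)))
        (fun i => X (.inr (.inl i))) - polyOfFin (fun k => X (.inr (.inr (some k)))) ^ 2
    have hQ : ∀ {B : Type u} [CommRing B] [Algebra K B] (s : SquareLineIndex m → B),
        Q.map (aeval (R := K) s : MvPolynomial (SquareLineIndex m) K →+* B) =
        lineForm (fun n => s (.inl (.inl n))) (fun i => s (.inl (.inr i)))
          (fun i => s (.inr (.inl i))) - polyOfFin (fun k => s (.inr (.inr (some k)))) ^ 2 := by
      intro B _ _ s
      rw [Polynomial.map_sub, Polynomial.map_pow, map_lineForm, map_polyOfFin]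
      simp [Function.comp_def]
    rw [← sub_eq_zero, ← hQ p]
    ext d
    rw [Polynomial.coeff_map, Polynomial.coeff_zero]
    refine hp _ fun s hs => ?_
    have h := hQ s
    rw [hs.2.2.2.1, sub_self] at h
    have := congrArg (Polynomial.coeff · d) h
    rwa [Polynomial.coeff_map, Polynomial.coeff_zero] at this
  · simpa using hp (X (.inr (.inr (some k)))) fun s hs => by simp [hs.2.2.2.2.1 k hk]
  · by_cases hj : (j : ℕ) = m
    · exact Or.inr hj
    · refine Or.inl fun h0 => ?_
      have := hp (X (.inr (.inr (some j))) * X (.inr (.inr none)) - 1) fun s hs => by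
        simp [hs.2.2.2.2.2.resolve_right hj]
      simp [h0] at this

/-- The transcendence degree of a point is at most the number of its coordinates not in the base
field. -/
theorem natRk_range_le_card {κ ι : Type*} [Finite ι] [Field κ] [Algebra K κ] {x : ι → κ}
    {x₀ : ι → K} {free : Finset ι} (hx : ∀ i ∉ free, x i = algebraMap K κ (x₀ i)) :
    natRk (matroid K κ) (Set.range x) ≤ free.card := by
  classical
  have h : (matroid K κ).eRk (Set.range x) ≤ (matroid K κ).eRk (x '' free) := by
    rw [← Matroid.eRk_closure_eq (matroid K κ) (x '' free)]
    refine (matroid K κ).eRk_mono ?_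
    rintro _ ⟨i, rfl⟩
    rw [← mem_relClosure]
    by_cases hi : i ∈ free
    · exact subset_relClosure _ ⟨i, hi, rfl⟩
    · rw [hx i hi]
      exact algebraMap_mem _ _
  rw [← coe_natRk (Set.finite_range x)] at h
  have h2 := h.trans ((matroid K κ).eRk_le_encard _)
  have h3 : (x '' (free : Set ι)).encard ≤ free.card :=
    (Set.encard_image_le _ _).trans (Set.encard_coe_eq_coe_finsetCard _).le
  exact_mod_cast h2.trans h3

/-- Forms for which, at some point, the coordinate `w` of the direction takes infinitely many values
on `squareLineData` have a generic point to which `natRk_add_le_of_lineForm_eq_sq` applies; the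
point `x` contributes at most `free.card` to the transcendence degree. -/
theorem le_zariskiCodim_squareLineData [NeZero (2 : K)] {x₀ : Fin (m + 1 + 1) → K}
    {free : Finset (Fin (m + 1 + 1))} {a b : Fin (m + 1 + 1)} (hab : b ≠ a) (hxa : x₀ a = 1)
    (ha : a ∉ free) (j : Fin (m + 1)) (w : Fin (m + 1 + 1)) :
    ((m + 2 - free.card : ℕ) : ℕ∞) ≤ zariskiCodim {c : FormIndex (m + 1) (2 * m) → K |
      ∃ x : Fin (m + 1 + 1) → K, {z | ∃ s ∈ squareLineData x₀ free a b j,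
        s ∘ Sum.inl = Sum.elim c x ∧ s (.inr (.inl w)) = z}.Infinite} := by
  rcases Nat.eq_zero_or_pos (m + 2 - free.card) with h0 | h0
  · simp [h0]
  obtain ⟨k, hk⟩ : ∃ k, m + 2 - free.card = k + 1 := ⟨m + 2 - free.card - 1, by omega⟩
  rw [hk]
  by_contra hcon
  obtain ⟨κ, _, _, p, hp, hcard, hw⟩ := exists_generic_point
    (ι := FormIndex (m + 1) (2 * m)) (ι₁ := FormIndex (m + 1) (2 * m) ⊕ Fin (m + 1 + 1))
    (τ := SquareLineIndex m) Sum.inl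
    (S₁ := {s₁ | {z | ∃ s ∈ squareLineData x₀ free a b j,
        s ∘ Sum.inl = s₁ ∧ s (.inr (.inl w)) = z}.Infinite}) (k := k) (by
      convert hcon using 3
      ext c
      constructor
      · rintro ⟨s₁, h, rfl⟩
        refine ⟨s₁ ∘ Sum.inr, ?_⟩
        rwa [Sum.elim_comp_inl_inr]
      · rintro ⟨x, h⟩
        exact ⟨_, h, by simp⟩)
    (squareLineData x₀ free a b j) Sum.inl (.inr (.inl w)) (fun s hs => hs)
  obtain ⟨hfree, hva, hvb, hsq, hlow, hne⟩ := squareLineData_generic hp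
  have : NeZero (2 : κ) := ⟨by
    rw [← map_ofNat (algebraMap K κ) 2]
    exact (map_ne_zero _).2 (NeZero.ne 2)⟩
  set c : FormIndex (m + 1) (2 * m) → κ := fun n => p (.inl (.inl n)) with hc
  set x : Fin (m + 1 + 1) → κ := fun i => p (.inl (.inr i)) with hx
  have hrange : Set.range (p ∘ Sum.inl) = Set.range x ∪ Set.range c := by
    ext z
    simp only [Set.mem_range, Set.mem_union, Sum.exists, Function.comp_apply, hc, hx]
    exact or_comm
  have hlow' : ∀ k < (j : ℕ), (polyOfFin fun k => p (.inr (.inr (some k)))).coeff k = 0 := by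
    intro k hk
    have := coeff_polyOfFin (fun k => p (.inr (.inr (some k)))) (⟨k, hk.trans j.2⟩ : Fin (m + 1))
    rw [hlow ⟨k, hk.trans j.2⟩ hk] at this
    exact this
  have hne' : (polyOfFin fun k => p (.inr (.inr (some k)))).coeff j ≠ 0 ∨ (j : ℕ) = m := by
    rwa [coeff_polyOfFin]
  have key := natRk_add_le_of_lineForm_eq_sq (K := K) hab c (x := x) (by
      rw [hx]
      simp [hfree a ha, hxa]) hva hvb
    (natDegree_polyOfFin_le _) (Nat.lt_succ_iff.1 j.2) hlow' hne' hsq (by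
      intro h
      apply hw
      rw [hrange, ← mem_relClosure]
      exact h ⟨w, rfl⟩)
  have h1 := natRk_range_le_card (K := K) (x := x) hfree
  have h2 : Fintype.card (FormIndex (m + 1) (2 * m)) ≤ k + natRk (matroid K κ) (Set.range c) := by
    rw [← Nat.cast_le (α := ℕ∞), Nat.cast_add, coe_natRk (Set.finite_range c)]
    exact hcard
  have h3 := natRk_mono (N := matroid K κ)
    (Set.subset_union_right (s := Set.range x) (t := Set.range c))
    ((Set.finite_range x).union (Set.finite_range c))
  omega

/-- The forms that are squares on infinitely many lines through some point of the affine space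
`{x | x_i = x₀_i for i ∉ free}` have codimension at least `m + 2` minus the dimension of this
space. A set of directions is infinite only if one of the coordinates takes infinitely many values
on it, with square roots of one and the same order `j`. -/
theorem le_zariskiCodim_infinite_squareDirections [NeZero (2 : K)] {x₀ : Fin (m + 1 + 1) → K}
    {free : Finset (Fin (m + 1 + 1))} {a b : Fin (m + 1 + 1)} (hab : b ≠ a) (hxa : x₀ a = 1)
    (ha : a ∉ free) :
    ((m + 2 - free.card : ℕ) : ℕ∞) ≤ zariskiCodim {c : FormIndex (m + 1) (2 * m) → K |
      ∃ x : Fin (m + 1 + 1) → K, (∀ i ∉ free, x i = x₀ i) ∧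
        (squareDirections c x a b).Infinite} := by
  refine le_trans (le_zariskiCodim_iUnion fun jw : Fin (m + 1) × Fin (m + 1 + 1) =>
    le_zariskiCodim_squareLineData hab hxa ha jw.1 jw.2) (zariskiCodim_anti ?_)
  rintro c ⟨x, hx, hinf⟩
  by_contra hcon
  apply hinf
  simp only [Set.mem_iUnion, Set.mem_ofPred_eq, not_exists, Set.not_infinite] at hcon
  have hfin := Set.Finite.pi fun w : Fin (m + 1 + 1) =>
    Set.finite_iUnion fun j : Fin (m + 1) => hcon (j, w) x
  refine hfin.subset ?_
  rintro v ⟨hva, hvb, P, hP, hsq⟩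
  rw [Set.mem_univ_pi]
  intro w
  rw [Set.mem_iUnion]
  -- the order of vanishing of `P` at `0`, cut off at `m`
  obtain ⟨j, hjm, hlow, hne⟩ : ∃ j ≤ m, (∀ k < j, P.coeff k = 0) ∧ (P.coeff j ≠ 0 ∨ j = m) := by
    by_cases h : ∃ j, P.coeff j ≠ 0
    · classical
      refine ⟨Nat.find h, ?_, fun k hk => ?_, Or.inl (Nat.find_spec h)⟩
      · exact (Polynomial.le_natDegree_of_ne_zero (Nat.find_spec h)).trans hP
      · exact not_not.1 (Nat.find_min h hk)
    · push Not at h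
      exact ⟨m, le_rfl, fun k _ => h k, Or.inr rfl⟩
  refine ⟨⟨j, Nat.lt_succ_of_le hjm⟩, Sum.elim (Sum.elim c x) (Sum.elim v fun o =>
    o.elim (P.coeff j)⁻¹ fun k : Fin (m + 1) => P.coeff k),
    ⟨hx, hva, hvb, ?_, fun k hk => ?_, ?_⟩, ?_, rfl⟩
  · simp only [Sum.elim_inl, Sum.elim_inr, Option.elim_some]
    rw [polyOfFin_coeff hP]
    exact hsq
  · exact hlow k hk
  · exact hne.imp (fun h => mul_inv_cancel₀ h) id
  · simp

end FamiliesOfForms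

/-! ### Smoothness of generic forms -/

section SmoothForms

open AlgebraicIndependent MvPolynomial

theorem IsWeightedHomogeneous.eval_pow_mul {R σ : Type*} [CommRing R] {w : σ → ℕ} {n : ℕ}
    {f : MvPolynomial σ R} (hf : IsWeightedHomogeneous w f n) (t : R) (x : σ → R) :
    eval (fun i => t ^ w i * x i) f = t ^ n * eval x f := by
  rw [eval_eq, eval_eq, Finset.mul_sum]
  refine Finset.sum_congr rfl fun d hd => ?_
  rw [mem_support_iff] at hd
  rw [← hf hd, Finsupp.weight_apply, Finsupp.sum, ← Finset.prod_pow_eq_pow_sum, mul_left_comm,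
    ← Finset.prod_mul_distrib]
  congr 1
  refine Finset.prod_congr rfl fun i _ => ?_
  rw [mul_pow, ← pow_mul, smul_eq_mul, mul_comm (w i)]

theorem IsHomogeneous.eval_smul {R σ : Type*} [CommRing R] {n : ℕ}
    {f : MvPolynomial σ R} (hf : f.IsHomogeneous n) (t : R) (x : σ → R) :
    eval (t • x) f = t ^ n * eval x f := by
  rw [← IsWeightedHomogeneous.eval_pow_mul hf]
  congr 2
  ext i
  simp

variable {K : Type u} [Field K] {M D m : ℕ}

theorem formOf_isHomogeneous (c : FormIndex M D → K) : (formOf c).IsHomogeneous D :=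
  ringForm_isHomogeneous c

theorem eval_restrictToLine (f : MvPolynomial (Fin (M + 1)) K) (x v : Fin (M + 1) → K) (t : K) :
    (restrictToLine f x v).eval t = eval (x + t • v) f := by
  rw [restrictToLine, ← Polynomial.coe_evalRingHom, aeval_def, ← coe_eval₂Hom,
    ← RingHom.comp_apply]
  congr 1
  apply ringHom_ext
  · simp
  · intro i
    simp [mul_comm t]

theorem coeff_zero_restrictToLine (f : MvPolynomial (Fin (M + 1)) K) (x v : Fin (M + 1) → K) :
    (restrictToLine f x v).coeff 0 = eval x f := by
  rw [Polynomial.coeff_zero_eq_eval_zero, eval_restrictToLine]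
  simp

theorem coeff_one_restrictToLine (f : MvPolynomial (Fin (M + 1)) K) (x v : Fin (M + 1) → K) :
    (restrictToLine f x v).coeff 1 = ∑ i, v i * eval x (pderiv i f) := by
  induction f using MvPolynomial.induction_on with
  | C r => simp [restrictToLine]
  | add p q hp hq =>
    rw [restrictToLine] at *
    rw [map_add, Polynomial.coeff_add, hp, hq, ← Finset.sum_add_distrib]
    simp [mul_add]
  | mul_X p i hp =>
    have h : restrictToLine (p * X i) x v =
        restrictToLine p x v * (Polynomial.C (x i) + Polynomial.C (v i) * Polynomial.X) := by
      simp [restrictToLine]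
    rw [h, Polynomial.mul_coeff_one, hp, coeff_zero_restrictToLine]
    simp only [Derivation.leibniz, pderiv_X, smul_eq_mul, map_add, map_mul, eval_X, mul_add,
      Finset.sum_add_distrib, Polynomial.coeff_add, Polynomial.coeff_C_mul, Polynomial.coeff_X_one,
      Polynomial.coeff_X_zero, Polynomial.coeff_C_zero, mul_zero, add_zero, mul_one,
      Polynomial.coeff_C_succ, zero_add, Finset.sum_mul]
    congr 1
    · rw [Finset.sum_eq_single i]
      · simp [mul_comm]
      · intro j _ hj
        simp [Pi.single_eq_of_ne hj.symm]
      · simp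
    · exact Finset.sum_congr rfl fun j _ => by ring

/-- The monomial `x_a^(D-1) x_i`. -/
noncomputable def nearPower (hD : 0 < D) (a i : Fin (M + 1)) : FormIndex M D :=
  ⟨Finsupp.single a (D - 1) + Finsupp.single i 1, by
    rw [Finset.mem_finsuppAntidiag, Finsupp.coe_add]
    simp only [Pi.add_apply, Finset.sum_add_distrib, Finsupp.univ_sum_single_apply]
    exact ⟨Nat.sub_add_cancel hD, Finset.subset_univ _⟩⟩

theorem nearPower_injective (hD : 0 < D) (a : Fin (M + 1)) :
    Function.Injective (nearPower (M := M) hD a) := by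
  intro i j h
  have := congrArg Subtype.val h
  simp only [nearPower, add_right_inj] at this
  exact Finsupp.single_left_injective one_ne_zero this

theorem nearPower_self (hD : 0 < D) (a : Fin (M + 1)) : nearPower hD a a = purePower a := by
  apply Subtype.ext
  change Finsupp.single a (D - 1) + Finsupp.single a 1 = Finsupp.single a D
  rw [← Finsupp.single_add, Nat.sub_add_cancel hD]

variable {R : Type*} [CommRing R]

theorem coeff_zero_lineForm_single (hD : 0 < D) {v : Fin (M + 1) → R} {a : Fin (M + 1)}
    (hv : v a = 0) (c : FormIndex M D → R) :
    (lineForm c (Pi.single a 1) v).coeff 0 = c (nearPower hD a a) := by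
  rw [coeff_lineForm_single hv, nearPower_self,
    Finset.sum_eq_single ⟨purePower a, offDegree_eq_zero_iff.2 rfl⟩]
  · rw [offMonomial_purePower, mul_one]
  · rintro ⟨n, hn⟩ _ h
    exact absurd (Subtype.ext (offDegree_eq_zero_iff.1 hn)) h
  · simp

theorem coeff_one_lineForm_single (hD : 0 < D) {i a : Fin (M + 1)} (hi : i ≠ a)
    (c : FormIndex M D → R) :
    (lineForm c (Pi.single a 1) (Pi.single i 1)).coeff 1 = c (nearPower hD a i) := by
  have hoff : offDegree a (nearPower hD a i : FormIndex M D) = 1 := by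
    simp [offDegree, nearPower, hi]
    omega
  rw [coeff_lineForm_single (by simp [hi.symm]), Finset.sum_eq_single ⟨nearPower hD a i, hoff⟩]
  · have : offMonomial a (Pi.single i 1 : Fin (M + 1) → R)
        (nearPower hD a i : FormIndex M D) = 1 := by
      rw [offMonomial]
      refine Finset.prod_eq_one fun k hk => ?_
      by_cases hki : k = i
      · simp [hki]
      · have h1 := Finset.ne_of_mem_erase hk
        simp [nearPower, Ne.symm hki, h1.symm]
    rw [this, mul_one]
  · rintro ⟨n, hn⟩ _ hne
    have : offMonomial a (Pi.single i 1 : Fin (M + 1) → R) n = 0 := by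
      by_contra h0
      apply hne
      have hk : ∀ k, k ≠ a → k ≠ i → n.1 k = 0 := by
        intro k hka hki
        by_contra hnk
        apply h0
        rw [offMonomial]
        refine Finset.prod_eq_zero (Finset.mem_erase.2 ⟨hka, Finset.mem_univ k⟩) ?_
        rw [Pi.single_eq_of_ne hki, zero_pow hnk]
      have hs := n.sum_erase a
      rw [hn, Finset.sum_eq_single_of_mem i (Finset.mem_erase.2 ⟨hi, Finset.mem_univ i⟩)
        (fun k hk' hki => hk k (Finset.ne_of_mem_erase hk') hki)] at hs
      have hna : n.1 a = D - 1 := by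
        have := n.le a
        rw [offDegree] at hn
        omega
      refine Subtype.ext (Subtype.ext (Finsupp.ext fun k => ?_))
      by_cases hka : k = a
      · subst hka
        simp [nearPower, hi, hna]
      · by_cases hki : k = i
        · subst hki
          simp [nearPower, Ne.symm hka, hs]
        · simp [nearPower, Ne.symm hka, Ne.symm hki, hk k hka hki]
    rw [this, mul_zero]
  · simp

/-- The pairs of a form and a point, normalised by `x_a = 1`, at which the form and its derivatives
vanish. -/
def singularData (M D : ℕ) (K : Type*) [Field K] (a : Fin (M + 1)) :
    Set (FormIndex M D ⊕ Fin (M + 1) → K) :=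
  {s | s (.inr a) = 1 ∧ ∀ i, ∀ d < 2,
    (lineForm (fun n => s (.inl n)) (fun i => s (.inr i)) (Pi.single i 1)).coeff d = 0}

/-- The relations defining `singularData` pass to generic points. -/
theorem singularData_generic {a : Fin (M + 1)} {κ : Type u} [Field κ] [Algebra K κ]
    {p : FormIndex M D ⊕ Fin (M + 1) → κ}
    (hp : ∀ G : MvPolynomial (FormIndex M D ⊕ Fin (M + 1)) K,
      (∀ s ∈ singularData M D K a, aeval s G = 0) → aeval p G = 0) :
    p ∈ singularData M D κ a := by
  refine ⟨?_, fun i d hd => ?_⟩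
  · have := hp (X (.inr a) - 1) fun s hs => by simp [hs.1]
    simpa only [map_sub, aeval_X, map_one, sub_eq_zero] using this
  · have hQ : ∀ {B : Type u} [CommRing B] [Algebra K B] (s : FormIndex M D ⊕ Fin (M + 1) → B),
        aeval s ((lineForm (fun n => (X (.inl n) : MvPolynomial (FormIndex M D ⊕ Fin (M + 1)) K))
          (fun i => X (.inr i)) (Pi.single i 1)).coeff d) =
        (lineForm (fun n => s (.inl n)) (fun i => s (.inr i)) (Pi.single i 1)).coeff d := by
      intro B _ _ s
      have h1 : (fun k => aeval s ((Pi.single i 1 : Fin (M + 1) →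
          MvPolynomial (FormIndex M D ⊕ Fin (M + 1)) K) k)) =
            (Pi.single i 1 : Fin (M + 1) → B) := by
        ext k
        simp only [Pi.single_apply]
        split_ifs <;> simp
      have h2 := congrArg (Polynomial.coeff · d) (map_lineForm_algHom (aeval (R := K) s)
        (fun n => (X (.inl n) : MvPolynomial (FormIndex M D ⊕ Fin (M + 1)) K))
        (fun i => X (.inr i)) (Pi.single i 1))
      rw [h1] at h2
      simpa [Polynomial.coeff_map] using h2
    rw [← hQ]
    refine hp _ fun s hs => ?_
    rw [hQ]
    exact hs.2 i d hd

/-- Vanishing coefficients do not contribute to the transcendence degree. -/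
theorem natRk_add_card_le_of_vanishing {κ : Type*} [Field κ] [Algebra K κ] {ι : Type*}
    [Fintype ι] {X : Set κ} (hX : X.Finite) {c : ι → κ} {z : Finset ι} (hz : ∀ n ∈ z, c n = 0) :
    natRk (matroid K κ) (X ∪ Set.range c) + z.card ≤ natRk (matroid K κ) X + Fintype.card ι := by
  classical
  have h1 : natRk (matroid K κ) (X ∪ Set.range c) =
      natRk (matroid K κ) (X ∪ c '' ((zᶜ : Finset ι) : Set ι)) := by
    refine natRk_closure_eq_of_subset ?_
      (Set.union_subset_union_right _ (Set.image_subset_range _ _))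
    rintro w (hw | ⟨n, rfl⟩)
    · exact mem_relClosure.1 (subset_relClosure _ (Or.inl hw))
    · rw [← mem_relClosure]
      by_cases hn : n ∈ z
      · rw [hz n hn]
        exact zero_mem _
      · exact subset_relClosure _ (Or.inr ⟨n, by simpa using hn, rfl⟩)
  have h2 := natRk_union_le (N := matroid K κ) hX (Set.toFinite (c '' ((zᶜ : Finset ι) : Set ι)))
  have h3 : (c '' ((zᶜ : Finset ι) : Set ι)).ncard ≤ (zᶜ : Finset ι).card := by
    refine (Set.ncard_image_le (Finset.finite_toSet _)).trans (Set.ncard_coe_finset _).le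
  have h4 := Finset.card_add_card_compl z
  omega

/-- A singularity at a point is given by the vanishing of `M + 1` coefficients of the shifted form,
and the point has only `M` coordinates not equal to one. -/
theorem one_le_zariskiCodim_singularData [Infinite K] (hM : 0 < M) (hD : 0 < D) (a : Fin (M + 1)) :
    1 ≤ zariskiCodim {c : FormIndex M D → K | ∃ x, Sum.elim c x ∈ singularData M D K a} := by
  by_contra hcon
  -- the auxiliary coordinate `none` is free; only the generic form and point are of interest
  obtain ⟨κ, _, _, p, hp, hcard, -⟩ := exists_generic_point
    (ι := FormIndex M D) (ι₁ := FormIndex M D ⊕ Fin (M + 1))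
    (τ := Option (FormIndex M D ⊕ Fin (M + 1))) Sum.inl
    (S₁ := singularData M D K a) (k := 0) (by
      convert hcon using 3
      · simp
      ext c
      constructor
      · rintro ⟨s₁, h, rfl⟩
        refine ⟨s₁ ∘ Sum.inr, ?_⟩
        exact (Sum.elim_comp_inl_inr s₁).symm ▸ h
      · rintro ⟨x, h⟩
        exact ⟨_, h, by simp⟩)
    {s | s ∘ some ∈ singularData M D K a} some none (fun s hs => by
      refine (Set.infinite_univ (α := K)).mono fun z _ => ?_
      exact ⟨fun o => o.elim z s, hs, rfl, rfl⟩)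
  have hgen : p ∘ some ∈ singularData M D κ a := by
    refine singularData_generic (K := K) fun G hG => ?_
    have := hp (rename some G) fun s hs => by
      rw [aeval_rename]
      exact hG _ hs
    rwa [aeval_rename] at this
  obtain ⟨hxa, hsing⟩ := hgen
  set c : FormIndex M D → κ := fun n => p (some (.inl n)) with hc
  set x : Fin (M + 1) → κ := fun i => p (some (.inr i)) with hx
  have hcard' : Fintype.card (FormIndex M D) ≤ natRk (matroid K κ) (Set.range c) := by
    rw [← Nat.cast_le (α := ℕ∞), coe_natRk (Set.finite_range c)]
    rw [Nat.cast_zero, zero_add] at hcard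
    exact hcard
  have hy : ∀ i, (x - Pi.single a 1 : Fin (M + 1) → κ) i ∈ relClosure K (Set.range x) := by
    intro i
    refine sub_mem (subset_relClosure _ (Set.mem_range_self i)) ?_
    rw [Pi.single_apply]
    split_ifs
    · exact one_mem _
    · exact zero_mem _
  have hya : (x - Pi.single a 1 : Fin (M + 1) → κ) a = 0 := by
    rw [Pi.sub_apply, Pi.single_eq_same, sub_eq_zero]
    exact hxa
  have h1 := natRk_union_range_shiftForm (K := K) hya (c := c) hy
  have hline : ∀ v : Fin (M + 1) → κ, v a = 0 →
      lineForm (shiftForm (x - Pi.single a 1) a c) (Pi.single a 1) v = lineForm c x v := by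
    intro v hv
    rw [lineForm_shiftForm hv, add_sub_cancel]
  have hvan : ∀ i, shiftForm (x - Pi.single a 1) a c (nearPower hD a i) = 0 := by
    intro i
    by_cases hi : i = a
    · have : Nontrivial (Fin (M + 1)) := Fin.nontrivial_iff_two_le.2 (by omega)
      obtain ⟨b, hb⟩ := exists_ne a
      rw [hi, ← coeff_zero_lineForm_single (R := κ) hD (v := Pi.single b 1)
          (Pi.single_eq_of_ne hb.symm _) (shiftForm _ _ _),
        hline _ (Pi.single_eq_of_ne hb.symm _)]
      exact hsing b 0 two_pos
    · rw [← coeff_one_lineForm_single hD hi (shiftForm _ _ _),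
        hline _ (Pi.single_eq_of_ne (Ne.symm hi) _)]
      exact hsing i 1 one_lt_two
  have h2 := natRk_add_card_le_of_vanishing (K := K) (Set.finite_range x)
    (c := shiftForm (x - Pi.single a 1) a c) (z := Finset.univ.image (nearPower hD a)) (by
      intro n hn
      obtain ⟨i, -, rfl⟩ := Finset.mem_image.1 hn
      exact hvan i)
  rw [Finset.card_image_of_injective _ (nearPower_injective hD a), Finset.card_univ,
    Fintype.card_fin] at h2
  have h3 := natRk_range_le_card (K := K) (x := x) (x₀ := fun _ => 1) (free := Finset.univ.erase a)
    (by
      intro i hi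
      have : i = a := by simpa using hi
      rw [this, map_one]
      exact hxa)
  rw [Finset.card_erase_of_mem (Finset.mem_univ a), Finset.card_univ, Fintype.card_fin] at h3
  have h4 := natRk_mono (N := matroid K κ)
    (Set.subset_union_right (s := Set.range x) (t := Set.range c))
    ((Set.finite_range x).union (Set.finite_range c))
  omega

theorem isSmoothForm_of_forall_not_mem {c : FormIndex M D → K}
    (h : ∀ a, ¬ ∃ x, Sum.elim c x ∈ singularData M D K a) : IsSmoothForm (formOf c) := by
  intro x hx h0
  by_contra! hd
  obtain ⟨a, ha⟩ := Function.ne_iff.1 hx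
  refine h a ⟨(x a)⁻¹ • x, inv_mul_cancel₀ ha, fun i d hd' => ?_⟩
  change (restrictToLine (formOf c) ((x a)⁻¹ • x) (Pi.single i 1)).coeff d = 0
  interval_cases d
  · rw [coeff_zero_restrictToLine, IsHomogeneous.eval_smul (formOf_isHomogeneous c), h0, mul_zero]
  · rw [coeff_one_restrictToLine]
    refine Finset.sum_eq_zero fun k _ => ?_
    rw [IsHomogeneous.eval_smul (formOf_isHomogeneous c).pderiv, hd k, mul_zero, mul_zero]

end SmoothForms

/-! ### Lines on which a form is divisible by two -/

section DivisibleByTwo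

open MvPolynomial

variable {K : Type u} [Field K] {M m : ℕ}

/-- A polynomial over an algebraically closed field all of whose roots have even multiplicity is a
square. -/
theorem exists_sq_of_even_rootMultiplicity [IsAlgClosed K] {q : Polynomial K}
    (h : ∀ r, Even (q.rootMultiplicity r)) :
    ∃ P : Polynomial K, 2 * P.natDegree = q.natDegree ∧ q = P ^ 2 := by
  classical
  obtain ⟨s, hs⟩ := Multiset.exists_smul_of_dvd_count q.roots (k := 2) fun a _ => by
    rw [Polynomial.count_roots]
    exact (h a).two_dvd
  obtain ⟨l, hl⟩ := IsAlgClosed.exists_pow_nat_eq q.leadingCoeff two_pos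
  have hP : q = (Polynomial.C l * (s.map fun a => Polynomial.X - Polynomial.C a).prod) ^ 2 := by
    conv_lhs => rw [(IsAlgClosed.splits q).eq_prod_roots]
    rw [hs, Multiset.map_nsmul, Multiset.prod_nsmul, mul_pow, ← Polynomial.C_pow, hl]
  refine ⟨_, ?_, hP⟩
  conv_rhs => rw [hP]
  rw [Polynomial.natDegree_pow]

theorem natDegree_restrictToLine_le {f : MvPolynomial (Fin (M + 1)) K} {n : ℕ}
    (hf : f.IsHomogeneous n) (x v : Fin (M + 1) → K) : (restrictToLine f x v).natDegree ≤ n := by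
  have := aeval_natDegree_le f (m := n) hf.totalDegree_le
    (fun i => Polynomial.C (x i) + Polynomial.C (v i) * Polynomial.X) (n := 1) fun i => by
      compute_degree
  rwa [mul_one] at this

/-- On a line to which the restriction of the branch divisor is divisible by two, the form is the
square of a polynomial. -/
theorem DivisibleByTwoOn.exists_sq [IsAlgClosed K] {f : MvPolynomial (Fin (M + 1)) K}
    (hf : f.IsHomogeneous (2 * m)) {L : Submodule K (Fin (M + 1) → K)} (h : DivisibleByTwoOn f L)
    {x v : Fin (M + 1) → K} (hx : x ∈ L) (hv : v ∈ L) (hxv : LinearIndependent K ![x, v]) :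
    ∃ P : Polynomial K, P.natDegree ≤ m ∧ restrictToLine f x v = P ^ 2 := by
  have : Infinite K := IsAlgClosed.instInfinite
  by_cases hq : restrictToLine f x v = 0
  · exact ⟨0, by simp, by simp [hq]⟩
  rcases h with h | h
  · refine absurd (Polynomial.funext fun t => ?_) hq
    rw [eval_restrictToLine, h _ (L.add_mem hx (L.smul_mem t hv)), Polynomial.eval_zero]
  · obtain ⟨P, hdeg, hP⟩ := exists_sq_of_even_rootMultiplicity (q := restrictToLine f x v)
        fun r => by
      have hlin : LinearIndependent K ![x + r • v, v] := by
        rw [LinearIndependent.pair_iff] at hxv ⊢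
        intro s t hst
        have := hxv s (s * r + t) (by rw [← hst]; module)
        refine ⟨this.1, ?_⟩
        simpa [this.1] using this.2
      have := h (x + r • v) (L.add_mem hx (L.smul_mem r hv)) v hv hlin
      have hcomp : (restrictToLine f x v).comp (Polynomial.X + Polynomial.C r) =
          restrictToLine f (x + r • v) v := by
        refine Polynomial.funext fun t => ?_
        rw [Polynomial.eval_comp, eval_restrictToLine, eval_restrictToLine]
        simp only [Polynomial.eval_add, Polynomial.eval_X, Polynomial.eval_C]
        congr 2
        module
      rwa [Polynomial.rootMultiplicity_eq_rootMultiplicity, hcomp]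
    refine ⟨P, ?_, hP⟩
    have := natDegree_restrictToLine_le hf x v
    omega

theorem IsSquareOn.divisibleByTwoOn [Infinite K] {f : MvPolynomial (Fin (M + 1)) K}
    {L : Submodule K (Fin (M + 1) → K)} {k : ℕ} (h : IsSquareOn k f L) : DivisibleByTwoOn f L := by
  obtain ⟨g, -, hg⟩ := h
  refine Or.inr fun u hu v hv _ => ?_
  have hsq : restrictToLine f u v = restrictToLine g u v ^ 2 := by
    refine Polynomial.funext fun t => ?_
    rw [Polynomial.eval_pow, eval_restrictToLine, eval_restrictToLine,
      hg _ (L.add_mem hu (L.smul_mem t hv))]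
  rw [hsq]
  by_cases h0 : restrictToLine g u v = 0
  · simp [h0]
  · rw [pow_two, Polynomial.rootMultiplicity_mul (mul_ne_zero h0 h0)]
    exact ⟨_, rfl⟩

/-- A representative of a point of `ℙ^M` with one coordinate equal to one. -/
theorem exists_normalized_rep (x : ℙ K (Fin (M + 1) → K)) :
    ∃ (a : Fin (M + 1)) (y : Fin (M + 1) → K), y a = 1 ∧
      ∀ L : Submodule K (Fin (M + 1) → K), x.submodule ≤ L ↔ y ∈ L := by
  obtain ⟨a, ha⟩ := Function.ne_iff.1 x.rep_nonzero
  refine ⟨a, (x.rep a)⁻¹ • x.rep, inv_mul_cancel₀ ha, fun L => ?_⟩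
  rw [Projectivization.submodule_eq, Submodule.span_singleton_le_iff_mem,
    L.smul_mem_iff (inv_ne_zero ha)]

/-- A line through `x` is spanned by `x` and a normalised direction. -/
theorem exists_direction {x : Fin (M + 1) → K} {a : Fin (M + 1)} (hxa : x a = 1)
    {L : Submodule K (Fin (M + 1) → K)} (hL : Module.finrank K L = 2) (hx : x ∈ L) :
    ∃ b ≠ a, ∃ v ∈ L, v a = 0 ∧ v b = 1 ∧ LinearIndependent K ![x, v] ∧
      L = Submodule.span K {x, v} := by
  have hlt : ¬ L ≤ Submodule.span K {x} := by
    intro h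
    have h1 := Submodule.finrank_mono h
    have h2 := finrank_span_le_card (R := K) ({x} : Set (Fin (M + 1) → K))
    simp at h2
    omega
  obtain ⟨w, hw, hwx⟩ := SetLike.not_le_iff_exists.1 hlt
  have hne : w - w a • x ≠ 0 := by
    intro h
    apply hwx
    rw [sub_eq_zero.1 h]
    exact Submodule.smul_mem _ _ (Submodule.mem_span_singleton_self x)
  obtain ⟨b, hb⟩ := Function.ne_iff.1 hne
  have hva : (w - w a • x) a = 0 := by simp [hxa]
  have hba : b ≠ a := by
    rintro rfl
    exact hb hva
  have hvL : ((w - w a • x) b)⁻¹ • (w - w a • x) ∈ L :=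
    L.smul_mem _ (L.sub_mem hw (L.smul_mem _ hx))
  have hva' : (((w - w a • x) b)⁻¹ • (w - w a • x)) a = 0 := by
    rw [Pi.smul_apply, hva, smul_zero]
  have hvb' : (((w - w a • x) b)⁻¹ • (w - w a • x)) b = 1 := inv_mul_cancel₀ hb
  generalize ((w - w a • x) b)⁻¹ • (w - w a • x) = v at *
  have hlin : LinearIndependent K ![x, v] := by
    rw [LinearIndependent.pair_iff]
    intro s t hst
    have h1 := congrFun hst a
    simp [hxa, hva'] at h1
    have h2 := congrFun hst b
    simp [h1, hvb'] at h2
    exact ⟨h1, h2⟩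
  refine ⟨b, hba, v, hvL, hva', hvb', hlin, ?_⟩
  symm
  refine Submodule.eq_of_le_of_finrank_eq ?_ ?_
  · rw [Submodule.span_le]
    rintro z (rfl | rfl)
    · exact hx
    · exact hvL
  · rw [hL]
    have := finrank_span_eq_card hlin
    rw [Matrix.range_cons_cons_empty] at this
    simpa using this

/-- Every line through `x` has a direction `v` with `v_a = 0` and `v_b = 1` for one of the finitely
many `b`, so infinitely many lines give infinitely many directions for the same `b`. -/
theorem exists_infinite_squareDirections [IsAlgClosed K] {c : FormIndex (m + 1) (2 * m) → K}
    {x : Fin (m + 1 + 1) → K} {a : Fin (m + 1 + 1)} (hxa : x a = 1)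
    (h : {L : Submodule K (Fin (m + 1 + 1) → K) |
      (Module.finrank K L = 2 ∧ x ∈ L) ∧ DivisibleByTwoOn (formOf c) L}.Infinite) :
    ∃ b, b ≠ a ∧ (squareDirections c x a b).Infinite := by
  by_contra! hcon
  refine h ((Set.finite_iUnion fun b : {b // b ≠ a} =>
    (hcon b b.2).image fun v => Submodule.span K {x, v}).subset ?_)
  rintro L ⟨⟨hL, hx⟩, hdiv⟩
  obtain ⟨b, hb, v, hv, hva, hvb, hlin, hspan⟩ := exists_direction hxa hL hx
  exact Set.mem_iUnion.2 ⟨⟨b, hb⟩, v,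
    ⟨hva, hvb, hdiv.exists_sq (formOf_isHomogeneous c) hx hv hlin⟩, hspan.symm⟩

/-- The dimension count at a fixed point, that is, without free coordinates. -/
theorem le_zariskiCodim_badForms [IsAlgClosed K] [CharZero K] (x : ℙ K (Fin (m + 1 + 1) → K)) :
    ((m + 2 : ℕ) : ℕ∞) ≤ zariskiCodim (badForms x) := by
  have : Infinite K := IsAlgClosed.instInfinite
  obtain ⟨a, y, hya, hy⟩ := exists_normalized_rep x
  refine le_trans (le_zariskiCodim_iUnion fun b : {b // b ≠ a} =>
    le_zariskiCodim_infinite_squareDirections (m := m) b.2 hya (Finset.notMem_empty a))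
    (zariskiCodim_anti ?_)
  intro c hc
  obtain ⟨b, hb, hinf⟩ := exists_infinite_squareDirections (m := m) (c := c) hya
    (hc.mono fun L hL => ⟨⟨hL.1.1, (hy L).1 hL.1.2⟩, hL.2.divisibleByTwoOn⟩)
  exact Set.mem_iUnion.2 ⟨⟨b, hb⟩, y, fun _ _ => rfl, hinf⟩

/-- A generic form is smooth and has only finitely many lines through each point on which it is
divisible by two. -/
theorem exists_ne_zero_forall_isSmoothForm_and_finite [IsAlgClosed K] [CharZero K] (hm : 0 < m) :
    ∃ G : MvPolynomial (FormIndex (m + 1) (2 * m)) K, G ≠ 0 ∧ ∀ c, eval c G ≠ 0 →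
      IsSmoothForm (formOf c) ∧ ∀ x : ℙ K (Fin (m + 1 + 1) → K),
        {L | L ∈ linesThrough x ∧ DivisibleByTwoOn (formOf c) L}.Finite := by
  obtain ⟨G₁, hG₁, h₁⟩ := exists_ne_zero_of_one_le_zariskiCodim
    (le_zariskiCodim_iUnion (k := 1) fun a : Fin (m + 1 + 1) =>
      one_le_zariskiCodim_singularData (K := K) (M := m + 1) (D := 2 * m) (by omega) (by omega) a)
  obtain ⟨G₂, hG₂, h₂⟩ := exists_ne_zero_of_one_le_zariskiCodim
    (le_zariskiCodim_iUnion (k := 1)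
      fun ab : {ab : Fin (m + 1 + 1) × Fin (m + 1 + 1) // ab.2 ≠ ab.1} => by
      have := le_zariskiCodim_infinite_squareDirections (K := K) (m := m) ab.2
        (x₀ := Pi.single ab.1.1 1) (free := Finset.univ.erase ab.1.1) (Pi.single_eq_same _ _)
        (Finset.notMem_erase _ _)
      rwa [Finset.card_erase_of_mem (Finset.mem_univ _), Finset.card_univ, Fintype.card_fin,
        show m + 2 - (m + 1 + 1 - 1) = 1 by omega, Nat.cast_one] at this)
  refine ⟨G₁ * G₂, mul_ne_zero hG₁ hG₂, fun c hc => ?_⟩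
  rw [map_mul] at hc
  refine ⟨isSmoothForm_of_forall_not_mem fun a ha => left_ne_zero_of_mul hc ?_, fun x => ?_⟩
  · exact h₁ c (Set.mem_iUnion.2 ⟨a, ha⟩)
  · by_contra hinf
    obtain ⟨a, y, hya, hy⟩ := exists_normalized_rep x
    obtain ⟨b, hb, hinf'⟩ := exists_infinite_squareDirections (m := m) (c := c) hya
      ((show Set.Infinite _ from hinf).mono fun L hL => ⟨⟨hL.1.1, (hy L).1 hL.1.2⟩, hL.2⟩)
    refine right_ne_zero_of_mul hc
      (h₂ c (Set.mem_iUnion.2 ⟨⟨(a, b), hb⟩, y, fun i hi => ?_, hinf'⟩))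
    have : i = a := by simpa using hi
    rw [this, hya, Pi.single_eq_same]

end DivisibleByTwo

/-! ### Sections of the double space over lines -/

section LineCurves

open MvPolynomial

theorem IsWeightedHomogeneous.aeval_isWeightedHomogeneous {R σ τ : Type*} [CommRing R] {w : σ → ℕ}
    {w' : τ → ℕ} {n : ℕ} {f : MvPolynomial σ R} (hf : IsWeightedHomogeneous w f n)
    {g : σ → MvPolynomial τ R} (hg : ∀ i, IsWeightedHomogeneous w' (g i) (w i)) :
    IsWeightedHomogeneous w' (aeval g f) n := by
  rw [aeval_def, eval₂_eq]
  refine IsWeightedHomogeneous.sum _ _ _ fun d hd => ?_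
  refine IsWeightedHomogeneous.C_mul ?_ _
  rw [← hf (mem_support_iff.1 hd), Finsupp.weight_apply, Finsupp.sum]
  exact IsWeightedHomogeneous.prod _ _ _ fun i _ => (hg i).pow (d i)

variable {K : Type u} [Field K] {M m : ℕ}

theorem mem_idealOf {C : Set (WeightedProj K M)} {F : MvPolynomial (Option (Fin (M + 1))) K} :
    F ∈ idealOf C ↔ ∀ w ∈ coneOf C, eval w F = 0 := by
  rw [idealOf, mem_vanishingIdeal_iff]
  rfl

theorem WeightedProj.mk_eq_iff {v w : Option (Fin (M + 1)) → K} {hv : v ≠ 0} {hw : w ≠ 0} :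
    WeightedProj.mk v hv = WeightedProj.mk w hw ↔
      ∃ t : Kˣ, ∀ i, w i = (t : K) ^ coordWeight M i * v i :=
  ⟨fun h => Quotient.exact h, fun h => Quotient.sound (s := weightedSetoid K M) h⟩

theorem WeightedProj.exists_mk (p : WeightedProj K M) : ∃ w hw, WeightedProj.mk w hw = p := by
  induction p using Quotient.ind with
  | _ w => exact ⟨w.1, w.2, rfl⟩

theorem smul_mem_coneOf {C : Set (WeightedProj K M)} {w : Option (Fin (M + 1)) → K}
    (hw : w ∈ coneOf C) {t : K} (ht : t ≠ 0) :
    (fun i => t ^ coordWeight M i * w i) ∈ coneOf C := by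
  obtain ⟨hw0, hC⟩ := hw
  have hne : (fun i => t ^ coordWeight M i * w i) ≠ 0 := by
    obtain ⟨i, hi⟩ := Function.ne_iff.1 hw0
    exact fun h => mul_ne_zero (pow_ne_zero _ ht) hi (congrFun h i)
  refine ⟨hne, ?_⟩
  have h : WeightedProj.mk w hw0 = WeightedProj.mk _ hne :=
    WeightedProj.mk_eq_iff.2 ⟨Units.mk0 t ht, fun _ => rfl⟩
  rwa [← h]

/-- The equation of the double space holds for all coordinate vectors of its points. -/
theorem eval_of_mem_doubleSpace {f : MvPolynomial (Fin (m + 1 + 1)) K}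
    (hf : f.IsHomogeneous (2 * m)) {w : Option (Fin (m + 1 + 1)) → K} {hw : w ≠ 0}
    (h : WeightedProj.mk w hw ∈ doubleSpace f) : w none ^ 2 = eval (w ∘ some) f := by
  obtain ⟨v, hv, hvw, heq⟩ := h
  obtain ⟨t, ht⟩ := WeightedProj.mk_eq_iff.1 hvw
  have h1 : w ∘ some = (t : K) • fun i => v (some i) := by
    ext i
    simp [ht (some i), coordWeight]
  rw [h1, IsHomogeneous.eval_smul hf, ← heq, ht none, mul_pow, ← pow_mul, mul_comm 2 m]
  rfl

/-- The section `x_{M+1} = g` of the double space over a line `L` on which the branch form is the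
square of `g`. -/
def lineCurve (L : Submodule K (Fin (M + 1) → K)) (g : MvPolynomial (Fin (M + 1)) K) :
    Set (WeightedProj K M) :=
  {p | ∃ w hw, WeightedProj.mk w hw = p ∧ w ∘ some ∈ L ∧ w none = eval (w ∘ some) g}

/-- The point over `u` of the section `x_{M+1} = g`. -/
noncomputable def sectionPoint (g : MvPolynomial (Fin (M + 1)) K) (u : Fin (M + 1) → K) :
    Option (Fin (M + 1)) → K := fun o => o.elim (eval u g) u

theorem eval_zero_of_isHomogeneous {g : MvPolynomial (Fin (M + 1)) K} (hm : 0 < m)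
    (hg : g.IsHomogeneous m) : eval (0 : Fin (M + 1) → K) g = 0 := by
  have := IsHomogeneous.eval_smul hg 0 (0 : Fin (M + 1) → K)
  rwa [zero_smul, zero_pow hm.ne', zero_mul] at this

theorem mem_coneOf_lineCurve {L : Submodule K (Fin (m + 1 + 1) → K)}
    {g : MvPolynomial (Fin (m + 1 + 1)) K} (hg : g.IsHomogeneous m)
    {w : Option (Fin (m + 1 + 1)) → K} :
    w ∈ coneOf (lineCurve L g) ↔ w ≠ 0 ∧ w ∘ some ∈ L ∧ w none = eval (w ∘ some) g := by
  constructor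
  · rintro ⟨hw, v, hv, hvw, hL, hn⟩
    obtain ⟨t, ht⟩ := WeightedProj.mk_eq_iff.1 hvw
    have h1 : w ∘ some = (t : K) • (v ∘ some) := by
      ext i
      simp [ht (some i), coordWeight]
    refine ⟨hw, h1 ▸ L.smul_mem _ hL, ?_⟩
    rw [h1, IsHomogeneous.eval_smul hg, ← hn, ht none]
    rfl
  · rintro ⟨hw, hL, hn⟩
    exact ⟨hw, w, hw, rfl, hL, hn⟩

theorem sectionPoint_mem_coneOf {L : Submodule K (Fin (m + 1 + 1) → K)}
    {g : MvPolynomial (Fin (m + 1 + 1)) K} (hg : g.IsHomogeneous m) {u : Fin (m + 1 + 1) → K}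
    (hu : u ∈ L) (hu0 : u ≠ 0) : sectionPoint g u ∈ coneOf (lineCurve L g) :=
  (mem_coneOf_lineCurve hg).2
    ⟨fun h => hu0 (funext fun i => congrFun h (some i)), hu, rfl⟩

/-- A point of `lineCurve L g` is the point of the section over its projection. -/
theorem eq_sectionPoint_of_mem_coneOf (hm : 0 < m) {L : Submodule K (Fin (m + 1 + 1) → K)}
    {g : MvPolynomial (Fin (m + 1 + 1)) K} (hg : g.IsHomogeneous m)
    {w : Option (Fin (m + 1 + 1)) → K} (hw : w ∈ coneOf (lineCurve L g)) :
    w ∘ some ∈ L ∧ w ∘ some ≠ 0 ∧ w = sectionPoint g (w ∘ some) := by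
  obtain ⟨hw0, hL, hn⟩ := (mem_coneOf_lineCurve hg).1 hw
  have h : w = sectionPoint g (w ∘ some) := by
    ext o
    cases o with
    | none => exact hn
    | some i => rfl
  refine ⟨hL, fun h0 => hw0 ?_, h⟩
  rw [h, h0]
  ext o
  cases o with
  | none => exact eval_zero_of_isHomogeneous hm hg
  | some i => rfl

/-- The line is determined by its curve. -/
theorem lineCurve_le {L L' : Submodule K (Fin (m + 1 + 1) → K)}
    {g g' : MvPolynomial (Fin (m + 1 + 1)) K} (hg : g.IsHomogeneous m) (hg' : g'.IsHomogeneous m)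
    (h : lineCurve L g = lineCurve L' g') : L ≤ L' := by
  intro u hu
  by_cases hu0 : u = 0
  · rw [hu0]
    exact L'.zero_mem
  · have := sectionPoint_mem_coneOf hg hu hu0
    rw [h] at this
    exact ((mem_coneOf_lineCurve hg').1 this).2.1

/-- The point with parameters `y` on the line through `v` and `x`. -/
def linePoint {R : Type*} [CommRing R] (x v : Fin (M + 1) → R) (y : Fin 2 → R) : Fin (M + 1) → R :=
  fun i => x i * y 1 + v i * y 0

/-- The restriction of a form to the line through `v` and `x`, as a form in the parameters of
`linePoint`. -/
noncomputable def lineRestrict (x v : Fin (M + 1) → K) :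
    MvPolynomial (Fin (M + 1)) K →ₐ[K] MvPolynomial (Fin 2) K :=
  aeval fun i => C (x i) * X 1 + C (v i) * X 0

theorem eval_lineRestrict (x v : Fin (M + 1) → K) (f : MvPolynomial (Fin (M + 1)) K)
    (y : Fin 2 → K) : eval y (lineRestrict x v f) = eval (linePoint x v y) f := by
  rw [lineRestrict, aeval_def, ← coe_eval₂Hom, ← RingHom.comp_apply]
  congr 1
  apply ringHom_ext <;> intro <;> simp [linePoint, algebraMap_eq]

theorem isHomogeneous_lineCoord (x v : Fin (M + 1) → K) (i : Fin (M + 1)) :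
    (C (x i) * X 1 + C (v i) * X 0 : MvPolynomial (Fin 2) K).IsHomogeneous 1 :=
  (isHomogeneous_C_mul_X _ _).add (isHomogeneous_C_mul_X _ _)

theorem lineRestrict_isHomogeneous {f : MvPolynomial (Fin (M + 1)) K} {n : ℕ}
    (hf : f.IsHomogeneous n) (x v : Fin (M + 1) → K) : (lineRestrict x v f).IsHomogeneous n := by
  have := hf.aeval (fun i => C (x i) * X 1 + C (v i) * X 0 : Fin (M + 1) → MvPolynomial (Fin 2) K)
    (isHomogeneous_lineCoord x v)
  rwa [one_mul] at this

theorem lineRestrict_eq_homogenize {f : MvPolynomial (Fin (M + 1)) K} {n : ℕ}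
    (hf : f.IsHomogeneous n) (x v : Fin (M + 1) → K) :
    lineRestrict x v f = (restrictToLine f x v).homogenize n := by
  refine (Polynomial.homogenize_eq_of_isHomogeneous (lineRestrict_isHomogeneous hf x v) ?_).symm
  rw [lineRestrict, restrictToLine, ← AlgHom.restrictScalars_apply K (aeval _), ← AlgHom.comp_apply]
  congr 1
  ext i : 1
  simp [Polynomial.algebraMap_eq]

/-- The parameters, compare `linePoint`, of a point on the line through `x` and `v`, when
`x_a = 1`, `v_a = 0`, `v_b = 1`. -/
def lineParam (x : Fin (M + 1) → K) (a b : Fin (M + 1)) (u : Fin (M + 1) → K) : Fin 2 → K :=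
  ![u b - x b * u a, u a]

/-- The linear forms defining `lineParam`. -/
noncomputable def lineParamForm (x : Fin (M + 1) → K) (a b : Fin (M + 1)) :
    Fin 2 → MvPolynomial (Fin (M + 1)) K :=
  ![X b - C (x b) * X a, X a]

theorem eval_lineParamForm (x : Fin (M + 1) → K) (a b : Fin (M + 1)) (u : Fin (M + 1) → K)
    (k : Fin 2) : eval u (lineParamForm x a b k) = lineParam x a b u k := by
  fin_cases k <;> simp [lineParamForm, lineParam]

theorem isHomogeneous_lineParamForm (x : Fin (M + 1) → K) (a b : Fin (M + 1)) (k : Fin 2) :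
    (lineParamForm x a b k).IsHomogeneous 1 := by
  fin_cases k
  · exact (isHomogeneous_X _ _).sub (isHomogeneous_C_mul_X _ _)
  · exact isHomogeneous_X _ _

variable {x v : Fin (M + 1) → K} {a b : Fin (M + 1)}

theorem lineParam_linePoint (hxa : x a = 1) (hva : v a = 0) (hvb : v b = 1) (y : Fin 2 → K) :
    lineParam x a b (linePoint x v y) = y := by
  ext k
  fin_cases k <;> simp [lineParam, linePoint, hxa, hva, hvb]

theorem linePoint_mem (y : Fin 2 → K) : linePoint x v y ∈ Submodule.span K {x, v} :=
  Submodule.mem_span_pair.2 ⟨y 1, y 0, by ext i; simp [linePoint, mul_comm]⟩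

theorem linePoint_lineParam (hxa : x a = 1) (hva : v a = 0) (hvb : v b = 1)
    {u : Fin (M + 1) → K} (hu : u ∈ Submodule.span K {x, v}) :
    linePoint x v (lineParam x a b u) = u := by
  obtain ⟨s, t, rfl⟩ := Submodule.mem_span_pair.1 hu
  ext i
  simp [linePoint, lineParam, hxa, hva, hvb]
  ring

theorem linePoint_ne_zero (hxa : x a = 1) (hva : v a = 0) (hvb : v b = 1) {y : Fin 2 → K}
    (hy : y ≠ 0) : linePoint x v y ≠ 0 := by
  intro h
  apply hy
  rw [← lineParam_linePoint hxa hva hvb y, h]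
  ext k
  fin_cases k <;> simp [lineParam]

theorem exists_normalized_basis {L : Submodule K (Fin (M + 1) → K)} (hL : Module.finrank K L = 2) :
    ∃ (a b : Fin (M + 1)) (x v : Fin (M + 1) → K), x a = 1 ∧ v a = 0 ∧ v b = 1 ∧
      LinearIndependent K ![x, v] ∧ L = Submodule.span K {x, v} := by
  have hne : L ≠ ⊥ := by
    rintro rfl
    simp at hL
  obtain ⟨u, hu, hu0⟩ := L.exists_mem_ne_zero_of_ne_bot hne
  obtain ⟨a, ha⟩ := Function.ne_iff.1 hu0
  have hxa : ((u a)⁻¹ • u) a = 1 := inv_mul_cancel₀ ha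
  obtain ⟨b, -, v, -, hva, hvb, hlin, hspan⟩ := exists_direction hxa hL (L.smul_mem _ hu)
  exact ⟨a, b, _, v, hxa, hva, hvb, hlin, hspan⟩

theorem MvPolynomial.eq_zero_of_forall_ne_zero [Infinite K] {n : ℕ}
    {Q : MvPolynomial (Fin (n + 1)) K}
    (h : ∀ y : Fin (n + 1) → K, y ≠ 0 → eval y Q = 0) : Q = 0 := by
  have : X 0 * Q = 0 := by
    refine MvPolynomial.funext fun y => ?_
    by_cases hy : y = 0
    · simp [hy]
    · simp [h y hy]
  exact (mul_eq_zero.1 this).resolve_left (X_ne_zero 0)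

theorem eval_aeval_lineParamForm (x : Fin (M + 1) → K) (a b : Fin (M + 1))
    (Q : MvPolynomial (Fin 2) K) (u : Fin (M + 1) → K) :
    eval u (aeval (lineParamForm x a b) Q) = eval (lineParam x a b u) Q := by
  rw [aeval_def, ← coe_eval₂Hom, ← RingHom.comp_apply]
  congr 1
  apply ringHom_ext
  · simp [algebraMap_eq]
  · intro k
    simp [eval_lineParamForm]

theorem eval_eq_sq_of_restrictToLine_eq_sq (hxa : x a = 1) (hva : v a = 0) (hvb : v b = 1)
    {f : MvPolynomial (Fin (M + 1)) K} (hf : f.IsHomogeneous (2 * m)) {P : Polynomial K}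
    (hP : P.natDegree ≤ m) (hsq : restrictToLine f x v = P ^ 2) {u : Fin (M + 1) → K}
    (hu : u ∈ Submodule.span K {x, v}) :
    eval u f = eval u (aeval (lineParamForm x a b) (P.homogenize m)) ^ 2 := by
  rw [eval_aeval_lineParamForm, ← map_pow, pow_two (P.homogenize m),
    ← Polynomial.homogenize_mul _ _ hP hP, ← two_mul, ← pow_two, ← hsq,
    ← lineRestrict_eq_homogenize hf, eval_lineRestrict, linePoint_lineParam hxa hva hvb hu]

theorem isHomogeneous_aeval_lineParamForm (x : Fin (M + 1) → K) (a b : Fin (M + 1))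
    (P : Polynomial K) (n : ℕ) :
    (aeval (lineParamForm x a b) (P.homogenize n)).IsHomogeneous n := by
  have := (Polynomial.isHomogeneous_homogenize (n := n) P).aeval (lineParamForm x a b)
    (isHomogeneous_lineParamForm x a b)
  rwa [one_mul] at this

/-- A form divisible by two on a line is the square of a form there. -/
theorem DivisibleByTwoOn.isSquareOn [IsAlgClosed K] {f : MvPolynomial (Fin (M + 1)) K}
    (hf : f.IsHomogeneous (2 * m)) {L : Submodule K (Fin (M + 1) → K)}
    (hL : Module.finrank K L = 2) (h : DivisibleByTwoOn f L) : IsSquareOn m f L := by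
  obtain ⟨a, b, x, v, hxa, hva, hvb, hlin, rfl⟩ := exists_normalized_basis hL
  obtain ⟨P, hP, hsq⟩ := h.exists_sq hf (Submodule.subset_span (by simp))
    (Submodule.subset_span (by simp)) hlin
  exact ⟨_, isHomogeneous_aeval_lineParamForm x a b P m, fun u hu =>
    eval_eq_sq_of_restrictToLine_eq_sq hxa hva hvb hf hP hsq hu⟩

theorem finrank_map_le_of_forall {V V₁ V₂ : Type*} [AddCommGroup V] [Module K V] [AddCommGroup V₁]
    [Module K V₁] [AddCommGroup V₂] [Module K V₂] {W : Submodule K V} [FiniteDimensional K W]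
    {f : V →ₗ[K] V₁} {g : V →ₗ[K] V₂} (h : ∀ w ∈ W, g w = 0 → f w = 0) :
    Module.finrank K (W.map f) ≤ Module.finrank K (W.map g) := by
  have hf := LinearMap.finrank_range_add_finrank_ker (f.domRestrict W)
  have hg := LinearMap.finrank_range_add_finrank_ker (g.domRestrict W)
  have hle : LinearMap.ker (g.domRestrict W) ≤ LinearMap.ker (f.domRestrict W) := by
    intro w hw
    exact h w w.2 hw
  have := Submodule.finrank_mono hle
  rw [LinearMap.range_domRestrict] at hf hg
  omega

theorem finrank_degreeLT (n : ℕ) : Module.finrank K (Polynomial.degreeLT K n) = n := by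
  rw [(Polynomial.degreeLTEquiv K n).finrank_eq, Module.finrank_fin_fun]

instance finiteDimensional_degreeLT (n : ℕ) : FiniteDimensional K (Polynomial.degreeLT K n) :=
  Module.Finite.equiv (Polynomial.degreeLTEquiv K n).symm

theorem natDegree_le_of_mem_degreeLT {n : ℕ} {P : Polynomial K}
    (hP : P ∈ Polynomial.degreeLT K (n + 1)) : P.natDegree ≤ n := by
  rw [Polynomial.degreeLT_succ_eq_degreeLE, Polynomial.mem_degreeLE] at hP
  exact Polynomial.natDegree_le_of_degree_le hP

theorem natDegree_aeval_le_of_isHomogeneous {n : ℕ} {Q : MvPolynomial (Fin 2) K}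
    (hQ : Q.IsHomogeneous n) : (aeval ![Polynomial.X, 1] Q : Polynomial K).natDegree ≤ n := by
  have := aeval_natDegree_le Q (m := n) hQ.totalDegree_le
    (![Polynomial.X, 1] : Fin 2 → Polynomial K) (n := 1) fun i => by fin_cases i <;> simp
  rwa [mul_one] at this

theorem finrank_homogeneousSubmodule_two (n : ℕ) :
    Module.finrank K (homogeneousSubmodule (Fin 2) K n) = n + 1 := by
  have hmap : (Polynomial.degreeLT K (n + 1)).map (Polynomial.homogenizeLM n) =
      homogeneousSubmodule (Fin 2) K n := by
    ext Q
    constructor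
    · rintro ⟨P, -, rfl⟩
      exact Polynomial.isHomogeneous_homogenize P
    · intro hQ
      refine ⟨aeval ![Polynomial.X, 1] Q, ?_, Polynomial.homogenize_eq_of_isHomogeneous hQ rfl⟩
      rw [SetLike.mem_coe, Polynomial.degreeLT_succ_eq_degreeLE, Polynomial.mem_degreeLE]
      exact Polynomial.natDegree_le_iff_degree_le.1 (natDegree_aeval_le_of_isHomogeneous hQ)
  have h1 := LinearMap.finrank_range_add_finrank_ker
    ((Polynomial.homogenizeLM (R := K) n).domRestrict (Polynomial.degreeLT K (n + 1)))
  have hker : LinearMap.ker ((Polynomial.homogenizeLM (R := K) n).domRestrict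
      (Polynomial.degreeLT K (n + 1))) = ⊥ := by
    rw [LinearMap.ker_eq_bot']
    rintro ⟨P, hP⟩ h
    exact Subtype.ext (Polynomial.eq_zero_of_homogenize_eq_zero (natDegree_le_of_mem_degreeLT hP) h)
  rwa [hker, finrank_bot, add_zero, LinearMap.range_domRestrict, hmap, finrank_degreeLT] at h1

theorem finiteDimensional_weightedHomogeneousSubmodule (hm : 0 < m) (n : ℕ) :
    FiniteDimensional K (weightedHomogeneousSubmodule K (coordWeight (m + 1)) n) := by
  have := weightedHomogeneousSubmodule_fg (R := K) (coordWeight (m + 1)) (by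
    rintro (_ | i)
    · exact hm.ne'
    · exact one_ne_zero) n
  exact Module.Finite.iff_fg.2 this

/-- Restriction of polynomials to the section `x_{M+1} = g` over the line through `x` and `v`. -/
noncomputable def sectionRestrict (x v : Fin (M + 1) → K) (g : MvPolynomial (Fin (M + 1)) K) :
    MvPolynomial (Option (Fin (M + 1))) K →ₐ[K] MvPolynomial (Fin 2) K :=
  aeval fun o => o.elim (lineRestrict x v g) fun i => C (x i) * X 1 + C (v i) * X 0

theorem eval_sectionRestrict (x v : Fin (M + 1) → K) (g : MvPolynomial (Fin (M + 1)) K)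
    (F : MvPolynomial (Option (Fin (M + 1))) K) (y : Fin 2 → K) :
    eval y (sectionRestrict x v g F) = eval (sectionPoint g (linePoint x v y)) F := by
  rw [sectionRestrict, aeval_def, ← coe_eval₂Hom, ← RingHom.comp_apply]
  congr 1
  apply ringHom_ext
  · simp [algebraMap_eq]
  · rintro (_ | i)
    · simp [sectionPoint, eval_lineRestrict]
    · simp [sectionPoint, linePoint]

/-- The ideal of the curve is the kernel of `sectionRestrict`. In particular it is prime and the
coordinate ring is the ring of binary forms. -/
theorem mem_idealOf_lineCurve [Infinite K] (hm : 0 < m) {x v : Fin (m + 1 + 1) → K}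
    {a b : Fin (m + 1 + 1)} (hxa : x a = 1) (hva : v a = 0) (hvb : v b = 1)
    {g : MvPolynomial (Fin (m + 1 + 1)) K} (hg : g.IsHomogeneous m)
    {F : MvPolynomial (Option (Fin (m + 1 + 1))) K} :
    F ∈ idealOf (lineCurve (Submodule.span K {x, v}) g) ↔ sectionRestrict x v g F = 0 := by
  rw [mem_idealOf]
  constructor
  · intro h
    refine MvPolynomial.eq_zero_of_forall_ne_zero fun y hy => ?_
    rw [eval_sectionRestrict]
    exact h _ (sectionPoint_mem_coneOf hg (linePoint_mem y) (linePoint_ne_zero hxa hva hvb hy))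
  · intro h w hw
    obtain ⟨hL, -, heq⟩ := eq_sectionPoint_of_mem_coneOf hm hg hw
    rw [heq, ← linePoint_lineParam hxa hva hvb hL, ← eval_sectionRestrict, h, map_zero]

/-- The section over a line is a line on the double space. -/
theorem isCurveOfDegree_lineCurve [Infinite K] (hm : 0 < m) {f : MvPolynomial (Fin (m + 1 + 1)) K}
    {L : Submodule K (Fin (m + 1 + 1) → K)} (hL : Module.finrank K L = 2)
    {g : MvPolynomial (Fin (m + 1 + 1)) K} (hg : g.IsHomogeneous m)
    (hfg : ∀ u ∈ L, eval u f = eval u g ^ 2) : IsCurveOfDegree f 1 (lineCurve L g) := by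
  obtain ⟨a, b, x, v, hxa, hva, hvb, -, rfl⟩ := exists_normalized_basis hL
  have hmem := fun F => mem_idealOf_lineCurve hm hxa hva hvb hg (F := F)
  refine ⟨one_pos, ?_, ⟨?_, ?_⟩, 1, Filter.Eventually.of_forall fun n => ?_⟩
  · rintro _ ⟨w, hw, rfl, hwL, hwn⟩
    exact ⟨w, hw, rfl, by rw [hwn, ← hfg _ hwL]; rfl⟩
  · have : idealOf (lineCurve (Submodule.span K {x, v}) g) =
        RingHom.ker (sectionRestrict x v g) := by
      ext F
      rw [hmem, RingHom.mem_ker]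
    rw [this]
    exact RingHom.ker_isPrime _
  · intro w hw h
    have hL' : linePoint x v (lineParam x a b (w ∘ some)) = w ∘ some := by
      ext i
      have := h (X (some i) - (C (x i) * X (some a) +
        C (v i) * (X (some b) - C (x b) * X (some a)))) (by
          rw [hmem]
          simp [sectionRestrict, hxa, hva, hvb])
      simp only [map_sub, map_add, map_mul, eval_X, eval_C, sub_eq_zero] at this
      simp [linePoint, lineParam, this]
    have hn := h (X none - rename some g) (by
      rw [hmem, map_sub, sectionRestrict, aeval_rename, aeval_X]
      exact sub_self _)
    rw [map_sub, eval_X, eval_rename, sub_eq_zero] at hn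
    exact ⟨w, hw, rfl, hL' ▸ linePoint_mem _, hn⟩
  · have hfd := finiteDimensional_weightedHomogeneousSubmodule (K := K) hm n
    have himg : (weightedHomogeneousSubmodule K (coordWeight (m + 1)) n).map
        (sectionRestrict x v g).toLinearMap = homogeneousSubmodule (Fin 2) K n := by
      ext Q
      constructor
      · rintro ⟨F, hF, rfl⟩
        refine IsWeightedHomogeneous.aeval_isWeightedHomogeneous hF ?_
        rintro (_ | i)
        · exact lineRestrict_isHomogeneous hg x v
        · exact isHomogeneous_lineCoord x v i
      · intro hQ
        refine ⟨aeval (fun k => rename some (lineParamForm x a b k)) Q, ?_, ?_⟩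
        · refine IsWeightedHomogeneous.aeval_isWeightedHomogeneous (w := 1) hQ fun k => ?_
          rw [← aeval_X_left_apply (R := K) (rename some _), aeval_rename]
          exact IsWeightedHomogeneous.aeval_isWeightedHomogeneous (w := 1)
            (isHomogeneous_lineParamForm x a b k) fun i => isWeightedHomogeneous_X K _ _
        · rw [AlgHom.toLinearMap_apply, ← AlgHom.comp_apply]
          conv_rhs => rw [← aeval_X_left_apply (R := K) Q]
          congr 1
          ext k : 1
          rw [AlgHom.comp_apply, aeval_X, aeval_X, sectionRestrict, aeval_rename]
          fin_cases k <;> simp [lineParamForm, hxa, hva, hvb]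
    have h1 : hilbertFn (lineCurve (Submodule.span K {x, v}) g) n = n + 1 := by
      rw [← finrank_homogeneousSubmodule_two (K := K) n, ← himg]
      refine le_antisymm (finrank_map_le_of_forall fun F _ h => ?_)
        (finrank_map_le_of_forall fun F _ h => ?_)
      · exact Ideal.Quotient.eq_zero_iff_mem.2 ((hmem F).2 h)
      · exact (hmem F).1 (Ideal.Quotient.eq_zero_iff_mem.1 h)
    rw [h1]
    push_cast
    ring

end LineCurves

/-! ### Curves of degree one on the double space -/

section CurvesOfDegreeOne

open MvPolynomial

variable {K : Type u} [Field K] {m : ℕ}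

theorem exists_dual_pair {V : Type*} [AddCommGroup V] [Module K V] {p q : V}
    (h : LinearIndependent K ![p, q]) :
    ∃ φ ψ : V →ₗ[K] K, φ p = 1 ∧ φ q = 0 ∧ ψ p = 0 ∧ ψ q = 1 := by
  rw [linearIndependent_iff_injective_fintypeLinearCombination, ← LinearMap.ker_eq_bot] at h
  obtain ⟨g, hg⟩ := LinearMap.exists_leftInverse_of_injective _ h
  have hp := LinearMap.congr_fun hg (Pi.single 0 1)
  have hq := LinearMap.congr_fun hg (Pi.single 1 1)
  simp [Fintype.linearCombination_apply_single] at hp hq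
  refine ⟨LinearMap.proj 0 ∘ₗ g, LinearMap.proj 1 ∘ₗ g, ?_, ?_, ?_, ?_⟩ <;> simp [hp, hq]

/-- The linear form on `ℙ(1, …, 1, M-1)` with values `φ(x₀, …, x_M)`. -/
noncomputable def formOfFunctional {M : ℕ} (φ : (Fin (M + 1) → K) →ₗ[K] K) :
    MvPolynomial (Option (Fin (M + 1))) K :=
  ∑ i, C (φ (Pi.single i 1)) * X (some i)

theorem eval_formOfFunctional {M : ℕ} (φ : (Fin (M + 1) → K) →ₗ[K] K)
    (w : Option (Fin (M + 1)) → K) : eval w (formOfFunctional φ) = φ (w ∘ some) := by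
  rw [formOfFunctional, map_sum]
  rw [LinearMap.pi_apply_eq_sum_univ φ]
  refine Finset.sum_congr rfl fun i _ => ?_
  rw [map_mul, eval_C, eval_X, mul_comm, smul_eq_mul]
  congr 2
  ext j
  simp [Pi.single_apply, eq_comm]

theorem isWeightedHomogeneous_formOfFunctional {M : ℕ} (φ : (Fin (M + 1) → K) →ₗ[K] K) :
    IsWeightedHomogeneous (coordWeight M) (formOfFunctional φ) 1 :=
  IsWeightedHomogeneous.sum _ _ _ fun _ _ => (isWeightedHomogeneous_X K _ _).C_mul _

theorem finrank_prod_base_base {V : Type*} [AddCommGroup V] [Module K V] [FiniteDimensional K V] :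
    Module.finrank K (V × K × K) = Module.finrank K V + 2 := by
  rw [Module.finrank_prod, Module.finrank_prod, Module.finrank_self]

/-- Multiplication by a linear form which vanishes at two points with different projections, but
not on the whole curve, is injective on the coordinate ring and its image has codimension at least
two in each degree: the image vanishes at the two points, and powers of two linear forms separating
them are independent modulo it. -/
theorem hilbertFn_add_two_le (hm : 0 < m) {C : Set (WeightedProj K (m + 1))}
    (hI : (idealOf C).IsPrime) {p q w₀ : Option (Fin (m + 1 + 1)) → K} (hp : p ∈ coneOf C)
    (hq : q ∈ coneOf C) (hw₀ : w₀ ∈ coneOf C) (hpq : LinearIndependent K ![p ∘ some, q ∘ some])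
    {φ : (Fin (m + 1 + 1) → K) →ₗ[K] K} (hφp : φ (p ∘ some) = 0) (hφq : φ (q ∘ some) = 0)
    (hφ : φ (w₀ ∘ some) ≠ 0) (n : ℕ) : hilbertFn C n + 2 ≤ hilbertFn C (n + 1) := by
  obtain ⟨α, β, hαp, hαq, hβp, hβq⟩ := exists_dual_pair hpq
  have hfd := finiteDimensional_weightedHomogeneousSubmodule (K := K) hm
  set mk := Ideal.Quotient.mkₐ K (idealOf C) with hmk
  set R := fun n => Submodule.map mk.toLinearMap
    (weightedHomogeneousSubmodule K (coordWeight (m + 1)) n) with hR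
  have hmem : ∀ F, mk F = 0 ↔ F ∈ idealOf C := fun F => Ideal.Quotient.eq_zero_iff_mem
  let T : (R n × K × K) →ₗ[K] (MvPolynomial (Option (Fin (m + 1 + 1))) K ⧸ idealOf C) :=
    (LinearMap.mulLeft K (mk (formOfFunctional φ)) ∘ₗ (R n).subtype).coprod
      ((LinearMap.toSpanSingleton K _ (mk (formOfFunctional α ^ (n + 1)))).coprod
        (LinearMap.toSpanSingleton K _ (mk (formOfFunctional β ^ (n + 1)))))
  have hT : ∀ F hF s t, T (⟨mk F, hF⟩, s, t) = mk (formOfFunctional φ * F +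
      (s • formOfFunctional α ^ (n + 1) + t • formOfFunctional β ^ (n + 1))) := by
    intro F hF s t
    simp [T]
  have hinj : Function.Injective T := by
    rw [injective_iff_map_eq_zero]
    rintro ⟨⟨_, F, hF, rfl⟩, s, t⟩ h0
    have h1 := (hmem _).1 ((hT F ⟨F, hF, rfl⟩ s t).symm.trans h0)
    have hs : s = 0 := by
      have := mem_idealOf.1 h1 p hp
      simpa [eval_formOfFunctional, hφp, hαp, hβp] using this
    have ht : t = 0 := by
      have := mem_idealOf.1 h1 q hq
      simpa [eval_formOfFunctional, hφq, hαq, hβq] using this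
    subst hs ht
    rw [zero_smul, zero_smul, add_zero, add_zero] at h1
    have hF0 : F ∈ idealOf C := (hI.mem_or_mem h1).resolve_left fun h =>
      hφ (by rw [← eval_formOfFunctional]; exact mem_idealOf.1 h w₀ hw₀)
    exact Prod.ext (Subtype.ext ((hmem F).2 hF0)) rfl
  have hrange : LinearMap.range T ≤ R (n + 1) := by
    rintro _ ⟨⟨⟨_, F, hF, rfl⟩, s, t⟩, rfl⟩
    refine ⟨_, ?_, (hT F ⟨F, hF, rfl⟩ s t).symm⟩
    have hpow : ∀ γ : (Fin (m + 1 + 1) → K) →ₗ[K] K, IsWeightedHomogeneous (coordWeight (m + 1))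
        (formOfFunctional γ ^ (n + 1)) (n + 1) := fun γ => by
      have := (isWeightedHomogeneous_formOfFunctional γ).pow (n + 1)
      rwa [smul_eq_mul, mul_one] at this
    refine IsWeightedHomogeneous.add ?_ (IsWeightedHomogeneous.add ?_ ?_)
    · rw [add_comm n 1]
      exact (isWeightedHomogeneous_formOfFunctional φ).mul hF
    · rw [smul_eq_C_mul]
      exact (hpow α).C_mul s
    · rw [smul_eq_C_mul]
      exact (hpow β).C_mul t
  have h1 := Submodule.finrank_mono hrange
  rw [LinearMap.finrank_range_of_inj hinj, finrank_prod_base_base] at h1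
  exact h1

/-- Let a prime ideal contain neither `l₁` nor any `l₀ - r l₁`. A binary form is a product of linear
forms, so its value at `(l₀, l₁)` lies in the prime only if the form is zero. -/
theorem eq_zero_of_aeval_homogenize_mem [IsAlgClosed K] {A : Type*} [CommRing A] [Algebra K A]
    {I : Ideal A} (hI : I.IsPrime) {l : Fin 2 → A} (h1 : l 1 ∉ I)
    (h2 : ∀ r : K, l 0 - algebraMap K A r * l 1 ∉ I) {n : ℕ} {P : Polynomial K}
    (hP : P.natDegree ≤ n) (h : aeval l (P.homogenize n) ∈ I) : P = 0 := by
  obtain ⟨d, hd⟩ : ∃ d, P.natDegree = d := ⟨_, rfl⟩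
  induction d generalizing n P with
  | zero =>
    rw [Polynomial.natDegree_eq_zero] at hd
    obtain ⟨r, rfl⟩ := hd
    by_contra hr
    rw [Polynomial.homogenize_C, map_mul, map_pow, aeval_X, aeval_C] at h
    rcases hI.mem_or_mem h with h | h
    · have hu : IsUnit (algebraMap K A r) :=
        (IsUnit.mk0 r fun h0 => hr (by rw [h0, map_zero])).map (algebraMap K A)
      exact hI.ne_top (Ideal.eq_top_of_isUnit_mem _ h hu)
    · exact h1 (hI.mem_of_pow_mem _ h)
  | succ d ih =>
    obtain ⟨r, hr⟩ := IsAlgClosed.exists_root P (by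
      intro h0
      rw [Polynomial.natDegree_eq_zero_iff_degree_le_zero.2 h0.le] at hd
      omega)
    obtain ⟨Q, rfl⟩ := Polynomial.dvd_iff_isRoot.2 hr
    have hQ0 : Q ≠ 0 := by
      rintro rfl
      simp at hd
    rw [Polynomial.natDegree_mul (Polynomial.X_sub_C_ne_zero r) hQ0,
      Polynomial.natDegree_X_sub_C] at hd hP
    obtain ⟨k, rfl⟩ : ∃ k, n = 1 + k := ⟨n - 1, by omega⟩
    rw [Polynomial.homogenize_mul _ _ (Polynomial.natDegree_X_sub_C r).le (by omega), map_mul] at h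
    refine absurd (ih (by omega) ((hI.mem_or_mem h).resolve_left ?_) (by omega)) hQ0
    simpa using h2 r

/-- A polynomial vanishing along a line through the origin has components vanishing there. -/
theorem eval_homogeneousComponent_eq_zero [Infinite K] {σ : Type*} {Q : MvPolynomial σ K}
    {y : σ → K} (h : ∀ t : K, t ≠ 0 → eval (t • y) Q = 0) (d : ℕ) :
    eval y (homogeneousComponent d Q) = 0 := by
  let P : Polynomial K := ∑ d ∈ Finset.range (Q.totalDegree + 1),
    Polynomial.C (eval y (homogeneousComponent d Q)) * Polynomial.X ^ d
  have hP : P = 0 := by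
    refine Polynomial.eq_zero_of_infinite_isRoot P
      ((Set.finite_singleton (0 : K)).infinite_compl.mono fun t ht => ?_)
    have h1 := h t ht
    rw [← sum_homogeneousComponent Q, map_sum] at h1
    rw [Set.mem_ofPred_eq, Polynomial.IsRoot.def, Polynomial.eval_finsetSum, ← h1]
    refine Finset.sum_congr rfl fun d _ => ?_
    rw [IsHomogeneous.eval_smul (homogeneousComponent_isHomogeneous d Q), Polynomial.eval_mul,
      Polynomial.eval_C, Polynomial.eval_pow, Polynomial.eval_X, mul_comm]
  by_cases hd : d ∈ Finset.range (Q.totalDegree + 1)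
  · have := congrArg (Polynomial.coeff · d) hP
    simpa [P, Polynomial.finsetSum_coeff, Polynomial.coeff_C_mul, Polynomial.coeff_X_pow, hd]
      using this
  · rw [homogeneousComponent_eq_zero _ _ (by simpa using hd), map_zero]

/-- The double space does not contain the point `(0 : … : 0 : 1)`, so it projects to `ℙ^M`. -/
theorem comp_some_ne_zero (hm : 0 < m) {f : MvPolynomial (Fin (m + 1 + 1)) K}
    (hf : f.IsHomogeneous (2 * m)) {w : Option (Fin (m + 1 + 1)) → K} (hw : w ≠ 0)
    (h : w none ^ 2 = eval (w ∘ some) f) : w ∘ some ≠ 0 := by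
  intro h0
  apply hw
  rw [h0, eval_zero_of_isHomogeneous (by omega) hf] at h
  ext o
  cases o with
  | none => exact pow_eq_zero_iff two_ne_zero |>.1 h
  | some i => exact congrFun h0 i

/-- A curve on the double space is not contracted to a point of `ℙ^M`: over one point there are at
most two points of the double space, and the Hilbert function of two points is bounded. -/
theorem exists_linearIndependent_of_isCurveOfDegree (hm : 0 < m)
    {f : MvPolynomial (Fin (m + 1 + 1)) K} (hf : f.IsHomogeneous (2 * m))
    {C : Set (WeightedProj K (m + 1))} (hC : IsCurveOfDegree f 1 C) :
    ∃ p ∈ coneOf C, ∃ q ∈ coneOf C, LinearIndependent K ![p ∘ some, q ∘ some] := by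
  obtain ⟨-, hCV, ⟨hI, -⟩, b, hb⟩ := hC
  have hsq : ∀ w ∈ coneOf C, w none ^ 2 = eval (w ∘ some) f := fun w ⟨hw, hwC⟩ =>
    eval_of_mem_doubleSpace hf (hCV hwC)
  have hne : ∀ w ∈ coneOf C, w ∘ some ≠ 0 := fun w hw =>
    comp_some_ne_zero hm hf hw.1 (hsq w hw)
  obtain ⟨p, hp⟩ : (coneOf C).Nonempty := by
    rw [Set.nonempty_iff_ne_empty]
    intro h
    apply hI.ne_top
    rw [idealOf, h, vanishingIdeal_empty]
  by_contra! hcon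
  -- `p` and its conjugate `p'` are the only points over the projection of `p`
  let p' : Option (Fin (m + 1 + 1)) → K := fun o => o.elim (-p none) fun i => p (some i)
  have hcases : ∀ w ∈ coneOf C, ∃ s : K, (∀ i, w i = s ^ coordWeight (m + 1) i * p i) ∨
      ∀ i, w i = s ^ coordWeight (m + 1) i * p' i := by
    intro w hw
    have h1 := hcon p hp w hw
    rw [LinearIndependent.pair_iff' (hne p hp)] at h1
    push Not at h1
    obtain ⟨s, hs⟩ := h1
    have h2 : w none ^ 2 = (s ^ m * p none) ^ 2 := by
      rw [hsq w hw, ← hs, IsHomogeneous.eval_smul hf, ← hsq p hp]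
      ring
    refine ⟨s, (sq_eq_sq_iff_eq_or_eq_neg.1 h2).imp (fun h => ?_) fun h => ?_⟩
    · rintro (_ | i)
      · exact h
      · simpa [coordWeight] using (congrFun hs i).symm
    · rintro (_ | i)
      · rw [h, ← mul_neg]
        rfl
      · simpa [coordWeight, p'] using (congrFun hs i).symm
  have hle : ∀ n, hilbertFn C n ≤ 2 := by
    intro n
    have hfd := finiteDimensional_weightedHomogeneousSubmodule (K := K) hm n
    refine (finrank_map_le_of_forall
      (g := (aeval p).toLinearMap.prod (aeval p' : _ →ₐ[K] K).toLinearMap) fun F hF h => ?_).trans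
      ((Submodule.finrank_le _).trans ?_)
    · have hFp : eval p F = 0 := congrArg Prod.fst h
      have hFp' : eval p' F = 0 := congrArg Prod.snd h
      refine Ideal.Quotient.eq_zero_iff_mem.2 (mem_idealOf.2 fun w hw => ?_)
      obtain ⟨s, hs | hs⟩ := hcases w hw
      · rw [funext hs, IsWeightedHomogeneous.eval_pow_mul hF, hFp, mul_zero]
      · rw [funext hs, IsWeightedHomogeneous.eval_pow_mul hF, hFp', mul_zero]
    · rw [Module.finrank_prod, Module.finrank_self]
  obtain ⟨N, hN⟩ := Filter.eventually_atTop.1 hb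
  have h1 := hN (N + (3 - b).toNat) (Nat.le_add_right _ _)
  have h2 := hle (N + (3 - b).toNat)
  have h3 := Int.self_le_toNat (3 - b)
  push_cast at h1
  omega

/-- Every line on the double space is a section over a line on which the branch form is a
square. The Hilbert function of the curve grows by one, so by `hilbertFn_add_two_le` every linear
form vanishing at two points of the projection vanishes on the curve, that is, the projection lies
on a line `L`. The Hilbert function is also too small for `1` and `x_{M+1}` to be independent over
the forms on `L`. So `x_{M+1}` is on the curve a fraction of binary forms, with square `f|_L`, hence
a binary form. -/
theorem IsCurveOfDegree.exists_eq_lineCurve [IsAlgClosed K] (hm : 0 < m)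
    {f : MvPolynomial (Fin (m + 1 + 1)) K} (hf : f.IsHomogeneous (2 * m))
    {C : Set (WeightedProj K (m + 1))} (hC : IsCurveOfDegree f 1 C) :
    ∃ (L : Submodule K (Fin (m + 1 + 1) → K)) (g : MvPolynomial (Fin (m + 1 + 1)) K),
      Module.finrank K L = 2 ∧ g.IsHomogeneous m ∧ (∀ u ∈ L, eval u f = eval u g ^ 2) ∧
      C = lineCurve L g := by
  have : Infinite K := IsAlgClosed.instInfinite
  obtain ⟨p, hp, q, hq, hpq⟩ := exists_linearIndependent_of_isCurveOfDegree hm hf hC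
  obtain ⟨-, hCV, ⟨hI, hclosed⟩, b', hb'⟩ := hC
  obtain ⟨N, hN⟩ := Filter.eventually_atTop.1 hb'
  have hsq : ∀ w ∈ coneOf C, w none ^ 2 = eval (w ∘ some) f := fun w ⟨hw, hwC⟩ =>
    eval_of_mem_doubleSpace hf (hCV hwC)
  have hlin : ∀ φ : (Fin (m + 1 + 1) → K) →ₗ[K] K, φ (p ∘ some) = 0 → φ (q ∘ some) = 0 →
      ∀ w ∈ coneOf C, φ (w ∘ some) = 0 := by
    intro φ hφp hφq w hw
    by_contra hφ
    have h1 := hilbertFn_add_two_le hm hI hp hq hw hpq hφp hφq hφ N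
    have h2 := hN N le_rfl
    have h3 := hN (N + 1) (Nat.le_succ N)
    push_cast at h2 h3
    omega
  have hL2 : Module.finrank K (Submodule.span K {p ∘ some, q ∘ some}) = 2 := by
    have := finrank_span_eq_card hpq
    rw [Matrix.range_cons_cons_empty] at this
    simpa using this
  obtain ⟨a, b, x, v, hxa, hva, hvb, -, hspan⟩ := exists_normalized_basis hL2
  have hpL : p ∘ some ∈ Submodule.span K {x, v} := hspan ▸ Submodule.subset_span (by simp)
  have hqL : q ∘ some ∈ Submodule.span K {x, v} := hspan ▸ Submodule.subset_span (by simp)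
  have hvanish : ∀ φ : (Fin (m + 1 + 1) → K) →ₗ[K] K, (∀ w ∈ coneOf C, φ (w ∘ some) = 0) →
      ∀ u ∈ Submodule.span K {x, v}, φ u = 0 := by
    intro φ hφ u hu
    rw [← hspan] at hu
    have : Submodule.span K {p ∘ some, q ∘ some} ≤ LinearMap.ker φ := by
      rw [Submodule.span_le]
      rintro _ (rfl | rfl)
      · exact hφ p hp
      · exact hφ q hq
    exact this hu
  have hline : ∀ w ∈ coneOf C, linePoint x v (lineParam x a b (w ∘ some)) = w ∘ some := by
    intro w hw
    ext i
    let φ : (Fin (m + 1 + 1) → K) →ₗ[K] K := LinearMap.proj i -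
      (x i • LinearMap.proj a + v i • (LinearMap.proj b - x b • LinearMap.proj a))
    have hφ : ∀ u, φ u = u i - linePoint x v (lineParam x a b u) i := by
      intro u
      simp [φ, linePoint, lineParam]
    have := hlin φ (by rw [hφ, linePoint_lineParam hxa hva hvb hpL, sub_self])
      (by rw [hφ, linePoint_lineParam hxa hva hvb hqL, sub_self]) w hw
    rw [hφ, sub_eq_zero] at this
    exact this.symm
  have hL : ∀ w ∈ coneOf C, w ∘ some ∈ Submodule.span K {x, v} := fun w hw =>
    hline w hw ▸ linePoint_mem _
  set l : Fin 2 → MvPolynomial (Option (Fin (m + 1 + 1))) K :=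
    fun k => rename some (lineParamForm x a b k) with hl
  have heval : ∀ (w : Option (Fin (m + 1 + 1)) → K) Q,
      eval w (aeval l Q) = eval (lineParam x a b (w ∘ some)) Q := by
    intro w Q
    rw [aeval_def, ← coe_eval₂Hom, ← RingHom.comp_apply]
    congr 1
    apply ringHom_ext
    · simp [algebraMap_eq]
    · intro k
      simp [hl, eval_rename, eval_lineParamForm]
  have hl1 : l 1 ∉ idealOf C := by
    intro h
    have := hvanish (LinearMap.proj a) (fun w hw => by
      simpa [hl, lineParamForm] using mem_idealOf.1 h w hw) x (Submodule.subset_span (by simp))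
    simp [hxa] at this
  have hl0 : ∀ r : K, l 0 - algebraMap K _ r * l 1 ∉ idealOf C := by
    intro r h
    have := hvanish (LinearMap.proj b - x b • LinearMap.proj a - r • LinearMap.proj a)
      (fun w hw => by
        simpa [hl, lineParamForm, algebraMap_eq] using mem_idealOf.1 h w hw) v
      (Submodule.subset_span (by simp))
    simp [hva, hvb] at this
  have hzero : ∀ {n : ℕ} {P : Polynomial K}, P.natDegree ≤ n →
      aeval l (P.homogenize n) ∈ idealOf C → P = 0 := fun hP h =>
    eq_zero_of_aeval_homogenize_mem hI hl1 hl0 hP h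
  -- the coordinate ring is generated by the two parameters and `x_{M+1}`, and its dimension in
  -- degree `n` is too small for `x_{M+1}` not to be a rational function of the parameters
  obtain ⟨k, P₁, P₂, hP₁, hP₂, hne, hrel⟩ : ∃ (k : ℕ) (P₁ P₂ : Polynomial K),
      P₁.natDegree ≤ k + m ∧ P₂.natDegree ≤ k ∧ ¬ (P₁ = 0 ∧ P₂ = 0) ∧
      aeval l (P₁.homogenize (k + m)) + X none * aeval l (P₂.homogenize k) ∈ idealOf C := by
    let k := N + b'.toNat
    have hfd := finiteDimensional_weightedHomogeneousSubmodule (K := K) hm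
    set mk := Ideal.Quotient.mkₐ K (idealOf C) with hmk
    let T : (Polynomial.degreeLT K (k + m + 1) × Polynomial.degreeLT K (k + 1)) →ₗ[K]
        (MvPolynomial (Option (Fin (m + 1 + 1))) K ⧸ idealOf C) :=
      mk.toLinearMap ∘ₗ (((aeval l).toLinearMap ∘ₗ Polynomial.homogenizeLM (k + m) ∘ₗ
        (Polynomial.degreeLT K (k + m + 1)).subtype).coprod
        (LinearMap.mulLeft K (X none) ∘ₗ (aeval l).toLinearMap ∘ₗ Polynomial.homogenizeLM k ∘ₗ
        (Polynomial.degreeLT K (k + 1)).subtype))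
    have hT : ∀ P, T P = mk (aeval l (P.1.1.homogenize (k + m)) +
        X none * aeval l (P.2.1.homogenize k)) := fun P => rfl
    by_cases hinj : Function.Injective T
    · exfalso
      have hlw : ∀ (Q : Polynomial K) (d : ℕ),
          IsWeightedHomogeneous (coordWeight (m + 1)) (aeval l (Q.homogenize d)) d := by
        intro Q d
        refine IsWeightedHomogeneous.aeval_isWeightedHomogeneous (w := 1)
          (Polynomial.isHomogeneous_homogenize Q) fun j => ?_
        change IsWeightedHomogeneous _ (rename some (lineParamForm x a b j)) 1
        rw [← aeval_X_left_apply (R := K) (rename some _), aeval_rename]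
        exact IsWeightedHomogeneous.aeval_isWeightedHomogeneous (w := 1)
          (isHomogeneous_lineParamForm x a b j) fun i => isWeightedHomogeneous_X K _ _
      have hrange : LinearMap.range T ≤ Submodule.map mk.toLinearMap
          (weightedHomogeneousSubmodule K (coordWeight (m + 1)) (k + m)) := by
        rintro _ ⟨P, rfl⟩
        refine ⟨_, IsWeightedHomogeneous.add (hlw _ _) ?_, (hT P).symm⟩
        have h : IsWeightedHomogeneous (coordWeight (m + 1))
            (X none * aeval l (P.2.1.homogenize k)) (m + k) :=
          (isWeightedHomogeneous_X K (coordWeight (m + 1)) none).mul (hlw _ _)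
        rwa [add_comm m k] at h
      have h1 := Submodule.finrank_mono hrange
      rw [LinearMap.finrank_range_of_inj hinj, Module.finrank_prod, finrank_degreeLT,
        finrank_degreeLT] at h1
      have h2 : (Module.finrank K (Submodule.map mk.toLinearMap
          (weightedHomogeneousSubmodule K (coordWeight (m + 1)) (k + m))) : ℤ) = _ :=
        hN (k + m) (by omega)
      have h3 := Int.self_le_toNat b'
      push_cast at h2
      omega
    · rw [injective_iff_map_eq_zero] at hinj
      push Not at hinj
      obtain ⟨P, hP0, hPne⟩ := hinj
      refine ⟨k, P.1.1, P.2.1, natDegree_le_of_mem_degreeLT P.1.2,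
        natDegree_le_of_mem_degreeLT P.2.2, fun h => hPne ?_, ?_⟩
      · exact Prod.ext (Subtype.ext h.1) (Subtype.ext h.2)
      · exact Ideal.Quotient.eq_zero_iff_mem.1 ((hT P).symm.trans hP0)
  have hP₂0 : P₂ ≠ 0 := by
    rintro rfl
    rw [Polynomial.homogenize_zero, map_zero, mul_zero, add_zero] at hrel
    exact hne ⟨hzero hP₁ hrel, rfl⟩
  set r := restrictToLine f x v with hr
  have hrdeg : r.natDegree ≤ 2 * m := natDegree_restrictToLine_le hf x v
  have hfr : X none ^ 2 - aeval l (r.homogenize (2 * m)) ∈ idealOf C := by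
    refine mem_idealOf.2 fun w hw => ?_
    rw [map_sub, map_pow, eval_X, heval, hr, ← lineRestrict_eq_homogenize hf, eval_lineRestrict,
      hline w hw, hsq w hw, sub_self]
  -- the relation `P₁ + x_{M+1} P₂ = 0` on the curve, multiplied by `P₁ - x_{M+1} P₂`
  have hsquare : P₁ * P₁ = P₂ * P₂ * r := by
    have hdeg : (k + m) + (k + m) = (k + k) + 2 * m := by ring
    have hd1 : (P₁ * P₁).natDegree ≤ (k + m) + (k + m) :=
      Polynomial.natDegree_mul_le_of_le hP₁ hP₁
    have hd2' : (P₂ * P₂).natDegree ≤ k + k := Polynomial.natDegree_mul_le_of_le hP₂ hP₂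
    have hd2 : (P₂ * P₂ * r).natDegree ≤ (k + m) + (k + m) := by
      rw [hdeg]
      exact Polynomial.natDegree_mul_le_of_le hd2' hrdeg
    rw [← sub_eq_zero]
    refine hzero ((Polynomial.natDegree_sub_le_of_le hd1 hd2).trans (max_self _).le) ?_
    rw [Polynomial.homogenize_sub, Polynomial.homogenize_mul _ _ hP₁ hP₁, hdeg,
      Polynomial.homogenize_mul _ _ hd2' hrdeg, Polynomial.homogenize_mul _ _ hP₂ hP₂, map_sub,
      map_mul, map_mul, map_mul]
    have h1 := Ideal.mul_mem_right (aeval l (P₁.homogenize (k + m)) -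
      X none * aeval l (P₂.homogenize k)) _ hrel
    have h2 := Ideal.mul_mem_left _ (aeval l (P₂.homogenize k) * aeval l (P₂.homogenize k)) hfr
    convert Ideal.add_mem _ h1 h2 using 1
    ring
  obtain ⟨P, rfl⟩ : P₂ ∣ P₁ := by
    rw [← IsIntegrallyClosed.pow_dvd_pow_iff two_ne_zero, pow_two, pow_two, hsquare]
    exact dvd_mul_right _ _
  have hrP : r = P ^ 2 := by
    have h0 : P₂ * P₂ * r = P₂ * P₂ * P ^ 2 := by
      rw [← hsquare]
      ring
    exact mul_left_cancel₀ (mul_ne_zero hP₂0 hP₂0) h0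
  have hPdeg : P.natDegree ≤ m := by
    rw [hrP, Polynomial.natDegree_pow] at hrdeg
    omega
  have hG : X none + aeval l (P.homogenize m) ∈ idealOf C := by
    rw [Polynomial.homogenize_mul _ _ hP₂ hPdeg, map_mul] at hrel
    have h1 : aeval l (P₂.homogenize k) * (X none + aeval l (P.homogenize m)) ∈ idealOf C := by
      convert hrel using 1
      ring
    exact (hI.mem_or_mem h1).resolve_left fun h => hP₂0 (hzero hP₂ h)
  set g : MvPolynomial (Fin (m + 1 + 1)) K := -aeval (lineParamForm x a b) (P.homogenize m) with hg
  have hgm : g.IsHomogeneous m := (isHomogeneous_aeval_lineParamForm x a b P m).neg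
  have hwn : ∀ w ∈ coneOf C, w none = eval (w ∘ some) g := by
    intro w hw
    have := mem_idealOf.1 hG w hw
    rw [map_add, eval_X, heval] at this
    rw [hg, map_neg, eval_aeval_lineParamForm]
    exact eq_neg_of_add_eq_zero_left this
  refine ⟨Submodule.span K {x, v}, g, hspan ▸ hL2, hgm, fun u hu => ?_, Set.Subset.antisymm ?_ ?_⟩
  · rw [hg, map_neg, neg_sq]
    exact eval_eq_sq_of_restrictToLine_eq_sq hxa hva hvb hf hPdeg hrP hu
  · intro c hc
    obtain ⟨w, hw, rfl⟩ := c.exists_mk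
    exact ⟨w, hw, rfl, hL w ⟨hw, hc⟩, hwn w ⟨hw, hc⟩⟩
  · rintro _ ⟨w, hw, rfl, hwL, hwg⟩
    refine hclosed w hw fun F hF => ?_
    have hpoint : ∀ {w : Option (Fin (m + 1 + 1)) → K}, w ∘ some ∈ Submodule.span K {x, v} →
        w none = eval (w ∘ some) g →
        eval (lineParam x a b (w ∘ some)) (sectionRestrict x v g F) = eval w F := by
      intro w hwL hwg
      rw [eval_sectionRestrict, linePoint_lineParam hxa hva hvb hwL]
      congr 2
      ext o
      cases o with
      | none => exact hwg.symm
      | some i => rfl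
    -- the restriction of `F` to the section vanishes on the curve, component by component, and no
    -- binary form other than zero does so
    have hQ : sectionRestrict x v g F = 0 := by
      rw [← sum_homogeneousComponent (sectionRestrict x v g F)]
      refine Finset.sum_eq_zero fun d _ => ?_
      have hd := homogeneousComponent_isHomogeneous d (sectionRestrict x v g F)
      rw [← Polynomial.homogenize_eq_of_isHomogeneous hd rfl,
        hzero (natDegree_aeval_le_of_isHomogeneous hd) ?_, Polynomial.homogenize_zero]
      rw [Polynomial.homogenize_eq_of_isHomogeneous hd rfl]
      refine mem_idealOf.2 fun w' hw' => ?_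
      rw [heval]
      refine eval_homogeneousComponent_eq_zero (fun t ht => ?_) d
      have hw'' := smul_mem_coneOf hw' ht
      have h1 := hpoint (hL _ hw'') (hwn _ hw'')
      rw [mem_idealOf.1 hF _ hw''] at h1
      rw [← h1]
      congr 2
      ext j
      fin_cases j <;> simp [lineParam, coordWeight]
      ring
    rw [← hpoint hwL hwg, hQ, map_zero]

end CurvesOfDegreeOne

/-! ### Lines through a point -/

section LinesThroughPoints

open AlgebraicIndependent MvPolynomial

variable {K : Type u} [Field K] {m : ℕ}

/-- Fewer equations than unknowns with the solution `0` have another solution: the ideal of the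
origin has height equal to the number of unknowns. -/
theorem exists_ne_zero_forall_eval_eq_zero [IsAlgClosed K] {σ : Type} [Fintype σ] {r : ℕ}
    (hr : r < Fintype.card σ) (E : Fin r → MvPolynomial σ K) (hE : ∀ k, eval 0 (E k) = 0) :
    ∃ y : σ → K, y ≠ 0 ∧ ∀ k, eval y (E k) = 0 := by
  by_contra! hcon
  set I := Ideal.span (Set.range E) with hI
  set P := RingHom.ker (aeval (R := K) (0 : σ → K)) with hP
  have hPprime : P.IsPrime := RingHom.ker_isPrime _
  have hIP : I ≤ P := by
    rw [hI, Ideal.span_le]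
    rintro _ ⟨k, rfl⟩
    exact hE k
  have hrad : I.radical = P := by
    rw [← vanishingIdeal_zeroLocus_eq_radical (K := K) I]
    ext F
    rw [mem_vanishingIdeal_iff]
    constructor
    · intro h
      exact h 0 fun G hG => hIP hG
    · intro h y hy
      have hy0 : y = 0 := by
        by_contra hy0
        obtain ⟨k, hk⟩ := hcon y hy0
        exact hk (hy _ (Ideal.subset_span ⟨k, rfl⟩))
      rw [hy0]
      exact h
  have hmin : P ∈ I.minimalPrimes := by
    refine ⟨⟨hPprime, hIP⟩, fun Q hQ _ => ?_⟩
    rw [← hrad]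
    exact hQ.1.radical_le_iff.2 hQ.2
  have h1 : P.height ≤ r := by
    classical
    have hI' : I = Ideal.span (Finset.univ.image E : Finset (MvPolynomial σ K)) := by
      rw [Finset.coe_image, Finset.coe_univ, Set.image_univ]
    rw [hI'] at hmin
    refine (Ideal.height_le_card_of_mem_minimalPrimes_span_finset hmin).trans ?_
    exact_mod_cast Finset.card_image_le.trans (Finset.card_fin r).le
  have h2 := card_le_height_ker_add_eRk (K := K) (0 : σ → K)
  have h3 : (matroid K K).eRk (Set.range (0 : σ → K)) = 0 := by
    rw [← le_zero_iff, ← (matroid K K).eRk_empty, ← (matroid K K).eRk_closure_eq ∅]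
    refine (matroid K K).eRk_mono ?_
    rintro _ ⟨i, rfl⟩
    exact mem_relClosure.1 (zero_mem _)
  rw [h3, add_zero] at h2
  have h4 := h2.trans h1
  rw [Nat.cast_le] at h4
  omega

theorem restrictToLine_smul {M : ℕ} (f : MvPolynomial (Fin (M + 1)) K) (x v : Fin (M + 1) → K)
    (s : K) : restrictToLine f x (s • v) =
      (restrictToLine f x v).comp (Polynomial.C s * Polynomial.X) := by
  rw [restrictToLine, restrictToLine, ← Polynomial.coe_compRingHom_apply, aeval_def, aeval_def,
    ← coe_eval₂Hom, ← coe_eval₂Hom, ← RingHom.comp_apply]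
  congr 1
  apply ringHom_ext
  · simp [Polynomial.algebraMap_eq]
  · intro i
    simp
    ring

/-- Through every point of `ℙ^M` there is a line on which a given form of degree `2(M-1)` is a
square: the coefficients of the square root and a direction are `2M-1` unknowns subject to `2M-2`
equations, with a trivial solution. -/
theorem exists_isSquareOn [IsAlgClosed K] (c : FormIndex (m + 1) (2 * m) → K)
    {u : Fin (m + 1 + 1) → K} (hu : u ≠ 0) :
    ∃ L : Submodule K (Fin (m + 1 + 1) → K), Module.finrank K L = 2 ∧ u ∈ L ∧
      IsSquareOn m (formOf c) L := by
  classical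
  obtain ⟨a, ha⟩ := Function.ne_iff.1 hu
  set x := (u a)⁻¹ • u with hx
  have hxa : x a = 1 := inv_mul_cancel₀ ha
  obtain ⟨h₀, hh₀⟩ := IsAlgClosed.exists_pow_nat_eq (eval x (formOf c)) two_pos
  -- the unknowns are the direction, with coordinate zero at `a`, and the coefficients of the square
  -- root of positive degree; the constant coefficient is the fixed square root `h₀`
  let σ := {i // i ≠ a} ⊕ Fin m
  let V : Fin (m + 1 + 1) → MvPolynomial σ K := fun i =>
    if h : i ≠ a then X (.inl ⟨i, h⟩) else 0
  let H : Fin (m + 1) → MvPolynomial σ K := Fin.cons (C h₀) fun k => X (.inr k)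
  let Q : Polynomial (MvPolynomial σ K) :=
    lineForm (fun n => C (c n)) (fun i => C (x i)) V - polyOfFin H ^ 2
  let v : (σ → K) → Fin (m + 1 + 1) → K := fun y i => if h : i ≠ a then y (.inl ⟨i, h⟩) else 0
  let P : (σ → K) → Polynomial K := fun y => polyOfFin (Fin.cons h₀ fun k => y (.inr k))
  have hQ : ∀ y : σ → K, Q.map (eval y) = restrictToLine (formOf c) x (v y) - P y ^ 2 := by
    intro y
    have h1 : ⇑(eval y) ∘ V = v y := by
      ext i
      simp only [V, v, Function.comp_apply]
      split_ifs <;> simp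
    have h2 : ⇑(eval y) ∘ H = Fin.cons h₀ fun k => y (.inr k) := by
      ext k
      refine Fin.cases ?_ (fun k => ?_) k <;> simp [H]
    rw [Polynomial.map_sub, Polynomial.map_pow, map_lineForm, map_polyOfFin, h1, h2]
    simp only [Function.comp_def, eval_C]
    rfl
  have hv0 : v 0 = 0 := by
    ext i
    simp [v]
  have hline0 : restrictToLine (formOf c) x 0 = Polynomial.C (h₀ ^ 2) := by
    have : Infinite K := IsAlgClosed.instInfinite
    refine Polynomial.funext fun t => ?_
    rw [eval_restrictToLine, smul_zero, add_zero, Polynomial.eval_C, hh₀]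
  have hP0 : P 0 = Polynomial.C h₀ := by
    rw [show P 0 = polyOfFin (Fin.cons h₀ fun k => 0) from rfl, polyOfFin, Fin.sum_univ_succ]
    simp
  obtain ⟨y, hy0, hy⟩ := exists_ne_zero_forall_eval_eq_zero (r := 2 * m) (σ := σ) (by
      simp only [σ, Fintype.card_sum, Fintype.card_fin, ne_eq, Fintype.card_subtype_compl,
        Fintype.card_unique]
      omega) (fun k => Q.coeff (k + 1)) fun k => by
    rw [← Polynomial.coeff_map, hQ, hv0, hline0, hP0, ← Polynomial.C_pow, sub_self,
      Polynomial.coeff_zero]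
  have hPdeg : (P y).natDegree ≤ m := natDegree_polyOfFin_le _
  have hPcoeff : ∀ k : Fin m, (P y).coeff (k + 1) = y (.inr k) := fun k =>
    coeff_polyOfFin (Fin.cons h₀ fun k => y (.inr k)) k.succ
  have hPzero : (P y).coeff 0 = h₀ := coeff_polyOfFin (Fin.cons h₀ fun k => y (.inr k)) 0
  have hsq : restrictToLine (formOf c) x (v y) = P y ^ 2 := by
    rw [← sub_eq_zero]
    ext d
    rw [Polynomial.coeff_zero]
    rcases d with _ | d
    · rw [Polynomial.coeff_sub, coeff_zero_restrictToLine, pow_two, Polynomial.mul_coeff_zero,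
        hPzero, ← hh₀]
      ring
    · rcases lt_or_ge d (2 * m) with hd | hd
      · rw [← hQ, Polynomial.coeff_map]
        exact hy ⟨d, hd⟩
      · refine Polynomial.coeff_eq_zero_of_natDegree_lt (lt_of_le_of_lt ?_ (Nat.lt_succ_of_le hd))
        refine (Polynomial.natDegree_sub_le_of_le
          (natDegree_restrictToLine_le (formOf_isHomogeneous c) x _)
          (Polynomial.natDegree_pow_le_of_le 2 hPdeg)).trans (max_self _).le
  -- if the direction were zero, the square root would be constant and the solution trivial
  have hvne : v y ≠ 0 := by
    intro h0
    have hconst : (P y).natDegree = 0 := by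
      rw [h0, hline0] at hsq
      have := congrArg Polynomial.natDegree hsq
      rw [Polynomial.natDegree_pow, Polynomial.natDegree_C] at this
      omega
    apply hy0
    ext (i | k)
    · have := congrFun h0 i
      simpa [v, i.2] using this
    · rw [← hPcoeff k]
      exact Polynomial.coeff_eq_zero_of_natDegree_lt (by omega)
  obtain ⟨b, hb⟩ := Function.ne_iff.1 hvne
  have hva : v y a = 0 := by simp [v]
  have hvb' : ((v y b)⁻¹ • v y) b = 1 := inv_mul_cancel₀ hb
  have hva' : ((v y b)⁻¹ • v y) a = 0 := by rw [Pi.smul_apply, hva, smul_zero]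
  have hsq' : restrictToLine (formOf c) x ((v y b)⁻¹ • v y) =
      ((P y).comp (Polynomial.C (v y b)⁻¹ * Polynomial.X)) ^ 2 := by
    rw [restrictToLine_smul, hsq, Polynomial.pow_comp]
  have hdeg' : ((P y).comp (Polynomial.C (v y b)⁻¹ * Polynomial.X)).natDegree ≤ m := by
    rw [Polynomial.natDegree_comp, Polynomial.natDegree_C_mul_X _ (inv_ne_zero hb), mul_one]
    exact hPdeg
  generalize (v y b)⁻¹ • v y = v' at *
  have hlin : LinearIndependent K ![x, v'] := by
    rw [LinearIndependent.pair_iff]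
    intro s t hst
    have h1 := congrFun hst a
    simp [hxa, hva'] at h1
    have h2 := congrFun hst b
    simp [h1, hvb'] at h2
    exact ⟨h1, h2⟩
  refine ⟨Submodule.span K {x, v'}, ?_, ?_, _, isHomogeneous_aeval_lineParamForm x a b _ m,
    fun u hu => eval_eq_sq_of_restrictToLine_eq_sq hxa hva' hvb' (formOf_isHomogeneous c) hdeg'
      hsq' hu⟩
  · have := finrank_span_eq_card hlin
    rw [Matrix.range_cons_cons_empty] at this
    simpa using this
  · rw [← Submodule.smul_mem_iff _ (inv_ne_zero ha)]
    exact Submodule.subset_span (by simp [hx])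

/-- The sign of the square root is chosen such that the section passes through the given point. -/
theorem IsSquareOn.exists_lineCurve [Infinite K] (hm : 0 < m)
    {f : MvPolynomial (Fin (m + 1 + 1)) K} {L : Submodule K (Fin (m + 1 + 1) → K)}
    (hL : Module.finrank K L = 2) (h : IsSquareOn m f L) {w : Option (Fin (m + 1 + 1)) → K}
    (hw : w ≠ 0) (hwL : w ∘ some ∈ L) (hwf : w none ^ 2 = eval (w ∘ some) f) :
    ∃ g : MvPolynomial (Fin (m + 1 + 1)) K, g.IsHomogeneous m ∧
      lineCurve L g ∈ doubleSpaceLinesThrough f (WeightedProj.mk w hw) := by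
  obtain ⟨g, hg, hfg⟩ := h
  rw [hfg _ hwL] at hwf
  rcases sq_eq_sq_iff_eq_or_eq_neg.1 hwf with h | h
  · exact ⟨g, hg, isCurveOfDegree_lineCurve hm hL hg hfg, w, hw, rfl, hwL, h⟩
  · refine ⟨-g, hg.neg, isCurveOfDegree_lineCurve hm hL hg.neg fun u hu => ?_, w, hw, rfl, hwL, ?_⟩
    · rw [hfg u hu, map_neg, neg_sq]
    · rw [h, map_neg]

theorem lineCurve_congr {M : ℕ} {L : Submodule K (Fin (M + 1) → K)}
    {g g' : MvPolynomial (Fin (M + 1)) K} (h : ∀ u ∈ L, eval u g = eval u g') :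
    lineCurve L g = lineCurve L g' := by
  ext p
  constructor
  · rintro ⟨w, hw, rfl, hL, hn⟩
    exact ⟨w, hw, rfl, hL, hn.trans (h _ hL)⟩
  · rintro ⟨w, hw, rfl, hL, hn⟩
    exact ⟨w, hw, rfl, hL, hn.trans (h _ hL).symm⟩

/-- The square root of the restriction of `f` to `L` is unique up to sign, so there are at most two
sections over `L`. -/
theorem finite_lineCurve [Infinite K] {M : ℕ} (f : MvPolynomial (Fin (M + 1)) K)
    {L : Submodule K (Fin (M + 1) → K)} (hL : Module.finrank K L = 2) :
    {C | ∃ g : MvPolynomial (Fin (M + 1)) K, (∀ u ∈ L, eval u f = eval u g ^ 2) ∧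
      C = lineCurve L g}.Finite := by
  obtain ⟨a, b, x, v, hxa, hva, hvb, -, rfl⟩ := exists_normalized_basis hL
  by_cases h : ∃ g₀ : MvPolynomial (Fin (M + 1)) K,
      ∀ u ∈ Submodule.span K {x, v}, eval u f = eval u g₀ ^ 2
  · obtain ⟨g₀, hg₀⟩ := h
    refine (Set.toFinite {lineCurve (Submodule.span K {x, v}) g₀,
      lineCurve (Submodule.span K {x, v}) (-g₀)}).subset ?_
    rintro _ ⟨g, hg, rfl⟩
    have hsq : lineRestrict x v g ^ 2 = lineRestrict x v g₀ ^ 2 := by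
      refine MvPolynomial.funext fun y => ?_
      rw [map_pow, map_pow, eval_lineRestrict, eval_lineRestrict, ← hg _ (linePoint_mem y),
        hg₀ _ (linePoint_mem y)]
    refine (sq_eq_sq_iff_eq_or_eq_neg.1 hsq).imp (fun h => ?_) fun h => ?_
    · refine lineCurve_congr fun u hu => ?_
      rw [← linePoint_lineParam hxa hva hvb hu, ← eval_lineRestrict, h, eval_lineRestrict]
    · refine lineCurve_congr fun u hu => ?_
      rw [← linePoint_lineParam hxa hva hvb hu, ← eval_lineRestrict, h, map_neg, map_neg,
        eval_lineRestrict]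
  · refine Set.finite_empty.subset ?_
    rintro _ ⟨g, hg, -⟩
    exact h ⟨g, hg⟩

theorem mem_linesThrough_mk {M : ℕ} {u : Fin (M + 1) → K} (hu : u ≠ 0)
    {L : Submodule K (Fin (M + 1) → K)} :
    L ∈ linesThrough (Projectivization.mk K u hu) ↔ Module.finrank K L = 2 ∧ u ∈ L := by
  rw [linesThrough, Set.mem_ofPred_eq, Projectivization.submodule_mk,
    Submodule.span_singleton_le_iff_mem]

/-- Lines on the double space lie two by two over the lines in `ℙ^M` to which the restriction of
the branch divisor is divisible by two. -/
theorem forall_finite_doubleSpaceLinesThrough_iff [IsAlgClosed K] (hm : 0 < m)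
    {f : MvPolynomial (Fin (m + 1 + 1)) K} (hf : f.IsHomogeneous (2 * m)) :
    (∀ p ∈ doubleSpace f, (doubleSpaceLinesThrough f p).Finite) ↔
      ∀ x : ℙ K (Fin (m + 1 + 1) → K), {L | L ∈ linesThrough x ∧ DivisibleByTwoOn f L}.Finite := by
  have : Infinite K := IsAlgClosed.instInfinite
  constructor
  · intro h x
    induction x using Projectivization.ind with
    | h u hu =>
      obtain ⟨h₀, hh₀⟩ := IsAlgClosed.exists_pow_nat_eq (eval u f) two_pos
      let w : Option (Fin (m + 1 + 1)) → K := fun o => o.elim h₀ u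
      have hw : w ≠ 0 := fun h0 => hu (funext fun i => congrFun h0 (some i))
      have hwf : w none ^ 2 = eval (w ∘ some) f := hh₀
      have hex : ∀ L ∈ {L | L ∈ linesThrough (Projectivization.mk K u hu) ∧ DivisibleByTwoOn f L},
          ∃ g : MvPolynomial (Fin (m + 1 + 1)) K, g.IsHomogeneous m ∧
            lineCurve L g ∈ doubleSpaceLinesThrough f (WeightedProj.mk w hw) := by
        rintro L ⟨hL, hdiv⟩
        rw [mem_linesThrough_mk] at hL
        exact (hdiv.isSquareOn hf hL.1).exists_lineCurve hm hL.1 hw hL.2 hwf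
      choose! g hg hgmem using hex
      refine Set.Finite.of_injOn (f := fun L => lineCurve L (g L)) hgmem ?_
        (h _ ⟨w, hw, rfl, hwf⟩)
      intro L hL L' hL' heq
      exact le_antisymm (lineCurve_le (hg L hL) (hg L' hL') heq)
        (lineCurve_le (hg L' hL') (hg L hL) heq.symm)
  · intro h p hp
    obtain ⟨w, hw, rfl⟩ := p.exists_mk
    have hwf := eval_of_mem_doubleSpace hf hp
    have hw0 := comp_some_ne_zero hm hf hw hwf
    refine ((h (Projectivization.mk K _ hw0)).biUnion (t := fun L => {C | ∃ g : MvPolynomial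
      (Fin (m + 1 + 1)) K, (∀ u ∈ L, eval u f = eval u g ^ 2) ∧ C = lineCurve L g}) fun L hL =>
        finite_lineCurve f hL.1.1).subset ?_
    rintro C ⟨hC, hpC⟩
    obtain ⟨L, g, hL, hg, hfg, rfl⟩ := hC.exists_eq_lineCurve hm hf
    have hwL : w ∘ some ∈ L := ((mem_coneOf_lineCurve hg).1 ⟨hw, hpC⟩).2.1
    refine Set.mem_biUnion (x := L) ⟨(mem_linesThrough_mk hw0).2 ⟨hL, hwL⟩, ?_⟩ ⟨g, hfg, rfl⟩
    exact IsSquareOn.divisibleByTwoOn (k := m) ⟨g, hg, hfg⟩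

/-- A line through the projection of the point on which the form is a square lifts to a line through
the point. -/
theorem doubleSpaceLinesThrough_nonempty [IsAlgClosed K] (hm : 0 < m)
    (c : FormIndex (m + 1) (2 * m) → K) {p : WeightedProj K (m + 1)}
    (hp : p ∈ doubleSpace (formOf c)) : (doubleSpaceLinesThrough (formOf c) p).Nonempty := by
  have : Infinite K := IsAlgClosed.instInfinite
  obtain ⟨w, hw, rfl⟩ := p.exists_mk
  have hwf := eval_of_mem_doubleSpace (formOf_isHomogeneous c) hp
  obtain ⟨L, hL, hwL, hsq⟩ := exists_isSquareOn c
    (comp_some_ne_zero hm (formOf_isHomogeneous c) hw hwf)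
  obtain ⟨g, -, hg⟩ := hsq.exists_lineCurve hm hL hw hwL hwf
  exact ⟨_, hg⟩

end LinesThroughPoints

theorem proposition0p4 {K : Type*} [Field K] [IsAlgClosed K] [CharZero K]
    (M : ℕ) (hM : 4 ≤ M) :
    -- for a generic form the following three properties hold
    (∃ G : MvPolynomial (FormIndex M (2 * (M - 1))) K, G ≠ 0 ∧
      ∀ c : FormIndex M (2 * (M - 1)) → K, MvPolynomial.eval c G ≠ 0 →
        IsSmoothForm (formOf c) ∧
        (∀ p ∈ doubleSpace (formOf c),
          (doubleSpaceLinesThrough (formOf c) p).Nonempty ∧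
          (doubleSpaceLinesThrough (formOf c) p).Finite) ∧
        (∀ x : ℙ K (Fin (M + 1) → K),
          {L | L ∈ linesThrough x ∧ DivisibleByTwoOn (formOf c) L}.Finite)) ∧
    -- for each smooth branch hypersurface the two finiteness properties are equivalent
    (∀ c : FormIndex M (2 * (M - 1)) → K, IsSmoothForm (formOf c) →
      ((∀ p ∈ doubleSpace (formOf c), (doubleSpaceLinesThrough (formOf c) p).Finite) ↔
        (∀ x : ℙ K (Fin (M + 1) → K),
          {L | L ∈ linesThrough x ∧ DivisibleByTwoOn (formOf c) L}.Finite))) ∧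
    -- for each point the bad forms have codimension at least `M + 1`
    (∀ x : ℙ K (Fin (M + 1) → K), ((M + 1 : ℕ) : ℕ∞) ≤ zariskiCodim (badForms x)) := by
  obtain ⟨m, rfl⟩ : ∃ m, M = m + 1 := ⟨M - 1, by omega⟩
  have hm : 0 < m := by omega
  refine ⟨?_, fun c _ => forall_finite_doubleSpaceLinesThrough_iff hm (formOf_isHomogeneous c),
    le_zariskiCodim_badForms⟩
  obtain ⟨G, hG, h⟩ := exists_ne_zero_forall_isSmoothForm_and_finite (K := K) hm
  refine ⟨G, hG, fun c hc => ?_⟩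
  obtain ⟨hsmooth, hfin⟩ := h c hc
  exact ⟨hsmooth, fun p hp => ⟨doubleSpaceLinesThrough_nonempty hm c hp,
    (forall_finite_doubleSpaceLinesThrough_iff hm (formOf_isHomogeneous c)).2 hfin p hp⟩, hfin⟩
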